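/- **Setting.** Let $n\ge 1$, $h_0>0$, $h_\pm\in\mathcal S(\mathbf R)$ real, $U_0,\dots,U_n\in\mathbf R$, and rest levels $-h_0<\ell_1<\dots<\ell_n<h_0$. For functions $\eta_1,\dots,\eta_n$ of $(x,t)\in\mathbf R\times(0,\infty)$ put $\Gamma_i=\{y=\eta_i(x,t)\}$, $\mathcal B^\pm=\{y=\pm h_0+h_\pm(x)\}$. Let $\Omega_i$ ($1\le i\le n-1$) be the region between $\Gamma_i$ and $\Gamma_{i+1}$, $\Omega_0$ the region between $\mathcal B^-$ and $\Gamma_1$, and $\Omega_n$ the region between $\Gamma_n$ and $\mathcal B^+$. It is assumed that these surfaces are strictly ordered for all $x$ and $t>0$. Write $\partial_U=\partial_t+U\partial_x$ and $N=(-\partial_xf,1)$ for the upward normal of $\{y=f\}$. *Function classes.* "Vanishes" means: tends to $0$ as $|x|\to\infty$, locally uniformly in $t>0$ (and uniformly in $y$). "Dominated" means: bounded by an integrable function of $x$, locally uniformly in $t>0$. The $\eta_i$ are $C^2$ in $(x,t)$ and $C^4$ in $x$; $\eta_i-\ell_i$ vanishes; $\partial_x\eta_i,\partial_t\eta_i,\partial_x^2\eta_i,\partial_t\partial_x\eta_i,\partial_t^2\eta_i$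 vanish and are dominated. A function $\xi(x,t)$ is an *admissible boundary potential* if it is $C^2$, $\xi$ and $\partial_t\xi$ vanish, and $\partial_x\xi,\partial_x^2\xi,\partial_t\partial_x\xi$ vanish and are dominated. **Free-boundary problem (BVP).** Potentials $\phi_i(x,y,t)$, $0\le i\le n$, that are $C^1$ up to the boundary of the space-time region of $\Omega_i$, vanish together with their first derivatives, have admissible boundary values on the two surfaces bounding $\Omega_i$, and satisfy for all $t>0$: $\Delta\phi_i=0$ in $\Omega_i$; for $1\le i\le n$, on $\Gamma_i$, $$(U_{i-1}+\partial_x\phi_{i-1},\partial_y\phi_{i-1})\cdot N=\partial_t\eta_i=(U_i+\partial_x\phi_i,\partial_y\phi_i)\cdot N,$$ $$\partial_t^2\eta_i+\partial_x^4\eta_i+\partial_{U_{i-1}}\phi_{i-1}+\tfrac12\|\nabla\phi_{i-1}\|^2=\partial_{U_i}\phi_i+\tfrac12\|\nabla\phi_i\|^2;\qquad(\ast)$$ and $(U_n+\partial_x\phi_n,\partial_y\phi_n)\cdot N=0$ on $\mathcal B^+$, $(U_0+\partial_x\phi_0,\partial_y\phi_0)\cdot N=0$ on $\mathcal B^-$.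 Let $\xi_i^+$ and $\xi_i^-$ denote the values of $\phi_i$ on the upper and the lower surface bounding $\Omega_i$. **Non-local problem (NL).** The $3n+2$ functions $\eta_i$ ($1\le i\le n$), $\xi_i^\pm$ ($0\le i\le n$) are in the classes above, the surfaces are strictly ordered, and for all $t>0$: * ($2n-2$ internal equations) for all $k\in\mathbf R$, $1\le i\le n-1$, $$\int e^{-\mathrm ikx}\big(\partial_{U_i}\eta_i\sinh(k\eta_i)+\mathrm i\,\partial_x\xi_i^-\cosh(k\eta_i)-\partial_{U_i}\eta_{i+1}\sinh(k\eta_{i+1})-\mathrm i\,\partial_x\xi_i^+\cosh(k\eta_{i+1})\big)dx=0,$$ $$\int e^{-\mathrm ikx}\big(\partial_{U_i}\eta_i\cosh(k\eta_i)+\mathrm i\,\partial_x\xi_i^-\sinh(k\eta_i)-\partial_{U_i}\eta_{i+1}\cosh(k\eta_{i+1})-\mathrm i\,\partial_x\xi_i^+\sinh(k\eta_{i+1})\big)dx=0;$$ * ($4$ external equations) for all $k\in\mathbf R$, with $b_+=h_0+h_+$ and $b_-=h_0-h_-$, $$\int e^{-\mathrm ikx}\big(\partial_{U_n}\eta_n\sinh(k\eta_n)+\mathrm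 i\,\partial_x\xi_n^-\cosh(k\eta_n)-U_nh_+'\sinh(kb_+)-\mathrm i\,\partial_x\xi_n^+\cosh(kb_+)\big)dx=0,$$ $$\int e^{-\mathrm ikx}\big(\partial_{U_n}\eta_n\cosh(k\eta_n)+\mathrm i\,\partial_x\xi_n^-\sinh(k\eta_n)-U_nh_+'\cosh(kb_+)-\mathrm i\,\partial_x\xi_n^+\sinh(kb_+)\big)dx=0,$$ $$\int e^{-\mathrm ikx}\big(\partial_{U_0}\eta_1\sinh(k\eta_1)+\mathrm i\,\partial_x\xi_0^+\cosh(k\eta_1)+U_0h_-'\sinh(kb_-)-\mathrm i\,\partial_x\xi_0^-\cosh(kb_-)\big)dx=0,$$ $$\int e^{-\mathrm ikx}\big(\partial_{U_0}\eta_1\cosh(k\eta_1)+\mathrm i\,\partial_x\xi_0^+\sinh(k\eta_1)-U_0h_-'\cosh(kb_-)+\mathrm i\,\partial_x\xi_0^-\sinh(kb_-)\big)dx=0;$$ * ($n$ Bernoulli-type equations) for $1\le i\le n$, equation $(\ast)$ holds on $\Gamma_i$ with the derivatives of $\phi_{i-1}$ and $\phi_i$ replaced by the expressions below, taken with $(U,\xi)=(U_{i-1},\xi_{i-1}^+)$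 and $(U,\xi)=(U_i,\xi_i^-)$ respectively, and $\eta=\eta_i$: $$\partial_x\phi=\frac{\partial_x\xi-\partial_x\eta\,\partial_U\eta}{1+(\partial_x\eta)^2},\quad \partial_y\phi=\frac{\partial_x\xi\,\partial_x\eta+\partial_U\eta}{1+(\partial_x\eta)^2},\quad \partial_t\phi=\partial_t\xi-\frac{\partial_t\eta\,(\partial_U\eta+\partial_x\eta\,\partial_x\xi)}{1+(\partial_x\eta)^2}.\qquad(\ast\ast)$$ **Proposition.** The solution of (BVP) is completely determined by the $3n+2$ functions $\eta_i,\xi_i^\pm$, and (BVP) is equivalent to (NL): 1. If $(\eta_i,\phi_i)$ solves (BVP), then $\eta_i$ and the boundary values $\xi_i^\pm$ of $\phi_i$ solve (NL), and the derivatives of $\phi_{i-1}$ and $\phi_i$ on $\Gamma_i$ are given by $(\ast\ast)$. 2. If $(\eta_i,\xi_i^\pm)$ solves (NL), then there are potentials $\phi_i$ with boundary values $\xi_i^\pm$ such that $(\eta_i,\phi_i)$ solves (BVP), and they are unique on the closures of the $\Omega_i$. -/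

import Mathlib

open MeasureTheory Set Complex
open scoped SchwartzMap

noncomputable section

namespace FluidPlates

/-- Partial derivative in the horizontal variable `x` of a function of `(x, t)`. -/
def dX (f : ℝ → ℝ → ℝ) (x t : ℝ) : ℝ := deriv (fun x' => f x' t) x

/-- Partial derivative in the time variable `t` of a function of `(x, t)`. -/
def dT (f : ℝ → ℝ → ℝ) (x t : ℝ) : ℝ := deriv (fun s => f x s) t

/-- The transport operator `∂_U = ∂_t + U ∂_x` on functions of `(x, t)`. -/
def dU (U : ℝ) (f : ℝ → ℝ → ℝ) (x t : ℝ) : ℝ := dT f x t + U * dX f x t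

/-- `f (x, t) → 0` as `|x| → ∞`, locally uniformly in `t > 0`. -/
def Vanishes (f : ℝ → ℝ → ℝ) : Prop :=
  ∀ t > 0, ∀ ε > 0, ∃ δ > 0, ∃ R : ℝ, ∀ s x : ℝ,
    0 < s → |s - t| < δ → R < |x| → |f x s| < ε

/-- `f (·, t)` is bounded by an integrable function of `x`, locally uniformly in `t > 0`. -/
def LocallyDominated (f : ℝ → ℝ → ℝ) : Prop :=
  ∀ t > 0, ∃ G : ℝ → ℝ, Integrable G ∧ ∃ δ > 0, ∀ s x : ℝ,
    0 < s → |s - t| < δ → |f x s| ≤ G x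

/-- Fixed data: `n ≥ 1` plates in the channel `-h₀ + h₋ (x) < y < h₀ + h₊ (x)`, the mean
velocities `U i` of the `n + 1` fluids, and the levels of the plates at rest. Plates are numbered
by `Fin n` and layers by `Fin (n + 1)`, from the bottom upwards: plate `j` has layer `j.castSucc`
below it and layer `j.succ` above it. -/
structure Channel (n : ℕ) where
  one_le : 1 ≤ n
  h₀ : ℝ
  h₀_pos : 0 < h₀
  hTop : 𝓢(ℝ, ℝ)
  hBot : 𝓢(ℝ, ℝ)
  U : Fin (n + 1) → ℝ
  level : Fin n → ℝ
  level_strictMono : StrictMono level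
  level_gt : ∀ j, -h₀ < level j
  level_lt : ∀ j, level j < h₀

variable {n : ℕ}

/-- The upper wall, as a (constant in time) function of `(x, t)`. -/
def Channel.top (C : Channel n) : ℝ → ℝ → ℝ := fun x _ => C.h₀ + C.hTop x

/-- The lower wall, as a (constant in time) function of `(x, t)`. -/
def Channel.bot (C : Channel n) : ℝ → ℝ → ℝ := fun x _ => -C.h₀ + C.hBot x

/-- The lowest plate. -/
def Channel.first (C : Channel n) : Fin n := ⟨0, C.one_le⟩

/-- The highest plate. -/
def Channel.last (C : Channel n) : Fin n := ⟨n - 1, Nat.sub_lt C.one_le Nat.one_pos⟩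

/-- The surface bounding layer `i` from below: the lower wall for the bottom layer, otherwise the
plate just below. -/
def floor (C : Channel n) (η : Fin n → ℝ → ℝ → ℝ) (i : Fin (n + 1)) : ℝ → ℝ → ℝ :=
  Fin.cons (α := fun _ => ℝ → ℝ → ℝ) C.bot η i

/-- The surface bounding layer `i` from above: the upper wall for the top layer, otherwise the
plate just above. -/
def ceil (C : Channel n) (η : Fin n → ℝ → ℝ → ℝ) (i : Fin (n + 1)) : ℝ → ℝ → ℝ :=
  Fin.snoc (α := fun _ => ℝ → ℝ → ℝ) η C.top i

/-- Layer `i` at time `t`, an open subset of the plane `ℂ ∋ x + i y`. -/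
def layer (C : Channel n) (η : Fin n → ℝ → ℝ → ℝ) (i : Fin (n + 1)) (t : ℝ) : Set ℂ :=
  {z | floor C η i z.re t < z.im ∧ z.im < ceil C η i z.re t}

/-- The space-time region of points `(x, y, t)`, `t > 0`, swept by layer `i` together with its
bounding surfaces. -/
def closedLayer (C : Channel n) (η : Fin n → ℝ → ℝ → ℝ) (i : Fin (n + 1)) : Set (ℝ × ℝ × ℝ) :=
  {p | 0 < p.2.2 ∧ floor C η i p.1 p.2.2 ≤ p.2.1 ∧ p.2.1 ≤ ceil C η i p.1 p.2.2}

/-- Regularity and decay of a plate: the amplitude `η - level` and its derivatives decay. -/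
structure PlateClass (level : ℝ) (η : ℝ → ℝ → ℝ) : Prop where
  contDiffOn : ContDiffOn ℝ 2 (fun p : ℝ × ℝ => η p.1 p.2) (univ ×ˢ Ioi 0)
  contDiff_x : ∀ t > 0, ContDiff ℝ 4 (fun x => η x t)
  vanishes : Vanishes (fun x t => η x t - level)
  dX_class : Vanishes (dX η) ∧ LocallyDominated (dX η)
  dT_class : Vanishes (dT η) ∧ LocallyDominated (dT η)
  dXX_class : Vanishes (dX (dX η)) ∧ LocallyDominated (dX (dX η))
  dTX_class : Vanishes (dT (dX η)) ∧ LocallyDominated (dT (dX η))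
  dTT_class : Vanishes (dT (dT η)) ∧ LocallyDominated (dT (dT η))

/-- Regularity and decay of a boundary potential `ξ`. -/
structure TraceClass (ξ : ℝ → ℝ → ℝ) : Prop where
  contDiffOn : ContDiffOn ℝ 2 (fun p : ℝ × ℝ => ξ p.1 p.2) (univ ×ˢ Ioi 0)
  vanishes : Vanishes ξ
  dT_vanishes : Vanishes (dT ξ)
  dX_class : Vanishes (dX ξ) ∧ LocallyDominated (dX ξ)
  dXX_class : Vanishes (dX (dX ξ)) ∧ LocallyDominated (dX (dX ξ))
  dTX_class : Vanishes (dT (dX ξ)) ∧ LocallyDominated (dT (dX ξ))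

/-- The admissible plate configurations: each plate is in the class above and the surfaces do not
touch. -/
structure AdmissiblePlates (C : Channel n) (η : Fin n → ℝ → ℝ → ℝ) : Prop where
  plate : ∀ j, PlateClass (C.level j) (η j)
  ordered : ∀ i x t, 0 < t → floor C η i x t < ceil C η i x t

/-! ### The free-boundary problem -/

/-- `∂_x F` at a point of the set `D`; on the boundary, the derivative from within `D`. -/
def pX (D : Set (ℝ × ℝ × ℝ)) (F : ℝ × ℝ × ℝ → ℝ) (p : ℝ × ℝ × ℝ) : ℝ :=
  fderivWithin ℝ F D p (1, 0, 0)

/-- `∂_y F` at a point of the set `D`; on the boundary, the derivative from within `D`. -/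
def pY (D : Set (ℝ × ℝ × ℝ)) (F : ℝ × ℝ × ℝ → ℝ) (p : ℝ × ℝ × ℝ) : ℝ :=
  fderivWithin ℝ F D p (0, 1, 0)

/-- `∂_t F` at a point of the set `D`; on the boundary, the derivative from within `D`. -/
def pT (D : Set (ℝ × ℝ × ℝ)) (F : ℝ × ℝ × ℝ → ℝ) (p : ℝ × ℝ × ℝ) : ℝ :=
  fderivWithin ℝ F D p (0, 0, 1)

/-- `F (x, y, t) → 0` as `|x| → ∞` inside `D`, uniformly in `y` and locally uniformly in
`t > 0`. -/
def VanishesOn (D : Set (ℝ × ℝ × ℝ)) (F : ℝ × ℝ × ℝ → ℝ) : Prop :=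
  ∀ t > 0, ∀ ε > 0, ∃ δ > 0, ∃ R : ℝ, ∀ s x y : ℝ,
    (x, y, s) ∈ D → |s - t| < δ → R < |x| → |F (x, y, s)| < ε

/-- `ξ⁻ i`: the potential of layer `i` on the surface below it. -/
def traceBelow (C : Channel n) (η : Fin n → ℝ → ℝ → ℝ) (φ : Fin (n + 1) → ℝ × ℝ × ℝ → ℝ)
    (i : Fin (n + 1)) (x t : ℝ) : ℝ := φ i (x, floor C η i x t, t)

/-- `ξ⁺ i`: the potential of layer `i` on the surface above it. -/
def traceAbove (C : Channel n) (η : Fin n → ℝ → ℝ → ℝ) (φ : Fin (n + 1) → ℝ × ℝ × ℝ → ℝ)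
    (i : Fin (n + 1)) (x t : ℝ) : ℝ := φ i (x, ceil C η i x t, t)

/-- `(U + ∂_x φ, ∂_y φ) · (-∂_x f, 1)` at the point of the surface `y = f (x, t)`, for the
potential of layer `i`. -/
def normalVelocity (C : Channel n) (η : Fin n → ℝ → ℝ → ℝ) (φ : Fin (n + 1) → ℝ × ℝ × ℝ → ℝ)
    (i : Fin (n + 1)) (f : ℝ → ℝ → ℝ) (x t : ℝ) : ℝ :=
  (C.U i + pX (closedLayer C η i) (φ i) (x, f x t, t)) * (-dX f x t)
    + pY (closedLayer C η i) (φ i) (x, f x t, t) * 1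

/-- `∂_U φ + ½ ‖∇ φ‖²` for layer `i`, at the point of the surface `y = f (x, t)`. -/
def bernoulliTerm (C : Channel n) (η : Fin n → ℝ → ℝ → ℝ) (φ : Fin (n + 1) → ℝ × ℝ × ℝ → ℝ)
    (i : Fin (n + 1)) (f : ℝ → ℝ → ℝ) (x t : ℝ) : ℝ :=
  pT (closedLayer C η i) (φ i) (x, f x t, t)
    + C.U i * pX (closedLayer C η i) (φ i) (x, f x t, t)
    + (1 / 2) * (pX (closedLayer C η i) (φ i) (x, f x t, t) ^ 2
      + pY (closedLayer C η i) (φ i) (x, f x t, t) ^ 2)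

/-- `(η, φ)` is a classical solution of the free-boundary problem. -/
structure IsSolution (C : Channel n) (η : Fin n → ℝ → ℝ → ℝ)
    (φ : Fin (n + 1) → ℝ × ℝ × ℝ → ℝ) : Prop where
  plates : AdmissiblePlates C η
  contDiffOn : ∀ i, ContDiffOn ℝ 1 (φ i) (closedLayer C η i)
  vanishes : ∀ i, VanishesOn (closedLayer C η i) (φ i)
  pX_vanishes : ∀ i, VanishesOn (closedLayer C η i) (pX (closedLayer C η i) (φ i))
  pY_vanishes : ∀ i, VanishesOn (closedLayer C η i) (pY (closedLayer C η i) (φ i))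
  pT_vanishes : ∀ i, VanishesOn (closedLayer C η i) (pT (closedLayer C η i) (φ i))
  traceBelow_class : ∀ i, TraceClass (traceBelow C η φ i)
  traceAbove_class : ∀ i, TraceClass (traceAbove C η φ i)
  harmonic : ∀ i, ∀ t > 0, InnerProductSpace.HarmonicOnNhd
    (fun z : ℂ => φ i (z.re, z.im, t)) (layer C η i t)
  kinematic_below : ∀ (j : Fin n) (x : ℝ), ∀ t > 0,
    normalVelocity C η φ j.castSucc (η j) x t = dT (η j) x t
  kinematic_above : ∀ (j : Fin n) (x : ℝ), ∀ t > 0,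
    normalVelocity C η φ j.succ (η j) x t = dT (η j) x t
  beam : ∀ (j : Fin n) (x : ℝ), ∀ t > 0,
    iteratedDeriv 2 (fun s => η j x s) t + iteratedDeriv 4 (fun x' => η j x' t) x
      + bernoulliTerm C η φ j.castSucc (η j) x t = bernoulliTerm C η φ j.succ (η j) x t
  neumann_top : ∀ x : ℝ, ∀ t > 0, normalVelocity C η φ (Fin.last n) C.top x t = 0
  neumann_bot : ∀ x : ℝ, ∀ t > 0, normalVelocity C η φ 0 C.bot x t = 0

/-! ### The non-local problem -/

/-- `∂_x φ` on the surface `y = η`, in terms of `η` and `ξ = φ|_{y = η}`. -/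
def surfX (U : ℝ) (η ξ : ℝ → ℝ → ℝ) (x t : ℝ) : ℝ :=
  (dX ξ x t - dX η x t * dU U η x t) / (1 + dX η x t ^ 2)

/-- `∂_y φ` on the surface `y = η`, in terms of `η` and `ξ = φ|_{y = η}`. -/
def surfY (U : ℝ) (η ξ : ℝ → ℝ → ℝ) (x t : ℝ) : ℝ :=
  (dX ξ x t * dX η x t + dU U η x t) / (1 + dX η x t ^ 2)

/-- `∂_t φ` on the surface `y = η`, in terms of `η` and `ξ = φ|_{y = η}`. -/
def surfT (U : ℝ) (η ξ : ℝ → ℝ → ℝ) (x t : ℝ) : ℝ :=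
  ((1 + dX η x t ^ 2) * dT ξ x t - dT η x t * (dU U η x t + dX η x t * dX ξ x t))
    / (1 + dX η x t ^ 2)

/-- `∂_U φ + ½ ‖∇ φ‖²` on the surface `y = η`, in terms of `η` and `ξ = φ|_{y = η}`. -/
def surfBernoulli (U : ℝ) (η ξ : ℝ → ℝ → ℝ) (x t : ℝ) : ℝ :=
  surfT U η ξ x t + U * surfX U η ξ x t
    + (1 / 2) * (surfX U η ξ x t ^ 2 + surfY U η ξ x t ^ 2)

/-- The `2n - 2` internal equations. The layer `j + 1` lies between the plates `j` and `j + 1`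
(counted from `0`). -/
structure InternalEquations (C : Channel n) (η : Fin n → ℝ → ℝ → ℝ)
    (ξp ξm : Fin (n + 1) → ℝ → ℝ → ℝ) (j : ℕ) (hj : j + 1 < n) (t k : ℝ) : Prop where
  eq₁ : let a : Fin n := ⟨j, Nat.lt_of_succ_lt hj⟩
    let b : Fin n := ⟨j + 1, hj⟩
    let i : Fin (n + 1) := ⟨j + 1, Nat.lt_succ_of_lt hj⟩
    ∫ x : ℝ, cexp (-I * k * x) *
      ((dU (C.U i) (η a) x t * Real.sinh (k * η a x t) : ℝ)
        + I * (dX (ξm i) x t * Real.cosh (k * η a x t) : ℝ)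
        - (dU (C.U i) (η b) x t * Real.sinh (k * η b x t) : ℝ)
        - I * (dX (ξp i) x t * Real.cosh (k * η b x t) : ℝ)) = 0
  eq₂ : let a : Fin n := ⟨j, Nat.lt_of_succ_lt hj⟩
    let b : Fin n := ⟨j + 1, hj⟩
    let i : Fin (n + 1) := ⟨j + 1, Nat.lt_succ_of_lt hj⟩
    ∫ x : ℝ, cexp (-I * k * x) *
      ((dU (C.U i) (η a) x t * Real.cosh (k * η a x t) : ℝ)
        + I * (dX (ξm i) x t * Real.sinh (k * η a x t) : ℝ)
        - (dU (C.U i) (η b) x t * Real.cosh (k * η b x t) : ℝ)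
        - I * (dX (ξp i) x t * Real.sinh (k * η b x t) : ℝ)) = 0

/-- The four external equations: two for the top layer, two for the bottom layer. The terms with
`U * deriv h` are the contributions `∂_U (h₀ + h₊)` and `∂_U (-h₀ + h₋)` of the walls; they vanish
when the wall is flat or the adjacent fluid has no mean flow. -/
structure ExternalEquations (C : Channel n) (η : Fin n → ℝ → ℝ → ℝ)
    (ξp ξm : Fin (n + 1) → ℝ → ℝ → ℝ) (t k : ℝ) : Prop where
  top₁ : ∫ x : ℝ, cexp (-I * k * x) *
      ((dU (C.U (Fin.last n)) (η C.last) x t * Real.sinh (k * η C.last x t) : ℝ)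
        + I * (dX (ξm (Fin.last n)) x t * Real.cosh (k * η C.last x t) : ℝ)
        - (C.U (Fin.last n) * deriv C.hTop x * Real.sinh (k * (C.h₀ + C.hTop x)) : ℝ)
        - I * (dX (ξp (Fin.last n)) x t * Real.cosh (k * (C.h₀ + C.hTop x)) : ℝ)) = 0
  top₂ : ∫ x : ℝ, cexp (-I * k * x) *
      ((dU (C.U (Fin.last n)) (η C.last) x t * Real.cosh (k * η C.last x t) : ℝ)
        + I * (dX (ξm (Fin.last n)) x t * Real.sinh (k * η C.last x t) : ℝ)
        - (C.U (Fin.last n) * deriv C.hTop x * Real.cosh (k * (C.h₀ + C.hTop x)) : ℝ)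
        - I * (dX (ξp (Fin.last n)) x t * Real.sinh (k * (C.h₀ + C.hTop x)) : ℝ)) = 0
  bot₁ : ∫ x : ℝ, cexp (-I * k * x) *
      ((dU (C.U 0) (η C.first) x t * Real.sinh (k * η C.first x t) : ℝ)
        + I * (dX (ξp 0) x t * Real.cosh (k * η C.first x t) : ℝ)
        + (C.U 0 * deriv C.hBot x * Real.sinh (k * (C.h₀ - C.hBot x)) : ℝ)
        - I * (dX (ξm 0) x t * Real.cosh (k * (C.h₀ - C.hBot x)) : ℝ)) = 0
  bot₂ : ∫ x : ℝ, cexp (-I * k * x) *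
      ((dU (C.U 0) (η C.first) x t * Real.cosh (k * η C.first x t) : ℝ)
        + I * (dX (ξp 0) x t * Real.sinh (k * η C.first x t) : ℝ)
        - (C.U 0 * deriv C.hBot x * Real.cosh (k * (C.h₀ - C.hBot x)) : ℝ)
        + I * (dX (ξm 0) x t * Real.sinh (k * (C.h₀ - C.hBot x)) : ℝ)) = 0

/-- The `3n + 2` functions `η`, `ξ⁺`, `ξ⁻` solve the non-local problem. -/
structure IsNonlocalSolution (C : Channel n) (η : Fin n → ℝ → ℝ → ℝ)
    (ξp ξm : Fin (n + 1) → ℝ → ℝ → ℝ) : Prop where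
  plates : AdmissiblePlates C η
  ξp_class : ∀ i, TraceClass (ξp i)
  ξm_class : ∀ i, TraceClass (ξm i)
  internal : ∀ (j : ℕ) (hj : j + 1 < n), ∀ t > 0, ∀ k : ℝ,
    InternalEquations C η ξp ξm j hj t k
  external : ∀ t > 0, ∀ k : ℝ, ExternalEquations C η ξp ξm t k
  beam : ∀ (j : Fin n) (x : ℝ), ∀ t > 0,
    iteratedDeriv 2 (fun s => η j x s) t + iteratedDeriv 4 (fun x' => η j x' t) x
      + surfBernoulli (C.U j.castSucc) (η j) (ξp j.castSucc) x t
      = surfBernoulli (C.U j.succ) (η j) (ξm j.succ) x t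

/-- On every plate, from below and from above, the derivatives of the potentials are the explicit
expressions in `η` and `ξ`. -/
structure SurfaceFormulas (C : Channel n) (η : Fin n → ℝ → ℝ → ℝ)
    (φ : Fin (n + 1) → ℝ × ℝ × ℝ → ℝ) (ξp ξm : Fin (n + 1) → ℝ → ℝ → ℝ)
    (j : Fin n) (x t : ℝ) : Prop where
  below_x : pX (closedLayer C η j.castSucc) (φ j.castSucc) (x, η j x t, t)
    = surfX (C.U j.castSucc) (η j) (ξp j.castSucc) x t
  below_y : pY (closedLayer C η j.castSucc) (φ j.castSucc) (x, η j x t, t)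
    = surfY (C.U j.castSucc) (η j) (ξp j.castSucc) x t
  below_t : pT (closedLayer C η j.castSucc) (φ j.castSucc) (x, η j x t, t)
    = surfT (C.U j.castSucc) (η j) (ξp j.castSucc) x t
  above_x : pX (closedLayer C η j.succ) (φ j.succ) (x, η j x t, t)
    = surfX (C.U j.succ) (η j) (ξm j.succ) x t
  above_y : pY (closedLayer C η j.succ) (φ j.succ) (x, η j x t, t)
    = surfY (C.U j.succ) (η j) (ξm j.succ) x t
  above_t : pT (closedLayer C η j.succ) (φ j.succ) (x, η j x t, t)
    = surfT (C.U j.succ) (η j) (ξm j.succ) x t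

/-- `ξ⁺` and `ξ⁻` are, for all positive times, the boundary values of the potentials `φ`. -/
def HasTraces (C : Channel n) (η : Fin n → ℝ → ℝ → ℝ) (φ : Fin (n + 1) → ℝ × ℝ × ℝ → ℝ)
    (ξp ξm : Fin (n + 1) → ℝ → ℝ → ℝ) : Prop :=
  ∀ i x t, 0 < t → traceAbove C η φ i x t = ξp i x t ∧ traceBelow C η φ i x t = ξm i x t

end FluidPlates

end

/-!
The free-boundary problem decouples into one elliptic problem per layer, and each layer can be
treated by complex analysis at a fixed time. Let `a < b` be the two surfaces of a layer, `α` and `β`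
the boundary potentials, `γ_η x = x + i η x` the parametrization of a surface, and let
`g = ∂_x ξ - i ∂_U η` (`densG`). If `φ` solves the problem in the layer, then
`f = ∂_x φ - i ∂_y φ` is holomorphic there, and on each surface the impermeability condition and
the tangential derivative of the potential say exactly that `f γ' = g`. The two non-local equations
of a layer say, for all real `k`, that `∫ e^{-ikγ_a} g_a = ∫ e^{-ikγ_b} g_b`: their sum is this
identity at `k`, their difference its conjugate at `-k` (`forall_integral_eq_zero_iff`).

From the potentials to the moments, the identity is Cauchy's theorem for `e^{-ikz} f`
(`integral_upper_eq_integral_lower`, `LayerFlow.layerData`). The formulas for the derivatives on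
the surfaces solve a linear system of three equations (`surf_formulas`). Uniqueness is the maximum
principle: the formulas determine `f` on both surfaces, and `f` decays at both ends of the layer
(`eqOn_zero_of_strip`, `LayerFlow.eqOn`).

From the moments to the potentials, the complex velocity has to be
`f z = (2πi)⁻¹ (∫ g_a / (γ_a - z) - ∫ g_b / (γ_b - z))`. For `z` far below the layer,
`1 / (γ - z)` is a Laplace integral of the exponentials `e^{-ikγ}` over `k` of one sign
(`cau_eq_laplace`), so equality of the moments makes the difference vanish there, and then
everywhere below the layer by analytic continuation (`Strip.cau_eq_of_below`). By the reflection
`y ↦ -y` it also vanishes above the layer. The jump relations of Cauchy integrals then give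
`f γ' = g` on both surfaces.

Two technical points shape the construction. First, boundary regularity: `f` is the Cauchy integral
of `F = g / γ'` with respect to `dγ`. Subtracting its value at the mirror image in the lower
surface, which is zero, and subtracting `F x` under the integral leaves an absolutely convergent
integral without singularity (`err`, `stripFn`), jointly continuous in `x`, `y`, `t` up to the
boundary and decaying as `|x| → ∞` by dominated convergence (`tendsto_err_nhds`,
`tendsto_err_zero`). Second, for the complex potential and its time derivative the densities are
bounded but need not be integrable. The difference of the kernels at two points is integrable
against bounded densities (`tau`), and differentiating in `z` or in `t` and integrating by parts
turns one density into another: `g` has the primitive `densP`, and the time derivative of the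
complex potential has the boundary value `densM = ∂_t P - i (∂_t η) F` (`hasDerivAt_tau`,
`hasDerivAt_tau_time`). All three functions, the complex potential, its `z`-derivative and its
`t`-derivative, are thus of the same form `movingFn`, and continuity of the last two up to the
boundary makes the potential of class `C¹` on the closed space-time region
(`OrderedC1.hasFDerivWithinAt_region`, `LayerData.layerFlow_potential`).
-/

noncomputable section

namespace FluidPlates
open Filter Topology

/-! ### Resolvent kernels along a graph -/

/-- The point of the graph `y = η x` over `x`, as a complex number. -/
def pt (η : ℝ → ℝ) (x : ℝ) : ℂ := x + I * η x

@[simp] lemma pt_re (η : ℝ → ℝ) (x : ℝ) : (pt η x).re = x := by simp [pt]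
@[simp] lemma pt_im (η : ℝ → ℝ) (x : ℝ) : (pt η x).im = η x := by simp [pt]

lemma abs_sub_re_le_norm_pt_sub (η : ℝ → ℝ) (x : ℝ) (z : ℂ) : |x - z.re| ≤ ‖pt η x - z‖ := by
  simpa using Complex.abs_re_le_norm (pt η x - z)

/-- Off the graph, `1 / (γ - z)` decays like `1 / |x|`, uniformly for nearby values of a parameter
on which the graph and the point depend continuously. -/
lemma eventually_norm_inv_pt_sub_le {Θ : Type*} [TopologicalSpace Θ] {θ₀ : Θ} {η : Θ → ℝ → ℝ}
    {z : Θ → ℂ} (hη : ∀ x, ContinuousAt (fun p : Θ × ℝ => η p.1 p.2) (θ₀, x))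
    (hz : ContinuousAt z θ₀) (hne : ∀ x, pt (η θ₀) x ≠ z θ₀) :
    ∃ C > 0, ∀ᶠ θ in 𝓝 θ₀, ∀ x, pt (η θ) x ≠ z θ ∧
      ‖(pt (η θ) x - z θ)⁻¹‖ ≤ C * (√(1 + x ^ 2))⁻¹ := by
  set R : ℝ := |(z θ₀).re| + 1 with hR
  have hR1 : 1 ≤ R := by rw [hR]; linarith [abs_nonneg (z θ₀).re]
  have hq : ∀ x, ContinuousAt (fun p : Θ × ℝ => ‖pt (η p.1) p.2 - z p.1‖) (θ₀, x) := by
    intro x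
    have h1 : ContinuousAt (fun p : Θ × ℝ => z p.1) (θ₀, x) :=
      ContinuousAt.comp (f := Prod.fst) (x := (θ₀, x)) hz continuousAt_fst
    have h2 := hη x
    unfold pt
    fun_prop
  have hc : Continuous (fun x => ‖pt (η θ₀) x - z θ₀‖) := by
    refine continuous_iff_continuousAt.2 fun x => ?_
    exact ContinuousAt.comp (f := fun x : ℝ => (θ₀, x)) (x := x) (hq x) (by fun_prop)
  obtain ⟨x₁, -, hx₁⟩ := (isCompact_Icc (a := -(2 * R)) (b := 2 * R)).exists_isMinOn
    ⟨0, by constructor <;> linarith⟩ hc.continuousOn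
  set m := ‖pt (η θ₀) x₁ - z θ₀‖ with hm
  have hm0 : 0 < m := norm_pos_iff.2 (sub_ne_zero.2 (hne x₁))
  have hE : ∀ᶠ θ in 𝓝 θ₀, ∀ x ∈ Icc (-(2 * R)) (2 * R), m / 2 < ‖pt (η θ) x - z θ‖ := by
    refine isCompact_Icc.eventually_forall_of_forall_eventually fun x hx => ?_
    refine (hq x).eventually_const_lt ?_
    have : m ≤ ‖pt (η θ₀) x - z θ₀‖ := hx₁ hx
    show m / 2 < ‖pt (η θ₀) x - z θ₀‖
    linarith
  have hre : ∀ᶠ θ in 𝓝 θ₀, |(z θ).re| < R := by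
    have : ContinuousAt (fun θ => |(z θ).re|) θ₀ := by fun_prop
    exact this.eventually_lt_const (by rw [hR]; linarith)
  refine ⟨max 4 (2 / m * √(1 + (2 * R) ^ 2)), by positivity, ?_⟩
  filter_upwards [hE, hre] with θ h1 h2 x
  have hs : 0 < √(1 + x ^ 2) := Real.sqrt_pos.2 (by positivity)
  have key : 0 < ‖pt (η θ) x - z θ‖ ∧
      √(1 + x ^ 2) ≤ max 4 (2 / m * √(1 + (2 * R) ^ 2)) * ‖pt (η θ) x - z θ‖ := by
    by_cases hx : x ∈ Icc (-(2 * R)) (2 * R)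
    · have h3 := h1 x hx
      refine ⟨by linarith, ?_⟩
      have h4 : √(1 + x ^ 2) ≤ √(1 + (2 * R) ^ 2) :=
        Real.sqrt_le_sqrt (by nlinarith [hx.1, hx.2])
      calc √(1 + x ^ 2) ≤ (2 / m * √(1 + (2 * R) ^ 2)) * (m / 2) := by
            rw [show 2 / m * √(1 + (2 * R) ^ 2) * (m / 2) = √(1 + (2 * R) ^ 2) by field_simp]
            exact h4
        _ ≤ _ := by gcongr; exact le_max_right _ _
    · have hx' : 2 * R < |x| := by
        by_contra! h
        exact hx ⟨by linarith [(abs_le.1 h).1], (abs_le.1 h).2⟩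
      have h3 : |x| / 2 ≤ ‖pt (η θ) x - z θ‖ := by
        refine le_trans ?_ (abs_sub_re_le_norm_pt_sub _ _ _)
        have := abs_sub_abs_le_abs_sub x (z θ).re
        linarith
      refine ⟨by linarith, ?_⟩
      have h4 : √(1 + x ^ 2) ≤ 2 * |x| := by
        rw [Real.sqrt_le_left (by positivity), mul_pow, sq_abs]
        nlinarith [sq_abs x, abs_nonneg x]
      calc √(1 + x ^ 2) ≤ 4 * (|x| / 2) := by linarith
        _ ≤ _ := by gcongr; exact le_max_left _ _
  refine ⟨fun h => by simp [h] at key, ?_⟩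
  rw [norm_inv, inv_le_comm₀ key.1 (by positivity), mul_inv, inv_inv, inv_mul_le_iff₀ (by positivity)]
  exact key.2

lemma norm_inv_pt_sub_le {η : ℝ → ℝ} (hη : Continuous η) {z : ℂ} (hne : ∀ x, pt η x ≠ z) :
    ∃ C > 0, ∀ x, ‖(pt η x - z)⁻¹‖ ≤ C * (√(1 + x ^ 2))⁻¹ := by
  obtain ⟨C, hC, h⟩ := eventually_norm_inv_pt_sub_le (Θ := Unit) (θ₀ := ()) (η := fun _ => η)
    (z := fun _ => z) (fun x => by fun_prop) continuousAt_const hne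
  exact ⟨C, hC, fun x => (h.self_of_nhds x).2⟩

lemma pt_ne_of_ne {η : ℝ → ℝ} {z : ℂ} (h : η z.re ≠ z.im) (x : ℝ) : pt η x ≠ z := by
  rintro rfl
  simp at h

lemma tendsto_inv_sqrt_one_add_sq : Tendsto (fun x : ℝ => (√(1 + x ^ 2))⁻¹) (cocompact ℝ) (𝓝 0) := by
  refine squeeze_zero' (Eventually.of_forall fun x => by positivity) ?_
    (tendsto_inv_atTop_zero.comp (tendsto_norm_cocompact_atTop (E := ℝ)))
  filter_upwards [(tendsto_norm_cocompact_atTop (E := ℝ)).eventually_gt_atTop 0] with x hx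
  simp only [Function.comp]
  gcongr
  rw [Real.norm_eq_abs]
  exact Real.abs_le_sqrt (by linarith)

/-- The difference of two resolvents `1 / (γ - z) - 1 / (γ - w)` along the graph of `η`; unlike a
single resolvent it is integrable against bounded densities. -/
def ker (η : ℝ → ℝ) (z w : ℂ) (x : ℝ) : ℂ := (pt η x - z)⁻¹ - (pt η x - w)⁻¹

/-- The regularized Cauchy integral `∫ M (1 / (γ - z) - 1 / (γ - w)) dγ` along the graph of `η`. -/
def tau (η : ℝ → ℝ) (M : ℝ → ℂ) (z w : ℂ) : ℂ :=
  ∫ x, M x * (1 + I * deriv η x) * ker η z w x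

/-- The integrand of the regularized Cauchy integral with the density `M` replaced by `M - M x`, at
the points `x + i y` and `x + i w`, after translation to `x`. The increment of `M` compensates the
singularity, whatever the position of `y` and `w`. -/
def errIntegrand (η : ℝ → ℝ) (M : ℝ → ℂ) (x y w u : ℝ) : ℂ :=
  (M (x + u) - M x) * (1 + I * deriv η (x + u)) *
    ((u + I * (η (x + u) - y))⁻¹ - (u + I * (η (x + u) - w))⁻¹)

/-- The regularized Cauchy integral with the density `M` replaced by `M - M x`, at the points
`x + i y` and `x + i w`. -/
def err (η : ℝ → ℝ) (M : ℝ → ℂ) (x y w : ℝ) : ℂ := ∫ u : ℝ, errIntegrand η M x y w u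

lemma norm_ker_le_of_bounds {η : ℝ → ℝ} {z w : ℂ} {C D x : ℝ} (hz : pt η x ≠ z) (hw : pt η x ≠ w)
    (h1 : ‖(pt η x - z)⁻¹‖ ≤ C * (√(1 + x ^ 2))⁻¹) (h2 : ‖(pt η x - w)⁻¹‖ ≤ D * (√(1 + x ^ 2))⁻¹) :
    ‖ker η z w x‖ ≤ ‖z - w‖ * C * D * (1 + x ^ 2)⁻¹ := by
  have h : ker η z w x = (z - w) * ((pt η x - z)⁻¹ * (pt η x - w)⁻¹) := by
    have h3 := sub_ne_zero.2 hz
    have h4 := sub_ne_zero.2 hw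
    unfold ker
    field_simp
    ring
  have h5 : (√(1 + x ^ 2))⁻¹ * (√(1 + x ^ 2))⁻¹ = (1 + x ^ 2)⁻¹ := by
    rw [← mul_inv, Real.mul_self_sqrt (by positivity)]
  rw [h, norm_mul, norm_mul]
  calc _ ≤ ‖z - w‖ * ((C * (√(1 + x ^ 2))⁻¹) * (D * (√(1 + x ^ 2))⁻¹)) := by
          gcongr
          exact (norm_nonneg _).trans h1
    _ = _ := by rw [← h5]; ring

lemma norm_ker_le {η : ℝ → ℝ} (hη : Continuous η) {z w : ℂ} (hz : ∀ x, pt η x ≠ z)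
    (hw : ∀ x, pt η x ≠ w) : ∃ C, ∀ x, ‖ker η z w x‖ ≤ C * (1 + x ^ 2)⁻¹ := by
  obtain ⟨C, -, h1⟩ := norm_inv_pt_sub_le hη hz
  obtain ⟨D, -, h2⟩ := norm_inv_pt_sub_le hη hw
  exact ⟨_, fun x => norm_ker_le_of_bounds (hz x) (hw x) (h1 x) (h2 x)⟩

lemma continuous_pt {η : ℝ → ℝ} (hη : Continuous η) : Continuous (pt η) := by
  unfold pt; fun_prop

lemma continuous_inv_pt_sub {η : ℝ → ℝ} (hη : Continuous η) {z : ℂ} (hz : ∀ x, pt η x ≠ z) :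
    Continuous fun x => (pt η x - z)⁻¹ :=
  ((continuous_pt hη).sub continuous_const).inv₀ fun x => sub_ne_zero.2 (hz x)

lemma continuous_ker {η : ℝ → ℝ} (hη : Continuous η) {z w : ℂ} (hz : ∀ x, pt η x ≠ z)
    (hw : ∀ x, pt η x ≠ w) : Continuous (ker η z w) :=
  (continuous_inv_pt_sub hη hz).sub (continuous_inv_pt_sub hη hw)

lemma integrable_of_le_inv_one_add_sq {f : ℝ → ℂ} (hf : Continuous f) {C : ℝ}
    (h : ∀ x, ‖f x‖ ≤ C * (1 + x ^ 2)⁻¹) : Integrable f :=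
  (integrable_inv_one_add_sq.const_mul C).mono' hf.aestronglyMeasurable (.of_forall h)

lemma integrable_mul_ker {η : ℝ → ℝ} (hη : Continuous η) {z w : ℂ} (hz : ∀ x, pt η x ≠ z)
    (hw : ∀ x, pt η x ≠ w) {ρ : ℝ → ℂ} (hρ : Continuous ρ) {B : ℝ} (hB : ∀ x, ‖ρ x‖ ≤ B) :
    Integrable fun x => ρ x * ker η z w x := by
  obtain ⟨C, hC⟩ := norm_ker_le hη hz hw
  refine integrable_of_le_inv_one_add_sq (hρ.mul (continuous_ker hη hz hw)) (C := B * C) fun x => ?_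
  rw [norm_mul, mul_assoc]
  exact mul_le_mul (hB x) (hC x) (norm_nonneg _) ((norm_nonneg _).trans (hB x))

/-- A graph of class `C¹` with bounded height and slope. -/
structure Graph (η : ℝ → ℝ) : Prop where
  contDiff : ContDiff ℝ 1 η
  bdd : ∃ B, ∀ x, |η x| ≤ B
  bdd_deriv : ∃ B, ∀ x, |deriv η x| ≤ B

namespace Graph
variable {η : ℝ → ℝ} (h : Graph η)
include h

lemma continuous : Continuous η := h.contDiff.continuous

lemma continuous_deriv : Continuous (deriv η) := h.contDiff.continuous_deriv le_rfl

lemma hasDerivAt (x : ℝ) : HasDerivAt η (deriv η x) x :=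
  (h.contDiff.differentiable one_ne_zero x).hasDerivAt

lemma hasDerivAt_pt (x : ℝ) : HasDerivAt (pt η) (1 + I * deriv η x) x := by
  have h1 : HasDerivAt (fun x : ℝ => (x : ℂ)) 1 x := Complex.ofRealCLM.hasDerivAt (x := x)
  exact h1.add ((h.hasDerivAt x).ofReal_comp.const_mul I)

lemma continuous_tangent : Continuous fun x => 1 + I * ((deriv η x : ℝ) : ℂ) := by
  have := h.continuous_deriv
  fun_prop

lemma bdd_tangent : ∃ B, ∀ x, ‖1 + I * ((deriv η x : ℝ) : ℂ)‖ ≤ B := by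
  obtain ⟨B, hB⟩ := h.bdd_deriv
  refine ⟨1 + B, fun x => (norm_add_le _ _).trans ?_⟩
  simpa using hB x

end Graph

lemma tangent_ne_zero (r : ℝ) : 1 + I * (r : ℂ) ≠ 0 := by
  intro h
  simpa using congrArg Complex.re h

/-! ### The winding number of a graph -/

/-- The branch of `log` cut along the vertical ray leaving `z` away from the graph, at the right
end of the graph; `q = ± i` turns the ray into the negative real axis. -/
lemma tendsto_log_pt_atTop {η : ℝ → ℝ} (hb : ∃ B, ∀ x, |η x| ≤ B) (z : ℂ) {q : ℂ}
    (hq : q ∈ slitPlane) :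
    Tendsto (fun x : ℝ => log (q * (pt η x - z)) - Real.log (x - z.re)) atTop (𝓝 (log q)) := by
  obtain ⟨B, hB⟩ := hb
  have hl : Tendsto (fun x : ℝ => x - z.re) atTop atTop := tendsto_atTop_add_const_right _ _ tendsto_id
  have h1 : Tendsto (fun x : ℝ => (η x - z.im) / (x - z.re)) atTop (𝓝 0) := by
    refine squeeze_zero_norm' (a := fun x => (B + |z.im|) / (x - z.re)) ?_ (hl.const_div_atTop _)
    filter_upwards [hl.eventually_gt_atTop 0] with x hx
    rw [Real.norm_eq_abs, abs_div, abs_of_pos hx]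
    gcongr
    exact (abs_sub _ _).trans (by linarith [hB x])
  have h2 : Tendsto (fun x : ℝ => q * (1 + I * ((η x - z.im) / (x - z.re) : ℝ))) atTop (𝓝 q) := by
    have : Tendsto (fun x : ℝ => q * (1 + I * ((η x - z.im) / (x - z.re) : ℝ))) atTop
      (𝓝 (q * (1 + I * (0 : ℝ)))) :=
      (((Complex.continuous_ofReal.tendsto 0).comp h1).const_mul I |>.const_add 1).const_mul q
    simpa using this
  refine ((continuousAt_clog hq).tendsto.comp h2).congr' ?_
  filter_upwards [hl.eventually_gt_atTop 0] with x hx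
  have h3 : q * (pt η x - z) = (x - z.re : ℝ) * (q * (1 + I * ((η x - z.im) / (x - z.re) : ℝ))) := by
    have h4 : ((x - z.re : ℝ) : ℂ) ≠ 0 := by exact_mod_cast hx.ne'
    have h5 : pt η x - z = (x - z.re : ℝ) + I * ((η x - z.im : ℝ) : ℂ) := by
      apply Complex.ext <;> simp
    rw [h5, Complex.ofReal_div]
    field_simp
  rw [h3, Complex.log_ofReal_mul hx]
  · simp
  · exact mul_ne_zero (slitPlane_ne_zero hq) (tangent_ne_zero _)

lemma tendsto_log_pt_atBot {η : ℝ → ℝ} (hb : ∃ B, ∀ x, |η x| ≤ B) (z : ℂ) {q : ℂ}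
    (hq : -q ∈ slitPlane) :
    Tendsto (fun x : ℝ => log (q * (pt η x - z)) - Real.log (z.re - x)) atBot (𝓝 (log (-q))) := by
  have h := tendsto_log_pt_atTop (η := fun x => -η (-x)) (by simpa using
    (fun ⟨B, hB⟩ => ⟨B, fun x => hB (-x)⟩ : (∃ B, ∀ x, |η x| ≤ B) → ∃ B, ∀ x, |η (-x)| ≤ B) hb)
    (-z) hq
  refine (h.comp tendsto_neg_atBot_atTop).congr fun x => ?_
  have : -q * (pt (fun x => -η (-x)) (-x) - -z) = q * (pt η x - z) := by
    simp [pt]; ring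
  simp only [Function.comp, this]
  congr 3
  simp; ring

lemma mem_slitPlane_above {η : ℝ → ℝ} {z : ℂ} (h : η z.re < z.im) (x : ℝ) :
    I * (pt η x - z) ∈ slitPlane := by
  rw [mem_slitPlane_iff]
  by_cases hx : x = z.re
  · left; subst hx; simpa using h
  · right; simpa [sub_eq_zero] using hx

lemma mem_slitPlane_below {η : ℝ → ℝ} {z : ℂ} (h : z.im < η z.re) (x : ℝ) :
    -I * (pt η x - z) ∈ slitPlane := by
  rw [mem_slitPlane_iff]
  by_cases hx : x = z.re
  · left; subst hx; simpa using h
  · right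
    simp only [neg_mul, neg_im, mul_im, I_re, zero_mul, I_im, one_mul, sub_re, pt_re, zero_add]
    simpa [sub_eq_zero] using fun h => hx h.symm

lemma I_mem_slitPlane : I ∈ slitPlane := by simp [mem_slitPlane_iff]
lemma neg_I_mem_slitPlane : -I ∈ slitPlane := by simp [mem_slitPlane_iff]

lemma Graph.integral_tangent_mul_ker {η : ℝ → ℝ} (h : Graph η) {z w : ℂ} (hre : z.re = w.re) {q r : ℂ}
    (hq : q ∈ slitPlane) (hq' : -q ∈ slitPlane) (hr : r ∈ slitPlane) (hr' : -r ∈ slitPlane)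
    (hz : ∀ x, q * (pt η x - z) ∈ slitPlane) (hw : ∀ x, r * (pt η x - w) ∈ slitPlane) :
    ∫ x, (1 + I * ((deriv η x : ℝ) : ℂ)) * ker η z w x = (log q - log r) - (log (-q) - log (-r)) := by
  have hq0 := slitPlane_ne_zero hq
  have hr0 := slitPlane_ne_zero hr
  have hz' : ∀ x, pt η x ≠ z := fun x hx => by simpa [hx] using slitPlane_ne_zero (hz x)
  have hw' : ∀ x, pt η x ≠ w := fun x hx => by simpa [hx] using slitPlane_ne_zero (hw x)
  obtain ⟨B, hB⟩ := h.bdd_tangent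
  refine integral_of_hasDerivAt_of_tendsto
    (f := fun x => log (q * (pt η x - z)) - log (r * (pt η x - w))) (fun x => ?_)
    (integrable_mul_ker h.continuous hz' hw' h.continuous_tangent hB) ?_ ?_
  · have h1 := (((h.hasDerivAt_pt x).sub_const z).const_mul q).clog_real (hz x)
    have h2 := (((h.hasDerivAt_pt x).sub_const w).const_mul r).clog_real (hw x)
    refine (h1.sub h2).congr_deriv ?_
    have h3 := sub_ne_zero.2 (hz' x)
    have h4 := sub_ne_zero.2 (hw' x)
    unfold ker
    field_simp
  · refine ((tendsto_log_pt_atBot h.bdd z hq').sub (tendsto_log_pt_atBot h.bdd w hr')).congr ?_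
    intro x; rw [hre]; ring
  · refine ((tendsto_log_pt_atTop h.bdd z hq).sub (tendsto_log_pt_atTop h.bdd w hr)).congr ?_
    intro x; rw [hre]; ring

lemma Graph.integral_tangent_mul_ker_above_below {η : ℝ → ℝ} (h : Graph η) {z w : ℂ}
    (hre : z.re = w.re) (hz : η z.re < z.im) (hw : w.im < η w.re) :
    ∫ x, (1 + I * ((deriv η x : ℝ) : ℂ)) * ker η z w x = 2 * Real.pi * I := by
  rw [h.integral_tangent_mul_ker hre (q := I) (r := -I) I_mem_slitPlane neg_I_mem_slitPlane
    neg_I_mem_slitPlane (by simpa using I_mem_slitPlane) (mem_slitPlane_above hz)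
    (mem_slitPlane_below hw)]
  rw [neg_neg, log_I, log_neg_I]
  ring

lemma Graph.integral_tangent_mul_ker_below_below {η : ℝ → ℝ} (h : Graph η) {z w : ℂ}
    (hre : z.re = w.re) (hz : z.im < η z.re) (hw : w.im < η w.re) :
    ∫ x, (1 + I * ((deriv η x : ℝ) : ℂ)) * ker η z w x = 0 := by
  rw [h.integral_tangent_mul_ker hre (q := -I) (r := -I) neg_I_mem_slitPlane
    (by simpa using I_mem_slitPlane)
    neg_I_mem_slitPlane (by simpa using I_mem_slitPlane) (mem_slitPlane_below hz)
    (mem_slitPlane_below hw)]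
  simp

/-- Splitting off the value of the density at the foot point. -/
lemma Graph.tau_eq_add_err {η : ℝ → ℝ} (h : Graph η) {M : ℝ → ℂ} (hM : Continuous M)
    (hMb : ∃ B, ∀ x, ‖M x‖ ≤ B) {z w : ℂ} (hre : z.re = w.re) (hz : η z.re ≠ z.im)
    (hw : η w.re ≠ w.im) :
    tau η M z w = M z.re * (∫ x, (1 + I * ((deriv η x : ℝ) : ℂ)) * ker η z w x)
      + err η M z.re z.im w.im := by
  obtain ⟨B, hB⟩ := h.bdd_tangent
  obtain ⟨A, hA⟩ := hMb
  have hz' := pt_ne_of_ne hz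
  have hw' := pt_ne_of_ne hw
  have i1 : Integrable fun x => (1 + I * ((deriv η x : ℝ) : ℂ)) * ker η z w x :=
    integrable_mul_ker h.continuous hz' hw' h.continuous_tangent hB
  have i2 : Integrable fun x => M x * (1 + I * ((deriv η x : ℝ) : ℂ)) * ker η z w x :=
    integrable_mul_ker h.continuous hz' hw' (hM.mul h.continuous_tangent) (B := A * B) fun x => by
      rw [norm_mul]
      exact mul_le_mul (hA x) (hB x) (norm_nonneg _) ((norm_nonneg _).trans (hA x))
  have e : err η M z.re z.im w.im
      = ∫ x, (M x * (1 + I * ((deriv η x : ℝ) : ℂ)) * ker η z w x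
        - M z.re * ((1 + I * ((deriv η x : ℝ) : ℂ)) * ker η z w x)) := by
    rw [← integral_add_left_eq_self _ z.re]
    refine integral_congr_ae (.of_forall fun u => ?_)
    have e1 : pt η (z.re + u) - z = u + I * (η (z.re + u) - z.im) := by
      apply Complex.ext <;> simp
    have e2 : pt η (z.re + u) - w = u + I * (η (z.re + u) - w.im) := by
      apply Complex.ext <;> simp [hre]
    simp only [errIntegrand, ker, e1, e2]
    ring
  rw [e, integral_sub i2 (i1.const_mul _), integral_const_mul, tau]
  ring

/-! ### Cauchy integrals over a graph -/

/-- The Cauchy integral `∫ g dx / (γ - z)` along the graph of `η`. -/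
def cau (η : ℝ → ℝ) (g : ℝ → ℂ) (z : ℂ) : ℂ := ∫ x, g x * (pt η x - z)⁻¹

lemma inv_sqrt_le_one (x : ℝ) : (√(1 + x ^ 2))⁻¹ ≤ 1 :=
  inv_le_one_of_one_le₀ (Real.one_le_sqrt.2 (by nlinarith [sq_nonneg x]))

lemma inv_sqrt_sq (x : ℝ) : (√(1 + x ^ 2))⁻¹ ^ 2 = (1 + x ^ 2)⁻¹ := by
  rw [inv_pow, Real.sq_sqrt (by positivity)]

lemma integrable_mul_inv_pt_sub {η : ℝ → ℝ} (hη : Continuous η) {g : ℝ → ℂ} (hg : Integrable g)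
    {z : ℂ} (hz : ∀ x, pt η x ≠ z) : Integrable fun x => g x * (pt η x - z)⁻¹ := by
  obtain ⟨C, hC, h⟩ := norm_inv_pt_sub_le hη hz
  refine hg.mul_bdd (c := C) (continuous_inv_pt_sub hη hz).aestronglyMeasurable (.of_forall fun x => ?_)
  exact (h x).trans (mul_le_of_le_one_right hC.le (inv_sqrt_le_one x))

lemma norm_mul_inv_sq_le {ρ v : ℂ} {B C x : ℝ} (hρ : ‖ρ‖ ≤ B) (hv : ‖v‖ ≤ C * (√(1 + x ^ 2))⁻¹) :
    ‖ρ * v ^ 2‖ ≤ B * C ^ 2 * (1 + x ^ 2)⁻¹ := by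
  rw [norm_mul, norm_pow, mul_assoc, ← inv_sqrt_sq, ← mul_pow]
  have := (norm_nonneg ρ).trans hρ
  gcongr

/-- Differentiation of a resolvent integral with respect to the point; `κ` is a regularization
making the integral converge. -/
lemma hasDerivAt_integral_resolvent {η : ℝ → ℝ} (hη : Continuous η) {ρ κ : ℝ → ℂ}
    (hρ : Continuous ρ) (hB : ∃ B, ∀ x, ‖ρ x‖ ≤ B) (hκ : Continuous κ) {z : ℂ}
    (hz : ∀ x, pt η x ≠ z) (hi : Integrable fun x => ρ x * ((pt η x - z)⁻¹ - κ x)) :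
    HasDerivAt (fun z => ∫ x, ρ x * ((pt η x - z)⁻¹ - κ x)) (∫ x, ρ x * (pt η x - z)⁻¹ ^ 2) z := by
  obtain ⟨B, hB⟩ := hB
  obtain ⟨C, hC, h⟩ := eventually_norm_inv_pt_sub_le (Θ := ℂ) (θ₀ := z) (η := fun _ => η)
    (z := fun z => z) (fun x => by fun_prop) continuousAt_id hz
  refine (hasDerivAt_integral_of_dominated_loc_of_deriv_le (μ := volume)
    (F := fun z x => ρ x * ((pt η x - z)⁻¹ - κ x)) (F' := fun z x => ρ x * (pt η x - z)⁻¹ ^ 2)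
    (bound := fun x => B * C ^ 2 * (1 + x ^ 2)⁻¹) h ?_ hi ?_ ?_ ?_ ?_).2
  · filter_upwards [h] with v hv
    exact (hρ.mul ((continuous_inv_pt_sub hη fun x => (hv x).1).sub hκ)).aestronglyMeasurable
  · exact (hρ.mul ((continuous_inv_pt_sub hη hz).pow 2)).aestronglyMeasurable
  · exact .of_forall fun x v hv => norm_mul_inv_sq_le (hB x) (hv x).2
  · exact integrable_inv_one_add_sq.const_mul _
  · refine .of_forall fun x v hv => ?_
    have h1 : HasDerivAt (fun v => pt η x - v) (-1) v := (hasDerivAt_id v).const_sub _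
    have h2 := (((h1.inv (sub_ne_zero.2 (hv x).1)).sub_const (κ x)).const_mul (ρ x))
    refine h2.congr_deriv ?_
    simp [div_eq_mul_inv]

lemma hasDerivAt_cau {η : ℝ → ℝ} (hη : Continuous η) {g : ℝ → ℂ}
    (hg : Continuous g) (hB : ∃ B, ∀ x, ‖g x‖ ≤ B) (hi : Integrable g) {z : ℂ}
    (hz : ∀ x, pt η x ≠ z) :
    HasDerivAt (cau η g) (∫ x, g x * (pt η x - z)⁻¹ ^ 2) z := by
  have := hasDerivAt_integral_resolvent hη hg hB (κ := fun _ => 0) continuous_const hz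
    (by simpa using integrable_mul_inv_pt_sub hη hi hz)
  simp only [sub_zero] at this
  exact this

/-- `G` is a bounded primitive of the bounded integrable density `g`. -/
structure BddPrimitive (G g : ℝ → ℂ) : Prop where
  hasDerivAt : ∀ x, HasDerivAt G (g x) x
  continuous_density : Continuous g
  bdd : ∃ B, ∀ x, ‖G x‖ ≤ B
  bdd_density : ∃ B, ∀ x, ‖g x‖ ≤ B
  integrable : Integrable g

lemma BddPrimitive.continuous {G g : ℝ → ℂ} (h : BddPrimitive G g) : Continuous G :=
  continuous_iff_continuousAt.2 fun x => (h.hasDerivAt x).continuousAt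

lemma exists_norm_mul_le {f g : ℝ → ℂ} (hf : ∃ B, ∀ x, ‖f x‖ ≤ B) (hg : ∃ B, ∀ x, ‖g x‖ ≤ B) :
    ∃ B, ∀ x, ‖f x * g x‖ ≤ B := by
  obtain ⟨A, hA⟩ := hf
  obtain ⟨B, hB⟩ := hg
  refine ⟨A * B, fun x => ?_⟩
  rw [norm_mul]
  exact mul_le_mul (hA x) (hB x) (norm_nonneg _) ((norm_nonneg _).trans (hA x))

/-- The integral over the line of the derivative of `A / (γ - z)`, `A` bounded, is zero. -/
lemma integral_deriv_mul_inv_pt_sub {η : ℝ → ℝ} (h : Graph η) {A A' : ℝ → ℂ}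
    (hA : ∀ x, HasDerivAt A (A' x) x) (hb : ∃ B, ∀ x, ‖A x‖ ≤ B) {z : ℂ} (hz : ∀ x, pt η x ≠ z)
    (hi : Integrable fun x => A' x * (pt η x - z)⁻¹
      - A x * (1 + I * ((deriv η x : ℝ) : ℂ)) * (pt η x - z)⁻¹ ^ 2) :
    ∫ x, (A' x * (pt η x - z)⁻¹
      - A x * (1 + I * ((deriv η x : ℝ) : ℂ)) * (pt η x - z)⁻¹ ^ 2) = 0 := by
  obtain ⟨B, hB⟩ := hb
  obtain ⟨C, hC, hc⟩ := norm_inv_pt_sub_le h.continuous hz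
  have hl : Tendsto (fun x => A x * (pt η x - z)⁻¹) (cocompact ℝ) (𝓝 0) := by
    refine squeeze_zero_norm (a := fun x => B * (C * (√(1 + x ^ 2))⁻¹)) (fun x => ?_) ?_
    · rw [norm_mul]
      exact mul_le_mul (hB x) (hc x) (norm_nonneg _) ((norm_nonneg _).trans (hB x))
    · simpa using (tendsto_inv_sqrt_one_add_sq.const_mul C).const_mul B
  have := integral_of_hasDerivAt_of_tendsto (f := fun x => A x * (pt η x - z)⁻¹) (fun x => ?_) hi
    (hl.mono_left atBot_le_cocompact) (hl.mono_left atTop_le_cocompact)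
  · simpa using this
  · have h1 := ((h.hasDerivAt_pt x).sub_const z).inv (sub_ne_zero.2 (hz x))
    refine ((hA x).mul h1).congr_deriv ?_
    simp only [Pi.inv_apply]
    rw [div_eq_mul_inv, inv_pow]
    ring

lemma integrable_mul_inv_sq {η : ℝ → ℝ} (hη : Continuous η) {ρ : ℝ → ℂ} (hρ : Continuous ρ)
    (hB : ∃ B, ∀ x, ‖ρ x‖ ≤ B) {z : ℂ} (hz : ∀ x, pt η x ≠ z) :
    Integrable fun x => ρ x * (pt η x - z)⁻¹ ^ 2 := by
  obtain ⟨B, hB⟩ := hB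
  obtain ⟨C, hC, hc⟩ := norm_inv_pt_sub_le hη hz
  exact integrable_of_le_inv_one_add_sq (hρ.mul ((continuous_inv_pt_sub hη hz).pow 2))
    fun x => norm_mul_inv_sq_le (hB x) (hc x)

/-- Integration by parts: the derivative of the regularized Cauchy integral of a primitive is the
Cauchy integral of the density. -/
lemma hasDerivAt_tau {η : ℝ → ℝ} (h : Graph η) {G g : ℝ → ℂ} (hG : BddPrimitive G g) {z w : ℂ}
    (hz : ∀ x, pt η x ≠ z) (hw : ∀ x, pt η x ≠ w) :
    HasDerivAt (fun z => tau η G z w) (cau η g z) z := by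
  have hc : Continuous fun x => G x * (1 + I * ((deriv η x : ℝ) : ℂ)) :=
    hG.continuous.mul h.continuous_tangent
  have hb := exists_norm_mul_le hG.bdd h.bdd_tangent
  obtain ⟨B, hB⟩ := hb
  have hd := hasDerivAt_integral_resolvent h.continuous hc ⟨B, hB⟩
    (continuous_inv_pt_sub h.continuous hw) hz (integrable_mul_ker h.continuous hz hw hc hB)
  refine hd.congr_deriv ?_
  have i1 := integrable_mul_inv_pt_sub h.continuous hG.integrable hz
  have i2 := integrable_mul_inv_sq h.continuous hc ⟨B, hB⟩ hz
  have := integral_deriv_mul_inv_pt_sub h hG.hasDerivAt hG.bdd hz (i1.sub i2)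
  rw [integral_sub i1 i2, sub_eq_zero] at this
  exact this.symm

lemma tau_swap (η : ℝ → ℝ) (M : ℝ → ℂ) (z w : ℂ) : tau η M z w = - tau η M w z := by
  rw [tau, tau, ← integral_neg]
  congr 1; ext x
  simp only [ker]; ring

lemma tau_add_tau {η : ℝ → ℝ} (h : Graph η) {M : ℝ → ℂ} (hM : Continuous M)
    (hMb : ∃ B, ∀ x, ‖M x‖ ≤ B) {z w v : ℂ} (hz : ∀ x, pt η x ≠ z) (hw : ∀ x, pt η x ≠ w)
    (hv : ∀ x, pt η x ≠ v) : tau η M z w + tau η M w v = tau η M z v := by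
  have hc : Continuous fun x => M x * (1 + I * ((deriv η x : ℝ) : ℂ)) := hM.mul h.continuous_tangent
  obtain ⟨B, hB⟩ := exists_norm_mul_le hMb h.bdd_tangent
  rw [tau, tau, tau, ← integral_add (integrable_mul_ker h.continuous hz hw hc hB)
    (integrable_mul_ker h.continuous hw hv hc hB)]
  congr 1; ext x
  simp only [ker]; ring

/-- With an integrable density no regularization is needed. -/
lemma tau_eq_cau_sub_cau {η : ℝ → ℝ} (hη : Continuous η) {M g : ℝ → ℂ}
    (hg : ∀ x, M x * (1 + I * ((deriv η x : ℝ) : ℂ)) = g x) (hi : Integrable g)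
    {z w : ℂ} (hz : ∀ x, pt η x ≠ z) (hw : ∀ x, pt η x ≠ w) :
    tau η M z w = cau η g z - cau η g w := by
  rw [tau, cau, cau, ← integral_sub (integrable_mul_inv_pt_sub hη hi hz)
    (integrable_mul_inv_pt_sub hη hi hw)]
  congr 1; ext x
  rw [hg, ker]; ring

/-- Far below the graph the Cauchy integral is the Laplace transform of the moments. -/
lemma cau_eq_laplace {η : ℝ → ℝ} (hη : Continuous η) {g : ℝ → ℂ} (hgc : Continuous g)
    (hi : Integrable g) {z : ℂ} {δ : ℝ} (hδ : 0 < δ) (hz : ∀ x, z.im + δ ≤ η x) :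
    cau η g z = ∫ k in Ioi (0 : ℝ), -I * cexp (-I * k * z) *
      ∫ x, cexp (-I * ((-k : ℝ) : ℂ) * pt η x) * g x := by
  have h1 : ∀ x, g x * (pt η x - z)⁻¹
      = ∫ k in Ioi (0 : ℝ), -I * g x * cexp (I * (pt η x - z) * k) := by
    intro x
    have hre : (I * (pt η x - z)).re < 0 := by simp; linarith [hz x]
    have hne : pt η x - z ≠ 0 := fun h0 => by simp [h0] at hre
    rw [integral_const_mul, integral_exp_mul_complex_Ioi hre]
    simp only [ofReal_zero, mul_zero, Complex.exp_zero]
    field_simp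
  rw [cau, integral_congr_ae (.of_forall h1), integral_integral_swap]
  · refine integral_congr_ae (.of_forall fun k => ?_)
    simp only
    rw [← integral_const_mul]
    refine integral_congr_ae (.of_forall fun x => ?_)
    simp only
    rw [show I * (pt η x - z) * k = -I * k * z + -I * ((-k : ℝ) : ℂ) * pt η x by push_cast; ring,
      Complex.exp_add]
    ring
  · have hd : Integrable (fun p : ℝ × ℝ => ‖g p.1‖ * Real.exp (-δ * p.2))
        (volume.prod (volume.restrict (Ioi (0 : ℝ)))) :=
      hi.norm.mul_prod (integrableOn_exp_mul_Ioi (by linarith : -δ < 0) 0)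
    refine hd.mono' ?_ ?_
    · refine Continuous.aestronglyMeasurable ?_
      have := continuous_pt hη
      unfold Function.uncurry
      fun_prop
    · filter_upwards [Measure.quasiMeasurePreserving_snd.ae
        (ae_restrict_mem (μ := volume) (measurableSet_Ioi (a := (0 : ℝ))))] with p hp
      simp only [Function.uncurry, norm_mul, norm_neg, norm_I, one_mul, Complex.norm_exp]
      gcongr
      have : (I * (pt η p.1 - z) * p.2).re = -((η p.1 - z.im) * p.2) := by simp; ring
      rw [this]
      have hp' : 0 < p.2 := hp
      nlinarith [hz p.1]

lemma isPreconnected_below {η : ℝ → ℝ} (hη : Continuous η) :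
    IsPreconnected {z : ℂ | z.im < η z.re} := by
  have : {z : ℂ | z.im < η z.re} =
      (fun p : ℝ × ℝ => (p.1 : ℂ) + I * (η p.1 - p.2 : ℝ)) '' (univ ×ˢ Ioi 0) := by
    ext z
    constructor
    · intro hz
      refine ⟨(z.re, η z.re - z.im), ⟨trivial, (sub_pos.2 hz : 0 < η z.re - z.im)⟩, ?_⟩
      apply Complex.ext <;> simp
    · rintro ⟨p, hp, rfl⟩
      simpa using hp.2
  rw [this]
  exact (isPreconnected_univ.prod isPreconnected_Ioi).image _ (by fun_prop)

lemma isOpen_below {η : ℝ → ℝ} (hη : Continuous η) : IsOpen {z : ℂ | z.im < η z.re} :=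
  isOpen_lt (by fun_prop) (by fun_prop)

/-- The data of one layer at one time: two ordered graphs carrying densities with the same
exponential moments. -/
structure Strip (a b : ℝ → ℝ) (ga gb : ℝ → ℂ) : Prop where
  lower : Graph a
  upper : Graph b
  lt : ∀ x, a x < b x
  continuous_lower : Continuous ga
  continuous_upper : Continuous gb
  bdd_lower : ∃ B, ∀ x, ‖ga x‖ ≤ B
  bdd_upper : ∃ B, ∀ x, ‖gb x‖ ≤ B
  integrable_lower : Integrable ga
  integrable_upper : Integrable gb
  moment : ∀ k : ℝ, ∫ x, cexp (-I * k * pt a x) * ga x = ∫ x, cexp (-I * k * pt b x) * gb x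

/-- Equality of the moments makes the Cauchy integral over both graphs vanish below the strip. -/
lemma Strip.cau_eq_of_below {a b : ℝ → ℝ} {ga gb : ℝ → ℂ} (h : Strip a b ga gb) {z : ℂ}
    (hz : z.im < a z.re) : cau a ga z = cau b gb z := by
  obtain ⟨A, hA⟩ := h.lower.bdd
  have hU := isOpen_below h.lower.continuous
  have ha : ∀ z ∈ {z : ℂ | z.im < a z.re}, ∀ x, pt a x ≠ z := fun z hz => pt_ne_of_ne (ne_of_gt hz)
  have hb : ∀ z ∈ {z : ℂ | z.im < a z.re}, ∀ x, pt b x ≠ z := fun z hz =>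
    pt_ne_of_ne (ne_of_gt (lt_trans hz (h.lt _)))
  have hd : DifferentiableOn ℂ (fun z => cau a ga z - cau b gb z) {z : ℂ | z.im < a z.re} := by
    intro z hz
    exact ((hasDerivAt_cau h.lower.continuous h.continuous_lower h.bdd_lower h.integrable_lower
      (ha z hz)).sub (hasDerivAt_cau h.upper.continuous h.continuous_upper h.bdd_upper
      h.integrable_upper (hb z hz))).differentiableAt.differentiableWithinAt
  have hfar : ∀ z : ℂ, z.im < -A - 1 → cau a ga z - cau b gb z = 0 := by
    intro z hz
    have h1 : ∀ x, z.im + 1 ≤ a x := fun x => by linarith [(abs_le.1 (hA x)).1]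
    rw [cau_eq_laplace h.lower.continuous h.continuous_lower h.integrable_lower one_pos h1,
      cau_eq_laplace h.upper.continuous h.continuous_upper h.integrable_upper one_pos
        (fun x => (h1 x).trans (h.lt x).le)]
    simp only [h.moment, sub_self]
  have hz₀ : (-I * (A + 2 : ℝ) : ℂ) ∈ {z : ℂ | z.im < a z.re} := by
    have := (abs_le.1 (hA 0)).1
    simp
    linarith
  have h0 := (hd.analyticOnNhd hU).eqOn_zero_of_preconnected_of_eventuallyEq_zero
    (isPreconnected_below h.lower.continuous) hz₀ (by
      have : IsOpen {z : ℂ | z.im < -A - 1} := isOpen_lt (by fun_prop) (by fun_prop)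
      filter_upwards [this.mem_nhds (show (-I * (A + 2 : ℝ) : ℂ) ∈ {z : ℂ | z.im < -A - 1} by
        simp; linarith)] with v hv
      exact hfar v hv)
  exact sub_eq_zero.1 (h0 hz)

/-! ### The holomorphic function of a strip -/

/-- The value at `z` of the regularized Cauchy integral over both graphs, normalized at `w`. -/
def cauchyT (a b : ℝ → ℝ) (Ma Mb : ℝ → ℂ) (z w : ℂ) : ℂ :=
  (2 * Real.pi * I)⁻¹ * (tau a Ma z w - tau b Mb z w)

/-- `cauchyT` at `x + i y`, normalized at the mirror image `x + i (2 a x - y)` in the lower graph.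
In this form it extends continuously to the closed strip, with the value `Ma` on the lower graph. -/
def stripFn (a b : ℝ → ℝ) (Ma Mb : ℝ → ℂ) (x y : ℝ) : ℂ :=
  Ma x + (2 * Real.pi * I)⁻¹ * (err a Ma x y (2 * a x - y) - err b Mb x y (2 * a x - y))

/-- The mirror image in the graph of `a`. -/
def mirror (a : ℝ → ℝ) (z : ℂ) : ℂ := z.re + I * (2 * a z.re - z.im : ℝ)

@[simp] lemma mirror_re (a : ℝ → ℝ) (z : ℂ) : (mirror a z).re = z.re := by simp [mirror]
@[simp] lemma mirror_im (a : ℝ → ℝ) (z : ℂ) : (mirror a z).im = 2 * a z.re - z.im := by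
  simp [mirror]

lemma err_self (η : ℝ → ℝ) (M : ℝ → ℂ) (x y : ℝ) : err η M x y y = 0 := by simp [err, errIntegrand]

lemma stripFn_lower (a b : ℝ → ℝ) (Ma Mb : ℝ → ℂ) (x : ℝ) : stripFn a b Ma Mb x (a x) = Ma x := by
  simp [stripFn, two_mul, err_self]

section Fixed
variable {a b : ℝ → ℝ} {ga gb : ℝ → ℂ}

lemma mirror_below {z : ℂ} (hz : a z.re < z.im) : (mirror a z).im < a (mirror a z).re := by
  simp; linarith

lemma mirror_pt_ne_lower {z : ℂ} (hz : a z.re < z.im) (x : ℝ) : pt a x ≠ mirror a z :=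
  pt_ne_of_ne (mirror_below hz).ne' x

lemma below_pt_ne_upper (hlt : ∀ x, a x < b x) {z : ℂ} (hz : z.im < a z.re) (x : ℝ) :
    pt b x ≠ z :=
  pt_ne_of_ne (hz.trans (hlt _)).ne' x

/-- The winding number of the lower graph around the pair of mirror points is one, that of the upper
graph zero; this produces the term `Ma x`. -/
lemma cauchyT_mirror_eq_stripFn (ha : Graph a) (hb : Graph b) {Ma Mb : ℝ → ℂ}
    (hMa : Continuous Ma) (hMa' : ∃ B, ∀ x, ‖Ma x‖ ≤ B)
    (hMb : Continuous Mb) (hMb' : ∃ B, ∀ x, ‖Mb x‖ ≤ B) {z : ℂ} (h1 : a z.re < z.im)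
    (h2 : z.im < b z.re) : cauchyT a b Ma Mb z (mirror a z) = stripFn a b Ma Mb z.re z.im := by
  have h3 := mirror_below h1
  have h4 : (mirror a z).im < b (mirror a z).re := by
    simp only [mirror_re, mirror_im] at h3 ⊢
    linarith
  rw [cauchyT, ha.tau_eq_add_err hMa hMa' (mirror_re a z).symm h1.ne h3.ne',
    hb.tau_eq_add_err hMb hMb' (mirror_re a z).symm h2.ne' h4.ne',
    ha.integral_tangent_mul_ker_above_below (mirror_re a z).symm h1 h3,
    hb.integral_tangent_mul_ker_below_below (mirror_re a z).symm h2 h4, stripFn]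
  have := Complex.two_pi_I_ne_zero
  simp only [mirror_im]
  field_simp
  ring

variable (h : Strip a b ga gb)
include h

/-- Inside the strip the extension of the quotients `F = g / γ'` is the Cauchy integral of `g`. -/
lemma Strip.stripFn_eq_cau {Fa Fb : ℝ → ℂ} (hFa : Continuous Fa) (hFa' : ∃ B, ∀ x, ‖Fa x‖ ≤ B)
    (hFb : Continuous Fb) (hFb' : ∃ B, ∀ x, ‖Fb x‖ ≤ B)
    (hga : ∀ x, Fa x * (1 + I * ((deriv a x : ℝ) : ℂ)) = ga x)
    (hgb : ∀ x, Fb x * (1 + I * ((deriv b x : ℝ) : ℂ)) = gb x)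
    {z : ℂ} (h1 : a z.re < z.im) (h2 : z.im < b z.re) :
    stripFn a b Fa Fb z.re z.im = (2 * Real.pi * I)⁻¹ * (cau a ga z - cau b gb z) := by
  have h3 := mirror_below h1
  rw [← cauchyT_mirror_eq_stripFn h.lower h.upper hFa hFa' hFb hFb' h1 h2, cauchyT,
    tau_eq_cau_sub_cau h.lower.continuous hga h.integrable_lower (pt_ne_of_ne h1.ne)
      (mirror_pt_ne_lower h1),
    tau_eq_cau_sub_cau h.upper.continuous hgb h.integrable_upper (pt_ne_of_ne h2.ne')
      (below_pt_ne_upper h.lt h3), h.cau_eq_of_below h3]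
  ring

variable {Ga Gb : ℝ → ℂ} (hGa : BddPrimitive Ga ga) (hGb : BddPrimitive Gb gb)
include hGa hGb

/-- The normalization point does not matter as long as it stays below the strip. -/
lemma Strip.cauchyT_congr_right {z v w : ℂ} (hza : ∀ x, pt a x ≠ z) (hzb : ∀ x, pt b x ≠ z)
    (hv : v.im < a v.re) (hw : w.im < a w.re) :
    cauchyT a b Ga Gb z v = cauchyT a b Ga Gb z w := by
  have hU := isOpen_below h.lower.continuous
  have hd : ∀ y ∈ {y : ℂ | y.im < a y.re},
      HasDerivAt (fun y => tau a Ga y w - tau b Gb y w) 0 y := by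
    intro y hy
    have h1 := hasDerivAt_tau h.lower hGa (pt_ne_of_ne (ne_of_gt hy)) (pt_ne_of_ne hw.ne')
    have h2 := hasDerivAt_tau h.upper hGb (below_pt_ne_upper h.lt hy) (below_pt_ne_upper h.lt hw)
    exact (h1.sub h2).congr_deriv (by rw [h.cau_eq_of_below hy, sub_self])
  have h0 := hU.is_const_of_deriv_eq_zero (isPreconnected_below h.lower.continuous)
    (fun y hy => (hd y hy).differentiableAt.differentiableWithinAt) (fun y hy => (hd y hy).deriv)
    hv hw
  have hs : ∀ η (M : ℝ → ℂ), tau η M w w = 0 := fun η M => by simp [tau, ker]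
  simp only [hs, sub_self] at h0
  rw [cauchyT, cauchyT,
    ← tau_add_tau h.lower hGa.continuous hGa.bdd hza (pt_ne_of_ne hw.ne') (pt_ne_of_ne hv.ne'),
    ← tau_add_tau h.upper hGb.continuous hGb.bdd hzb (below_pt_ne_upper h.lt hw)
      (below_pt_ne_upper h.lt hv), tau_swap a Ga w v, tau_swap b Gb w v]
  linear_combination (-(2 * Real.pi * I)⁻¹) * h0

lemma Strip.stripFn_eq_cauchyT {z w : ℂ} (h1 : a z.re < z.im) (h2 : z.im < b z.re)
    (hw : w.im < a w.re) : stripFn a b Ga Gb z.re z.im = cauchyT a b Ga Gb z w := by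
  rw [← cauchyT_mirror_eq_stripFn h.lower h.upper hGa.continuous hGa.bdd hGb.continuous hGb.bdd h1 h2]
  exact h.cauchyT_congr_right hGa hGb (pt_ne_of_ne h1.ne) (pt_ne_of_ne h2.ne') (mirror_below h1) hw

omit hGa hGb h in
lemma isOpen_strip (ha : Continuous a) (hb : Continuous b) :
    IsOpen {z : ℂ | a z.re < z.im ∧ z.im < b z.re} :=
  (isOpen_lt (f := fun z : ℂ => a z.re) (g := fun z : ℂ => z.im) (by fun_prop) (by fun_prop)).inter
    (isOpen_lt (f := fun z : ℂ => z.im) (g := fun z : ℂ => b z.re) (by fun_prop) (by fun_prop))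

/-- Inside the strip, the extension of the primitives is a primitive of the extension of the
quotients. -/
lemma Strip.hasDerivAt_stripFn {z : ℂ} (h1 : a z.re < z.im) (h2 : z.im < b z.re) :
    HasDerivAt (fun z : ℂ => stripFn a b Ga Gb z.re z.im)
      ((2 * Real.pi * I)⁻¹ * (cau a ga z - cau b gb z)) z := by
  have h3 := mirror_below h1
  have hd := ((hasDerivAt_tau h.lower hGa (pt_ne_of_ne h1.ne) (pt_ne_of_ne h3.ne')).sub
    (hasDerivAt_tau h.upper hGb (pt_ne_of_ne h2.ne') (below_pt_ne_upper h.lt h3))).const_mul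
    (2 * Real.pi * I)⁻¹
  refine hd.congr_of_eventuallyEq ?_
  filter_upwards [(isOpen_strip h.lower.continuous h.upper.continuous).mem_nhds ⟨h1, h2⟩] with v hv
  exact h.stripFn_eq_cauchyT hGa hGb hv.1 hv.2 h3

end Fixed

/-! ### Reflection -/

lemma pt_neg (η : ℝ → ℝ) (x : ℝ) : pt (fun x => -η x) x = (starRingEnd ℂ) (pt η x) := by
  apply Complex.ext <;> simp

lemma Graph.neg {η : ℝ → ℝ} (h : Graph η) : Graph fun x => -η x where
  contDiff := h.contDiff.neg
  bdd := by simpa using h.bdd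
  bdd_deriv := by simpa using h.bdd_deriv

lemma integrable_conj {f : ℝ → ℂ} (h : Integrable f) :
    Integrable fun x => (starRingEnd ℂ) (f x) := by
  exact (Complex.conjLIE.toContinuousLinearEquiv.toContinuousLinearMap.integrable_comp h)

lemma Strip.reflect {a b : ℝ → ℝ} {ga gb : ℝ → ℂ} (h : Strip a b ga gb) :
    Strip (fun x => -b x) (fun x => -a x) (fun x => (starRingEnd ℂ) (gb x))
      (fun x => (starRingEnd ℂ) (ga x)) where
  lower := h.upper.neg
  upper := h.lower.neg
  lt x := neg_lt_neg (h.lt x)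
  continuous_lower := continuous_conj.comp h.continuous_upper
  continuous_upper := continuous_conj.comp h.continuous_lower
  bdd_lower := by simpa using h.bdd_upper
  bdd_upper := by simpa using h.bdd_lower
  integrable_lower := integrable_conj h.integrable_upper
  integrable_upper := integrable_conj h.integrable_lower
  moment k := by
    have e : ∀ (η : ℝ → ℝ) (g : ℝ → ℂ),
        ∫ x, cexp (-I * k * pt (fun x => -η x) x) * (starRingEnd ℂ) (g x)
          = (starRingEnd ℂ) (∫ x, cexp (-I * ((-k : ℝ) : ℂ) * pt η x) * g x) := by
      intro η g
      rw [← integral_conj]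
      congr 1; ext x
      rw [pt_neg, map_mul, ← Complex.exp_conj]
      simp
    rw [e, e, h.moment]

lemma cau_neg (η : ℝ → ℝ) (g : ℝ → ℂ) (z : ℂ) :
    cau (fun x => -η x) (fun x => (starRingEnd ℂ) (g x)) ((starRingEnd ℂ) z)
      = (starRingEnd ℂ) (cau η g z) := by
  rw [cau, cau, ← integral_conj]
  congr 1; ext x
  rw [pt_neg]; simp

/-! ### Differentiation in time -/

/-- Time derivative of the regularized Cauchy integral of a family of primitives along a moving
graph. After an integration by parts it is again a regularized Cauchy integral, with the density
`M = ∂_t G - i (∂_t η) F` where `F = ∂_x G / γ'`. -/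
lemma hasDerivAt_tau_time {η ηt ηxt : ℝ → ℝ → ℝ} {G Gt : ℝ → ℝ → ℂ} {g M : ℝ → ℂ} {t B : ℝ}
    (hgr : ∀ᶠ s in 𝓝 t, Graph fun x => η x s)
    (hηc : ∀ x, ContinuousAt (fun p : ℝ × ℝ => η p.2 p.1) (t, x))
    (hη : ∀ᶠ s in 𝓝 t, ∀ x, HasDerivAt (fun s => η x s) (ηt x s) s)
    (hηx : ∀ᶠ s in 𝓝 t, ∀ x, HasDerivAt (fun s => deriv (fun x => η x s) x) (ηxt x s) s)
    (hG : ∀ᶠ s in 𝓝 t, ∀ x, HasDerivAt (fun s => G x s) (Gt x s) s)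
    (hb : ∀ᶠ s in 𝓝 t, ∀ x, ‖G x s‖ ≤ B ∧ ‖Gt x s‖ ≤ B ∧ |deriv (fun x => η x s) x| ≤ B ∧
      |ηt x s| ≤ B ∧ |ηxt x s| ≤ B)
    (hGc : ∀ᶠ s in 𝓝 t, Continuous fun x => G x s)
    (hGtc : Continuous fun x => Gt x t) (hηxtc : Continuous fun x => ηxt x t)
    (hGg : BddPrimitive (fun x => G x t) g)
    (hηtx : ∀ x, HasDerivAt (fun x => ηt x t) (ηxt x t) x)
    (hηi : Integrable fun x => ηxt x t)
    (hM : ∀ x, M x * (1 + I * ((deriv (fun x => η x t) x : ℝ) : ℂ))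
      = Gt x t * (1 + I * ((deriv (fun x => η x t) x : ℝ) : ℂ)) - I * ηt x t * g x)
    {z w : ℂ} (hz : ∀ x, pt (fun x => η x t) x ≠ z) (hw : ∀ x, pt (fun x => η x t) x ≠ w) :
    HasDerivAt (fun s => tau (fun x => η x s) (fun x => G x s) z w)
      (tau (fun x => η x t) M z w) t := by
  have hgt := hgr.self_of_nhds
  have hbt := hb.self_of_nhds
  obtain ⟨C, hC, h1⟩ := eventually_norm_inv_pt_sub_le (Θ := ℝ) (θ₀ := t) (η := fun s x => η x s)
    (z := fun _ => z) hηc continuousAt_const hz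
  obtain ⟨D, hD, h2⟩ := eventually_norm_inv_pt_sub_le (Θ := ℝ) (θ₀ := t) (η := fun s x => η x s)
    (z := fun _ => w) hηc continuousAt_const hw
  have hB0 : 0 ≤ B := (norm_nonneg _).trans (hbt 0).1
  have hηtc : Continuous fun x => ηt x t :=
    continuous_iff_continuousAt.2 fun x => (hηtx x).continuousAt
  have hctan : ∀ s, (Graph fun x => η x s) → Continuous fun x => 1 + I * ((deriv (fun x => η x s) x : ℝ) : ℂ) :=
    fun s hs => hs.continuous_tangent
  set κ : ℝ → ℝ → ℂ := fun s x => (Gt x s * (1 + I * ((deriv (fun x => η x s) x : ℝ) : ℂ))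
      + G x s * (I * ηxt x s)) * ker (fun x => η x s) z w x
    - (G x s * (1 + I * ((deriv (fun x => η x s) x : ℝ) : ℂ)) * (I * ηt x s))
      * (pt (fun x => η x s) x - z)⁻¹ ^ 2
    + (G x s * (1 + I * ((deriv (fun x => η x s) x : ℝ) : ℂ)) * (I * ηt x s))
      * (pt (fun x => η x s) x - w)⁻¹ ^ 2 with hκ
  have hκc : Continuous (κ t) := by
    have c1 := hctan t hgt
    have c2 := hGc.self_of_nhds
    have c3 := continuous_ker hgt.continuous hz hw
    have c4 := continuous_inv_pt_sub hgt.continuous hz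
    have c5 := continuous_inv_pt_sub hgt.continuous hw
    simp only [hκ]
    fun_prop
  have hdiff : HasDerivAt (fun s => tau (fun x => η x s) (fun x => G x s) z w) (∫ x, κ t x) t := by
    refine (hasDerivAt_integral_of_dominated_loc_of_deriv_le (μ := volume)
      (F := fun s x => G x s * (1 + I * ((deriv (fun x => η x s) x : ℝ) : ℂ))
        * ker (fun x => η x s) z w x) (F' := κ)
      (bound := fun x => ((B * (1 + B) + B * B) * (‖z - w‖ * C * D) + (B * (1 + B) * B) * C ^ 2
        + (B * (1 + B) * B) * D ^ 2) * (1 + x ^ 2)⁻¹)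
      ((h1.and h2).and (hη.and (hηx.and (hG.and hb)))) ?_ ?_ ?_ ?_ ?_ ?_).2
    · filter_upwards [hgr, hGc, h1, h2] with s c1 c2 c3 c4
      exact ((c2.mul (hctan s c1)).mul (continuous_ker c1.continuous (fun x => (c3 x).1)
        fun x => (c4 x).1)).aestronglyMeasurable
    · exact integrable_mul_ker hgt.continuous hz hw (hGg.continuous.mul hgt.continuous_tangent)
        (exists_norm_mul_le hGg.bdd hgt.bdd_tangent).choose_spec
    · exact hκc.aestronglyMeasurable
    · refine .of_forall fun x s ⟨⟨c1, c2⟩, c3, c4, c5, c6⟩ => ?_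
      obtain ⟨b1, b2, b3, b4, b5⟩ := c6 x
      have b6 : ‖1 + I * ((deriv (fun x => η x s) x : ℝ) : ℂ)‖ ≤ 1 + B := by
        refine (norm_add_le _ _).trans ?_
        simpa using b3
      have b7 : ‖G x s * (1 + I * ((deriv (fun x => η x s) x : ℝ) : ℂ)) * (I * ηt x s)‖
          ≤ B * (1 + B) * B := by
        rw [norm_mul, norm_mul, norm_mul, norm_I, one_mul, norm_real, Real.norm_eq_abs]
        gcongr
      have b8 : ‖Gt x s * (1 + I * ((deriv (fun x => η x s) x : ℝ) : ℂ)) + G x s * (I * ηxt x s)‖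
          ≤ B * (1 + B) + B * B := by
        refine (norm_add_le _ _).trans ?_
        rw [norm_mul, norm_mul, norm_mul, norm_I, one_mul, norm_real, Real.norm_eq_abs]
        gcongr
      have b9 := norm_ker_le_of_bounds (c1 x).1 (c2 x).1 (c1 x).2 (c2 x).2
      calc ‖κ s x‖ ≤ (B * (1 + B) + B * B) * (‖z - w‖ * C * D * (1 + x ^ 2)⁻¹)
            + B * (1 + B) * B * C ^ 2 * (1 + x ^ 2)⁻¹ + B * (1 + B) * B * D ^ 2 * (1 + x ^ 2)⁻¹ := by
            simp only [hκ]
            refine (norm_add_le _ _).trans (add_le_add ((norm_sub_le _ _).trans (add_le_add ?_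
              (norm_mul_inv_sq_le b7 (c1 x).2))) (norm_mul_inv_sq_le b7 (c2 x).2))
            rw [norm_mul]
            gcongr
        _ = _ := by ring
    · exact integrable_inv_one_add_sq.const_mul _
    · refine .of_forall fun x s ⟨⟨c1, c2⟩, c3, c4, c5, c6⟩ => ?_
      have d1 : HasDerivAt (fun s => 1 + I * ((deriv (fun x => η x s) x : ℝ) : ℂ)) (I * ηxt x s) s :=
        ((c4 x).ofReal_comp.const_mul I).const_add 1
      have d2 : HasDerivAt (fun s => pt (fun x => η x s) x) (I * ηt x s) s :=
        ((c3 x).ofReal_comp.const_mul I).const_add (x : ℂ)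
      have d3 := (d2.sub_const z).fun_inv (sub_ne_zero.2 (c1 x).1)
      have d4 := (d2.sub_const w).fun_inv (sub_ne_zero.2 (c2 x).1)
      refine (((c5 x).mul d1).mul (d3.sub d4)).congr_deriv ?_
      simp only [hκ, ker, Pi.mul_apply, Pi.sub_apply, div_eq_mul_inv, inv_pow]
      ring
  -- The terms of `κ` other than the integrand for `M` are the `x`-derivative of
  -- `i G η_t (1 / (γ - z) - 1 / (γ - w))`, whose integral is zero.
  refine hdiff.congr_deriv ?_
  have hA : ∀ x, HasDerivAt (fun x => I * G x t * ηt x t)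
      (I * g x * ηt x t + I * G x t * ηxt x t) x := fun x =>
    ((hGg.hasDerivAt x).const_mul I).mul (hηtx x).ofReal_comp
  have hAb : ∃ K, ∀ x, ‖I * G x t * ηt x t‖ ≤ K := ⟨B * B, fun x => by
    rw [norm_mul, norm_mul, norm_I, one_mul, norm_real, Real.norm_eq_abs]
    exact mul_le_mul (hbt x).1 (hbt x).2.2.2.1 (abs_nonneg _) hB0⟩
  have hA'i : Integrable fun x => I * g x * ηt x t + I * G x t * ηxt x t := by
    refine Integrable.add ?_ ?_
    · refine (hGg.integrable.const_mul I).mul_bdd (c := B) (by fun_prop) (.of_forall fun x => ?_)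
      simpa using (hbt x).2.2.2.1
    · refine Integrable.bdd_mul (c := B) hηi.ofReal
        (hGg.continuous.const_mul I).aestronglyMeasurable (.of_forall fun x => ?_)
      simpa using (hbt x).1
  have hAc : Continuous fun x => I * G x t * ηt x t * (1 + I * ((deriv (fun x => η x t) x : ℝ) : ℂ)) :=
    ((continuous_const.mul hGg.continuous).mul (by fun_prop)).mul hgt.continuous_tangent
  have hAcb := exists_norm_mul_le hAb hgt.bdd_tangent
  have j1 := (integrable_mul_inv_pt_sub hgt.continuous hA'i hz).sub
    (integrable_mul_inv_sq hgt.continuous hAc hAcb hz)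
  have j2 := (integrable_mul_inv_pt_sub hgt.continuous hA'i hw).sub
    (integrable_mul_inv_sq hgt.continuous hAc hAcb hw)
  have e1 := integral_deriv_mul_inv_pt_sub hgt hA hAb hz j1
  have e2 := integral_deriv_mul_inv_pt_sub hgt hA hAb hw j2
  have hMI : Integrable fun x => M x * (1 + I * ((deriv (fun x => η x t) x : ℝ) : ℂ))
      * ker (fun x => η x t) z w x := by
    simp only [hM]
    have c1 := hGg.continuous_density
    have c2 := hctan t hgt
    obtain ⟨K, hK⟩ := hGg.bdd_density
    refine integrable_mul_ker hgt.continuous hz hw (B := B * (1 + B) + B * K) (by fun_prop) fun x => ?_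
    obtain ⟨b1, b2, b3, b4, b5⟩ := hbt x
    refine (norm_sub_le _ _).trans (add_le_add ?_ ?_)
    · rw [norm_mul]
      have : ‖1 + I * ((deriv (fun x => η x t) x : ℝ) : ℂ)‖ ≤ 1 + B := by
        refine (norm_add_le _ _).trans ?_
        simpa using b3
      gcongr
    · rw [norm_mul, norm_mul, norm_I, one_mul, norm_real, Real.norm_eq_abs]
      exact mul_le_mul b4 (hK x) (norm_nonneg _) hB0
  have : ∀ x, κ t x = M x * (1 + I * ((deriv (fun x => η x t) x : ℝ) : ℂ))
        * ker (fun x => η x t) z w x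
      + (((I * g x * ηt x t + I * G x t * ηxt x t) * (pt (fun x => η x t) x - z)⁻¹
        - I * G x t * ηt x t * (1 + I * ((deriv (fun x => η x t) x : ℝ) : ℂ))
          * (pt (fun x => η x t) x - z)⁻¹ ^ 2)
      - ((I * g x * ηt x t + I * G x t * ηxt x t) * (pt (fun x => η x t) x - w)⁻¹
        - I * G x t * ηt x t * (1 + I * ((deriv (fun x => η x t) x : ℝ) : ℂ))
          * (pt (fun x => η x t) x - w)⁻¹ ^ 2)) := by
    intro x
    rw [hM]
    simp only [hκ, ker]
    ring
  have j3 := j1.sub j2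
  simp only [Pi.sub_def] at j1 j2 j3
  rw [integral_congr_ae (.of_forall this), integral_add hMI j3, integral_sub j1 j2, e1, e2, tau]
  simp

/-! ### Functions of position and time -/

section Classes
variable {E : Type*} [NormedAddCommGroup E]

/-- Joint continuity for positive times. -/
def JointCont (f : ℝ → ℝ → E) : Prop :=
  ContinuousOn (fun p : ℝ × ℝ => f p.1 p.2) (univ ×ˢ Ioi 0)

/-- Boundedness in `x`, locally uniformly in `t > 0`. -/
def LocBdd (f : ℝ → ℝ → E) : Prop := ∀ t > 0, ∃ B, ∀ᶠ s in 𝓝 t, ∀ x, ‖f x s‖ ≤ B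

/-- Convergence to `0` as `|x| → ∞`, locally uniformly in `t > 0`, as a statement on filters. -/
def Decays (f : ℝ → ℝ → E) : Prop :=
  ∀ t > 0, Tendsto (fun p : ℝ × ℝ => f p.1 p.2) (cocompact ℝ ×ˢ 𝓝 t) (𝓝 0)

lemma eventually_cocompact_prod_nhds {t : ℝ} (ht : 0 < t) {p : ℝ → ℝ → Prop} :
    (∀ᶠ q in cocompact ℝ ×ˢ 𝓝 t, p q.1 q.2) ↔
      ∃ δ > 0, ∃ R : ℝ, ∀ s x : ℝ, 0 < s → |s - t| < δ → R < |x| → p x s := by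
  have hb1 : (cocompact ℝ).HasBasis (fun _ : ℝ => True) (fun R => {x | R < |x|}) := by
    have := (atTop_basis_Ioi (α := ℝ)).comap (norm : ℝ → ℝ)
    rw [comap_norm_atTop, ← Metric.cobounded_eq_cocompact] at *
    exact this
  rw [(hb1.prod Metric.nhds_basis_ball).eventually_iff]
  constructor
  · rintro ⟨⟨R, δ⟩, ⟨-, hδ⟩, h⟩
    exact ⟨δ, hδ, R, fun s x _ h1 h2 => h (x := (x, s)) ⟨h2, h1⟩⟩
  · rintro ⟨δ, hδ, R, h⟩
    refine ⟨⟨R, min δ t⟩, ⟨trivial, lt_min hδ ht⟩, fun {q} hq => ?_⟩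
    have h1 : |q.2 - t| < min δ t := hq.2
    exact h _ _ (by linarith [(abs_lt.1 (h1.trans_le (min_le_right _ _))).1])
      (h1.trans_le (min_le_left _ _)) hq.1

lemma vanishes_iff_decays {f : ℝ → ℝ → ℝ} : Vanishes f ↔ Decays f := by
  refine forall₂_congr fun t ht => ?_
  rw [Metric.tendsto_nhds]
  refine forall₂_congr fun ε hε => ?_
  simp only [dist_zero_right, Real.norm_eq_abs]
  exact (eventually_cocompact_prod_nhds ht (p := fun x s => |f x s| < ε)).symm

lemma JointCont.tendsto {f : ℝ → ℝ → E} (h : JointCont f) {ι : Type*} {l : Filter ι} {x s : ι → ℝ}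
    {x₀ t : ℝ} (ht : 0 < t) (hx : Tendsto x l (𝓝 x₀)) (hs : Tendsto s l (𝓝 t)) :
    Tendsto (fun i => f (x i) (s i)) l (𝓝 (f x₀ t)) := by
  have h1 : ContinuousAt (fun p : ℝ × ℝ => f p.1 p.2) (x₀, t) :=
    ContinuousOn.continuousAt h ((isOpen_univ.prod isOpen_Ioi).mem_nhds ⟨trivial, ht⟩)
  exact h1.tendsto.comp (hx.prodMk_nhds hs)

lemma jointCont_of_tendsto {f : ℝ → ℝ → E}
    (h : ∀ x t, 0 < t → Tendsto (fun p : ℝ × ℝ => f p.1 p.2) (𝓝 (x, t)) (𝓝 (f x t))) :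
    JointCont f := fun p hp => (h p.1 p.2 hp.2).mono_left nhdsWithin_le_nhds

lemma JointCont.continuous {f : ℝ → ℝ → E} (h : JointCont f) {t : ℝ} (ht : 0 < t) :
    Continuous fun x => f x t :=
  continuous_iff_continuousAt.2 fun _ => h.tendsto ht tendsto_id tendsto_const_nhds

lemma JointCont.locBdd {f : ℝ → ℝ → E} (h : JointCont f) (hd : Decays f) : LocBdd f := by
  intro t ht
  have h1 : ∀ᶠ q in cocompact ℝ ×ˢ 𝓝 t, ‖f q.1 q.2‖ < 1 := by
    have := (hd t ht).norm
    rw [norm_zero] at this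
    exact this.eventually_lt_const one_pos
  obtain ⟨δ, hδ, R, h2⟩ := (eventually_cocompact_prod_nhds ht (p := fun x s => ‖f x s‖ < 1)).1 h1
  obtain ⟨B, hB⟩ := (isCompact_Icc (a := -R) (b := R)).exists_bound_of_continuousOn
    (h.continuous ht).continuousOn
  have h3 : ∀ᶠ s in 𝓝 t, ∀ x ∈ Icc (-R) R, ‖f x s‖ < B + 1 := by
    refine isCompact_Icc.eventually_forall_of_forall_eventually fun x hx => ?_
    have := (h.tendsto ht (l := 𝓝 (t, x)) continuous_snd.continuousAt
      continuous_fst.continuousAt).norm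
    exact this.eventually_lt_const (lt_of_le_of_lt (hB x hx) (lt_add_one _))
  refine ⟨max 1 (B + 1), ?_⟩
  filter_upwards [h3, Metric.ball_mem_nhds t hδ, Ioi_mem_nhds ht] with s h4 h5 h6 x
  by_cases hx : x ∈ Icc (-R) R
  · exact (h4 x hx).le.trans (le_max_right _ _)
  · refine (h2 s x h6 h5 ?_).le.trans (le_max_left _ _)
    by_contra! h7
    exact hx (abs_le.1 h7)

lemma LocBdd.add {f g : ℝ → ℝ → E} (hf : LocBdd f) (hg : LocBdd g) :
    LocBdd fun x t => f x t + g x t := fun t ht => by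
  obtain ⟨A, hA⟩ := hf t ht
  obtain ⟨B, hB⟩ := hg t ht
  refine ⟨A + B, ?_⟩
  filter_upwards [hA, hB] with s h1 h2 x
  exact (norm_add_le _ _).trans (add_le_add (h1 x) (h2 x))

lemma LocBdd.neg {f : ℝ → ℝ → E} (hf : LocBdd f) : LocBdd fun x t => -f x t := by
  simpa [LocBdd] using hf

lemma LocBdd.sub {f g : ℝ → ℝ → E} (hf : LocBdd f) (hg : LocBdd g) :
    LocBdd fun x t => f x t - g x t := by
  simpa only [sub_eq_add_neg] using hf.add hg.neg

lemma locBdd_const (c : E) : LocBdd fun _ _ => c := fun _ _ => ⟨‖c‖, .of_forall fun _ _ => le_rfl⟩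

lemma LocBdd.mul {A : Type*} [NormedRing A] {f g : ℝ → ℝ → A} (hf : LocBdd f) (hg : LocBdd g) :
    LocBdd fun x t => f x t * g x t := fun t ht => by
  obtain ⟨A, hA⟩ := hf t ht
  obtain ⟨B, hB⟩ := hg t ht
  refine ⟨A * B, ?_⟩
  filter_upwards [hA, hB] with s h1 h2 x
  refine (norm_mul_le _ _).trans ?_
  exact mul_le_mul (h1 x) (h2 x) (norm_nonneg _) ((norm_nonneg _).trans (h1 x))

lemma LocBdd.ofReal {f : ℝ → ℝ → ℝ} (hf : LocBdd f) : LocBdd fun x t => (f x t : ℂ) := by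
  simpa [LocBdd] using hf

lemma LocBdd.at {f : ℝ → ℝ → E} (hf : LocBdd f) {t : ℝ} (ht : 0 < t) : ∃ B, ∀ x, ‖f x t‖ ≤ B := by
  obtain ⟨B, hB⟩ := hf t ht
  exact ⟨B, hB.self_of_nhds⟩

lemma Decays.add {f g : ℝ → ℝ → E} (hf : Decays f) (hg : Decays g) :
    Decays fun x t => f x t + g x t := fun t ht => by
  simpa using (hf t ht).add (hg t ht)

lemma Decays.sub {f g : ℝ → ℝ → E} (hf : Decays f) (hg : Decays g) :
    Decays fun x t => f x t - g x t := fun t ht => by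
  simpa using (hf t ht).sub (hg t ht)

lemma Decays.ofReal {f : ℝ → ℝ → ℝ} (hf : Decays f) : Decays fun x t => (f x t : ℂ) := fun t ht => by
  rw [← Complex.ofReal_zero]
  exact (Complex.continuous_ofReal.tendsto 0).comp (hf t ht)

lemma Decays.mul_locBdd {A : Type*} [NormedRing A] {f g : ℝ → ℝ → A} (hf : Decays f) (hg : LocBdd g) :
    Decays fun x t => f x t * g x t := fun t ht => by
  obtain ⟨B, hB⟩ := hg t ht
  have h1 := (hf t ht).norm.mul_const B
  rw [norm_zero, zero_mul] at h1
  refine squeeze_zero_norm' ?_ h1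
  filter_upwards [tendsto_snd.eventually hB] with q hq
  refine (norm_mul_le _ _).trans ?_
  exact mul_le_mul_of_nonneg_left (hq _) (norm_nonneg _)

end Classes

/-- A moving graph with bounded height and slope. -/
structure MovingGraph (η : ℝ → ℝ → ℝ) : Prop where
  jointCont : JointCont η
  jointCont_dX : JointCont (dX η)
  locBdd : LocBdd η
  locBdd_dX : LocBdd (dX η)
  contDiff : ∀ t > 0, ContDiff ℝ 1 fun x => η x t

lemma MovingGraph.graph {η : ℝ → ℝ → ℝ} (h : MovingGraph η) {t : ℝ} (ht : 0 < t) :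
    Graph fun x => η x t :=
  ⟨h.contDiff t ht, h.locBdd.at ht, h.locBdd_dX.at ht⟩

/-- A bounded density `M` whose `x`-derivative `m` is bounded and decays. -/
structure Density (M m : ℝ → ℝ → ℂ) : Prop where
  jointCont : JointCont M
  hasDerivAt : ∀ t > 0, ∀ x, HasDerivAt (fun x => M x t) (m x t) x
  locBdd : LocBdd M
  locBdd_deriv : LocBdd m
  decays_deriv : Decays m

section Err
variable {η : ℝ → ℝ → ℝ} {M m : ℝ → ℝ → ℂ}

/-- A bound independent of the heights: for `|u| ≤ 1` the increment of `M` compensates the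
singularity, for `|u| ≥ 1` the difference of the resolvents decays quadratically. -/
lemma norm_errIntegrand_le {η : ℝ → ℝ} {M : ℝ → ℂ} {x y w u B H : ℝ}
    (hM : ∀ x, ‖M x‖ ≤ B) (hL : ∀ x u, ‖M (x + u) - M x‖ ≤ B * |u|) (hη : ∀ x, |deriv η x| ≤ B)
    (hH : |y - w| ≤ H) : ‖errIntegrand η M x y w u‖ ≤ 4 * B * (1 + B) * (1 + H) * (1 + u ^ 2)⁻¹ := by
  have hB0 : 0 ≤ B := (norm_nonneg _).trans (hM 0)
  have hH0 : 0 ≤ H := (abs_nonneg _).trans hH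
  rcases eq_or_ne u 0 with rfl | hu
  · have : errIntegrand η M x y w 0 = 0 := by simp [errIntegrand]
    rw [this, norm_zero]
    positivity
  have hu0 : 0 < |u| := abs_pos.2 hu
  set d₁ : ℂ := u + I * (η (x + u) - y) with hd₁
  set d₂ : ℂ := u + I * (η (x + u) - w) with hd₂
  have h1 : |u| ≤ ‖d₁‖ := by simpa [hd₁] using Complex.abs_re_le_norm d₁
  have h2 : |u| ≤ ‖d₂‖ := by simpa [hd₂] using Complex.abs_re_le_norm d₂
  have i1 : ‖d₁⁻¹‖ ≤ |u|⁻¹ := by rw [norm_inv]; gcongr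
  have i2 : ‖d₂⁻¹‖ ≤ |u|⁻¹ := by rw [norm_inv]; gcongr
  have htan : ‖1 + I * ((deriv η (x + u) : ℝ) : ℂ)‖ ≤ 1 + B := by
    refine (norm_add_le _ _).trans ?_
    simpa using hη (x + u)
  have hinv : 0 < 1 + u ^ 2 := by positivity
  rw [errIntegrand, norm_mul, norm_mul, ← hd₁, ← hd₂]
  rcases le_total |u| 1 with hu1 | hu1
  · have h3 : ‖d₁⁻¹ - d₂⁻¹‖ ≤ |u|⁻¹ + |u|⁻¹ := (norm_sub_le _ _).trans (add_le_add i1 i2)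
    have h4 : (1 / 2 : ℝ) ≤ (1 + u ^ 2)⁻¹ := by
      rw [one_div]; gcongr
      nlinarith [sq_abs u]
    calc _ ≤ (B * |u|) * (1 + B) * (|u|⁻¹ + |u|⁻¹) := by
          gcongr
          exact hL x u
      _ = 4 * B * (1 + B) * 1 * (1 / 2) := by field_simp; ring
      _ ≤ _ := by gcongr; linarith
  · have hne₁ : d₁ ≠ 0 := norm_pos_iff.1 (hu0.trans_le h1)
    have hne₂ : d₂ ≠ 0 := norm_pos_iff.1 (hu0.trans_le h2)
    have h3 : ‖d₁⁻¹ - d₂⁻¹‖ ≤ H * (|u|⁻¹ * |u|⁻¹) := by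
      have : d₁⁻¹ - d₂⁻¹ = (I * ((y - w : ℝ) : ℂ)) * (d₁⁻¹ * d₂⁻¹) := by
        field_simp
        rw [hd₁, hd₂]; push_cast; ring
      rw [this, norm_mul, norm_mul, norm_mul, norm_I, one_mul, norm_real]
      gcongr
      exact hH
    have h4 : |u|⁻¹ * |u|⁻¹ ≤ 2 * (1 + u ^ 2)⁻¹ := by
      rw [← mul_inv, ← sq, sq_abs, inv_le_iff_one_le_mul₀ (by positivity), mul_assoc,
        inv_mul_eq_div, ← mul_div_assoc, le_div_iff₀ hinv]
      nlinarith [sq_abs u]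
    calc _ ≤ (B + B) * (1 + B) * (H * (|u|⁻¹ * |u|⁻¹)) := by
          gcongr
          exact (norm_sub_le _ _).trans (add_le_add (hM _) (hM _))
      _ ≤ (B + B) * (1 + B) * (H * (2 * (1 + u ^ 2)⁻¹)) := by gcongr
      _ = 4 * B * (1 + B) * H * (1 + u ^ 2)⁻¹ := by ring
      _ ≤ _ := by gcongr; linarith

variable (hη : MovingGraph η) (hM : Density M m)
include hη hM

/-- Dominated convergence for `err`, along any family of positions and times. -/
lemma tendsto_err {ι : Type*} {l : Filter ι} [l.IsCountablyGenerated] {t : ℝ} (ht : 0 < t)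
    {x y w s : ι → ℝ} (hs : Tendsto s l (𝓝 t)) {H : ℝ} (hH : ∀ᶠ i in l, |y i - w i| ≤ H)
    {k : ℝ → ℂ} (hk : ∀ u ≠ 0, Tendsto (fun i => errIntegrand (fun x => η x (s i))
      (fun x => M x (s i)) (x i) (y i) (w i) u) l (𝓝 (k u))) :
    Tendsto (fun i => err (fun x => η x (s i)) (fun x => M x (s i)) (x i) (y i) (w i)) l
      (𝓝 (∫ u, k u)) := by
  obtain ⟨B₁, h1⟩ := hM.locBdd t ht
  obtain ⟨B₂, h2⟩ := hM.locBdd_deriv t ht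
  obtain ⟨B₃, h3⟩ := hη.locBdd_dX t ht
  set B := max B₁ (max B₂ B₃)
  refine tendsto_integral_filter_of_dominated_convergence
    (fun u => 4 * B * (1 + B) * (1 + H) * (1 + u ^ 2)⁻¹) ?_ ?_
    (integrable_inv_one_add_sq.const_mul _) ?_
  · filter_upwards [hs.eventually (Ioi_mem_nhds ht)] with i hi
    have c1 := (hM.jointCont.continuous hi).measurable
    have c2 := (hη.graph hi).continuous.measurable
    have c3 := (hη.graph hi).continuous_deriv.measurable
    refine Measurable.aestronglyMeasurable ?_
    unfold errIntegrand
    fun_prop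
  · filter_upwards [hs.eventually h1, hs.eventually h2, hs.eventually h3,
      hs.eventually (Ioi_mem_nhds ht), hH] with i c1 c2 c3 c4 c5
    refine .of_forall fun u => norm_errIntegrand_le (fun x => (c1 x).trans (le_max_left _ _))
      (fun x u => ?_) (fun x => (c3 x).trans ((le_max_right _ _).trans (le_max_right _ _))) c5
    have := convex_univ.norm_image_sub_le_of_norm_hasDerivWithin_le (x := x) (y := x + u) (C := B)
      (fun v _ => (hM.hasDerivAt _ c4 v).hasDerivWithinAt)
      (fun v _ => (c2 v).trans ((le_max_left _ _).trans (le_max_right _ _))) trivial trivial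
    simpa using this
  · filter_upwards [Measure.ae_ne volume (0 : ℝ)] with u hu
    exact hk u hu

lemma tendsto_err_nhds {ι : Type*} {l : Filter ι} [l.IsCountablyGenerated] {t x₀ y₀ w₀ : ℝ}
    (ht : 0 < t) {x y w s : ι → ℝ} (hx : Tendsto x l (𝓝 x₀)) (hy : Tendsto y l (𝓝 y₀))
    (hw : Tendsto w l (𝓝 w₀)) (hs : Tendsto s l (𝓝 t)) :
    Tendsto (fun i => err (fun x => η x (s i)) (fun x => M x (s i)) (x i) (y i) (w i)) l
      (𝓝 (err (fun x => η x t) (fun x => M x t) x₀ y₀ w₀)) := by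
  refine tendsto_err hη hM ht hs (H := |y₀ - w₀| + 1) ?_ fun u hu => ?_
  · exact ((hy.sub hw).abs.eventually_lt_const (lt_add_one _)).mono fun _ h => h.le
  · have hxu : Tendsto (fun i => x i + u) l (𝓝 (x₀ + u)) := hx.add_const u
    have c : Continuous (fun x : ℝ => (x : ℂ)) := Complex.continuous_ofReal
    have e1 := (c.tendsto _).comp (hη.jointCont.tendsto ht hxu hs)
    have e2 := (c.tendsto _).comp (hη.jointCont_dX.tendsto ht hxu hs)
    have e3 := (c.tendsto _).comp hy
    have e4 := (c.tendsto _).comp hw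
    have hne : ∀ r : ℂ, r.im = 0 → (u : ℂ) + I * r ≠ 0 := fun r hr h => hu (by
      simpa [hr] using congrArg Complex.re h)
    exact (((hM.jointCont.tendsto ht hxu hs).sub (hM.jointCont.tendsto ht hx hs)).mul
      ((e2.const_mul I).const_add 1)).mul
      (((((e1.sub e3).const_mul I).const_add (u : ℂ)).inv₀ (hne _ (by simp))).sub
        ((((e1.sub e4).const_mul I).const_add (u : ℂ)).inv₀ (hne _ (by simp))))

omit hη in
lemma tendsto_increment {ι : Type*} {l : Filter ι} {t : ℝ} (ht : 0 < t) {x s : ι → ℝ}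
    (hx : Tendsto x l (cocompact ℝ)) (hs : Tendsto s l (𝓝 t)) (u : ℝ) :
    Tendsto (fun i => M (x i + u) (s i) - M (x i) (s i)) l (𝓝 0) := by
  rw [Metric.tendsto_nhds]
  intro ε hε
  have h1 : ∀ᶠ q in cocompact ℝ ×ˢ 𝓝 t, ‖m q.1 q.2‖ < ε / (|u| + 1) := by
    have := (hM.decays_deriv t ht).norm
    rw [norm_zero] at this
    exact this.eventually_lt_const (by positivity)
  obtain ⟨δ, hδ, R, h2⟩ :=
    (eventually_cocompact_prod_nhds ht (p := fun x s => ‖m x s‖ < ε / (|u| + 1))).1 h1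
  filter_upwards [hx.eventually ((tendsto_norm_cocompact_atTop (E := ℝ)).eventually_gt_atTop
    (R + |u|)), hs.eventually (Metric.ball_mem_nhds t hδ), hs.eventually (Ioi_mem_nhds ht)]
    with i c1 c2 c3
  rw [dist_zero_right]
  have := (convex_uIcc (x i) (x i + u)).norm_image_sub_le_of_norm_hasDerivWithin_le
    (f := fun x => M x (s i)) (x := x i) (y := x i + u)
    (C := ε / (|u| + 1)) (fun v _ => (hM.hasDerivAt _ c3 v).hasDerivWithinAt) (fun v hv => ?_)
    left_mem_uIcc right_mem_uIcc
  · refine this.trans_lt ?_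
    rw [add_sub_cancel_left, Real.norm_eq_abs, div_mul_eq_mul_div, div_lt_iff₀ (by positivity)]
    linarith
  · refine (h2 _ _ c3 c2 ?_).le
    have h3 : |v - x i| ≤ |u| := by simpa using abs_sub_left_of_mem_uIcc hv
    have h4 := abs_sub_abs_le_abs_sub (x i) v
    rw [abs_sub_comm] at h3
    rw [Real.norm_eq_abs] at c1
    linarith

/-- At both ends the increments of `M` tend to zero, because its derivative does. -/
lemma tendsto_err_zero {ι : Type*} {l : Filter ι} [l.IsCountablyGenerated] {t : ℝ}
    (ht : 0 < t) {x y w s : ι → ℝ} (hx : Tendsto x l (cocompact ℝ)) (hs : Tendsto s l (𝓝 t))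
    {H : ℝ} (hH : ∀ᶠ i in l, |y i - w i| ≤ H) :
    Tendsto (fun i => err (fun x => η x (s i)) (fun x => M x (s i)) (x i) (y i) (w i)) l
      (𝓝 0) := by
  obtain ⟨B, h3⟩ := hη.locBdd_dX t ht
  have := tendsto_err hη hM ht hs hH (x := x) (k := fun _ => 0) fun u hu => ?_
  · simpa using this
  have h1 := (tendsto_increment hM ht hx hs u).norm.mul_const ((1 + B) * (|u|⁻¹ + |u|⁻¹))
  rw [norm_zero, zero_mul] at h1
  refine squeeze_zero_norm' ?_ h1
  filter_upwards [hs.eventually h3] with i hi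
  have hu0 : 0 < |u| := abs_pos.2 hu
  have hd : ∀ r : ℝ, ‖((u : ℂ) + I * ((η (x i + u) (s i) : ℂ) - (r : ℂ)))⁻¹‖ ≤ |u|⁻¹ := by
    intro r
    rw [norm_inv]
    gcongr
    simpa using Complex.abs_re_le_norm ((u : ℂ) + I * ((η (x i + u) (s i) : ℂ) - (r : ℂ)))
  have hB0 : 0 ≤ B := (norm_nonneg _).trans (hi 0)
  rw [errIntegrand, norm_mul, norm_mul, mul_assoc]
  gcongr
  · refine (norm_add_le _ _).trans ?_
    simpa using (show |deriv (fun x => η x (s i)) (x i + u)| ≤ B from hi (x i + u))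
  · exact (norm_sub_le _ _).trans (add_le_add (hd _) (hd _))

end Err

/-! ### Partial derivatives of functions of position and time -/

lemma isOpen_univ_prod_Ioi : IsOpen ((univ : Set ℝ) ×ˢ Ioi (0 : ℝ)) := isOpen_univ.prod isOpen_Ioi

section Partial
variable {f : ℝ → ℝ → ℝ}

lemma hasFDerivAt_of_contDiffOn (hf : ContDiffOn ℝ 1 (fun p : ℝ × ℝ => f p.1 p.2) (univ ×ˢ Ioi 0))
    {t : ℝ} (ht : 0 < t) (x : ℝ) : HasFDerivAt (fun p : ℝ × ℝ => f p.1 p.2)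
      (fderiv ℝ (fun p : ℝ × ℝ => f p.1 p.2) (x, t)) (x, t) :=
  ((hf.contDiffAt (isOpen_univ_prod_Ioi.mem_nhds (show (x, t) ∈ _ from ⟨trivial, ht⟩))).differentiableAt one_ne_zero).hasFDerivAt

lemma hasDerivAt_slice_fst {E : Type*} [NormedAddCommGroup E] [NormedSpace ℝ E] {F : ℝ × ℝ → E}
    {F' : ℝ × ℝ →L[ℝ] E} {x t : ℝ} (h : HasFDerivAt F F' (x, t)) :
    HasDerivAt (fun x => F (x, t)) (F' (1, 0)) x :=
  HasFDerivAt.comp_hasDerivAt (f := fun x : ℝ => (x, t)) x h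
    ((hasDerivAt_id x).prodMk (hasDerivAt_const x t))

lemma hasDerivAt_slice_snd {E : Type*} [NormedAddCommGroup E] [NormedSpace ℝ E] {F : ℝ × ℝ → E}
    {F' : ℝ × ℝ →L[ℝ] E} {x t : ℝ} (h : HasFDerivAt F F' (x, t)) :
    HasDerivAt (fun t => F (x, t)) (F' (0, 1)) t :=
  HasFDerivAt.comp_hasDerivAt (f := fun t : ℝ => (x, t)) t h
    ((hasDerivAt_const t x).prodMk (hasDerivAt_id t))

lemma dX_eq_fderiv (hf : ContDiffOn ℝ 1 (fun p : ℝ × ℝ => f p.1 p.2) (univ ×ˢ Ioi 0))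
    {t : ℝ} (ht : 0 < t) (x : ℝ) :
    HasDerivAt (fun x => f x t) (fderiv ℝ (fun p : ℝ × ℝ => f p.1 p.2) (x, t) (1, 0)) x :=
  hasDerivAt_slice_fst (hasFDerivAt_of_contDiffOn hf ht x)

lemma dT_eq_fderiv (hf : ContDiffOn ℝ 1 (fun p : ℝ × ℝ => f p.1 p.2) (univ ×ˢ Ioi 0))
    {t : ℝ} (ht : 0 < t) (x : ℝ) :
    HasDerivAt (fun s => f x s) (fderiv ℝ (fun p : ℝ × ℝ => f p.1 p.2) (x, t) (0, 1)) t :=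
  hasDerivAt_slice_snd (hasFDerivAt_of_contDiffOn hf ht x)

lemma hasDerivAt_dX (hf : ContDiffOn ℝ 1 (fun p : ℝ × ℝ => f p.1 p.2) (univ ×ˢ Ioi 0))
    {t : ℝ} (ht : 0 < t) (x : ℝ) : HasDerivAt (fun x => f x t) (dX f x t) x :=
  (dX_eq_fderiv hf ht x).differentiableAt.hasDerivAt

lemma hasDerivAt_dT (hf : ContDiffOn ℝ 1 (fun p : ℝ × ℝ => f p.1 p.2) (univ ×ˢ Ioi 0))
    {t : ℝ} (ht : 0 < t) (x : ℝ) : HasDerivAt (fun s => f x s) (dT f x t) t :=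
  (dT_eq_fderiv hf ht x).differentiableAt.hasDerivAt

lemma contDiffOn_fderiv_apply {n : ℕ}
    (hf : ContDiffOn ℝ (n + 1 : ℕ) (fun p : ℝ × ℝ => f p.1 p.2) (univ ×ˢ Ioi 0)) (v : ℝ × ℝ) :
    ContDiffOn ℝ n (fun p => fderiv ℝ (fun p : ℝ × ℝ => f p.1 p.2) p v) (univ ×ˢ Ioi 0) :=
  (hf.fderiv_of_isOpen isOpen_univ_prod_Ioi (by norm_cast)).clm_apply contDiffOn_const

lemma contDiffOn_dX {n : ℕ}
    (hf : ContDiffOn ℝ (n + 1 : ℕ) (fun p : ℝ × ℝ => f p.1 p.2) (univ ×ˢ Ioi 0)) :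
    ContDiffOn ℝ n (fun p : ℝ × ℝ => dX f p.1 p.2) (univ ×ˢ Ioi 0) :=
  (contDiffOn_fderiv_apply hf (1, 0)).congr fun p hp =>
    (dX_eq_fderiv (hf.of_le (by norm_cast; omega)) hp.2 p.1).deriv

lemma contDiffOn_dT {n : ℕ}
    (hf : ContDiffOn ℝ (n + 1 : ℕ) (fun p : ℝ × ℝ => f p.1 p.2) (univ ×ˢ Ioi 0)) :
    ContDiffOn ℝ n (fun p : ℝ × ℝ => dT f p.1 p.2) (univ ×ˢ Ioi 0) :=
  (contDiffOn_fderiv_apply hf (0, 1)).congr fun p hp =>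
    (dT_eq_fderiv (hf.of_le (by norm_cast; omega)) hp.2 p.1).deriv

lemma dX_dT_comm (hf : ContDiffOn ℝ 2 (fun p : ℝ × ℝ => f p.1 p.2) (univ ×ˢ Ioi 0))
    {t : ℝ} (ht : 0 < t) (x : ℝ) : dX (dT f) x t = dT (dX f) x t := by
  have hf1 : ContDiffOn ℝ 1 (fun p : ℝ × ℝ => f p.1 p.2) (univ ×ˢ Ioi 0) := hf.of_le (by norm_num)
  have hmem : univ ×ˢ Ioi (0 : ℝ) ∈ 𝓝 (x, t) := isOpen_univ_prod_Ioi.mem_nhds ⟨trivial, ht⟩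
  have hs : IsSymmSndFDerivAt ℝ (fun p : ℝ × ℝ => f p.1 p.2) (x, t) :=
    (hf.contDiffAt hmem).isSymmSndFDerivAt (by simp)
  have hd : HasFDerivAt (fderiv ℝ fun p : ℝ × ℝ => f p.1 p.2)
      (fderiv ℝ (fderiv ℝ fun p : ℝ × ℝ => f p.1 p.2) (x, t)) (x, t) :=
    (((hf.contDiffAt hmem).fderiv_right (m := 1) (by norm_num)).differentiableAt
      one_ne_zero).hasFDerivAt
  have e1 : dX (dT f) x t = fderiv ℝ (fderiv ℝ fun p : ℝ × ℝ => f p.1 p.2) (x, t) (1, 0) (0, 1) := by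
    have h1 : (fun x' => dT f x' t)
        = fun x' => fderiv ℝ (fun p : ℝ × ℝ => f p.1 p.2) (x', t) (0, 1) :=
      funext fun x' => (dT_eq_fderiv hf1 ht x').deriv
    rw [dX, h1]
    exact (hasDerivAt_slice_fst (F := fun p => fderiv ℝ (fun p : ℝ × ℝ => f p.1 p.2) p (0, 1))
      ((ContinuousLinearMap.apply ℝ ℝ ((0 : ℝ), (1 : ℝ))).hasFDerivAt.comp (x, t) hd)).deriv
  have e2 : dT (dX f) x t = fderiv ℝ (fderiv ℝ fun p : ℝ × ℝ => f p.1 p.2) (x, t) (0, 1) (1, 0) := by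
    have h1 : (fun s => dX f x s)
        =ᶠ[𝓝 t] fun s => fderiv ℝ (fun p : ℝ × ℝ => f p.1 p.2) (x, s) (1, 0) := by
      filter_upwards [Ioi_mem_nhds ht] with s hs
      exact (dX_eq_fderiv hf1 hs x).deriv
    rw [dT, h1.deriv_eq]
    exact (hasDerivAt_slice_snd (F := fun p => fderiv ℝ (fun p : ℝ × ℝ => f p.1 p.2) p (1, 0))
      ((ContinuousLinearMap.apply ℝ ℝ ((1 : ℝ), (0 : ℝ))).hasFDerivAt.comp (x, t) hd)).deriv
  rw [e1, e2]
  exact hs.eq _ _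

end Partial

section Algebra
variable {f g : ℝ → ℝ → ℂ}

lemma JointCont.add (hf : JointCont f) (hg : JointCont g) : JointCont fun x t => f x t + g x t :=
  ContinuousOn.add hf hg

lemma JointCont.sub (hf : JointCont f) (hg : JointCont g) : JointCont fun x t => f x t - g x t :=
  ContinuousOn.sub hf hg

lemma JointCont.mul (hf : JointCont f) (hg : JointCont g) : JointCont fun x t => f x t * g x t :=
  ContinuousOn.mul hf hg

lemma JointCont.inv (hf : JointCont f) (h0 : ∀ x t, f x t ≠ 0) : JointCont fun x t => (f x t)⁻¹ :=
  ContinuousOn.inv₀ hf fun p _ => h0 p.1 p.2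

lemma JointCont.ofReal {f : ℝ → ℝ → ℝ} (hf : JointCont f) : JointCont fun x t => (f x t : ℂ) :=
  Complex.continuous_ofReal.comp_continuousOn hf

lemma jointCont_const {E : Type*} [NormedAddCommGroup E] (c : E) : JointCont fun _ _ => c :=
  continuousOn_const

lemma Decays.const_mul {A : Type*} [NormedRing A] {f : ℝ → ℝ → A} (hf : Decays f) (c : A) :
    Decays fun x t => c * f x t := fun t ht => by
  simpa using (hf t ht).const_mul c

lemma decays_affine {u v : ℝ → ℝ → ℝ} (hu : Decays u) (hv : Decays v) (U : ℝ) :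
    Decays fun x t => u x t + U * v x t :=
  hu.add (hv.const_mul U)

lemma jointCont_affine {u v : ℝ → ℝ → ℝ} (hu : JointCont u) (hv : JointCont v) (U : ℝ) :
    JointCont fun x t => u x t + U * v x t :=
  ContinuousOn.add hu (continuousOn_const.mul hv)

lemma locBdd_affine {u v : ℝ → ℝ → ℝ} (hu : LocBdd u) (hv : LocBdd v) (U : ℝ) :
    LocBdd fun x t => u x t + U * v x t :=
  hu.add ((locBdd_const U).mul hv)

end Algebra

/-! ### Integrals from the origin -/

/-- The primitive `∫₀ˣ f (y, t) dy`. -/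
def primX (f : ℝ → ℝ → ℝ) (x t : ℝ) : ℝ := ∫ y in (0 : ℝ)..x, f y t

section PrimX
variable {f : ℝ → ℝ → ℝ}

lemma LocallyDominated.integrable (hd : LocallyDominated f) (hf : JointCont f) {t : ℝ} (ht : 0 < t) :
    Integrable fun x => f x t := by
  obtain ⟨G, hG, δ, hδ, h⟩ := hd t ht
  exact hG.mono' (hf.continuous ht).aestronglyMeasurable
    (.of_forall fun x => h t x ht (by simpa using hδ))

lemma hasDerivAt_primX_x (hf : JointCont f) {t : ℝ} (ht : 0 < t) (x : ℝ) :
    HasDerivAt (fun x => primX f x t) (f x t) x :=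
  intervalIntegral.integral_hasDerivAt_right ((hf.continuous ht).intervalIntegrable _ _)
    ((hf.continuous ht).stronglyMeasurableAtFilter _ _) (hf.continuous ht).continuousAt

lemma jointCont_primX (hf : JointCont f) : JointCont (primX f) := by
  refine jointCont_of_tendsto fun x t ht => ?_
  have hc : Continuous fun p : ℝ × ℝ => f p.1 (max p.2 (t / 2)) := by
    refine ContinuousOn.comp_continuous (s := univ ×ˢ Ioi 0) hf
      (f := fun p : ℝ × ℝ => (p.1, max p.2 (t / 2))) (by fun_prop) fun p => ⟨trivial, ?_⟩
    exact (lt_max_of_lt_right (half_pos ht) : (0 : ℝ) < max p.2 (t / 2))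
  have h := intervalIntegral.continuous_parametric_intervalIntegral_of_continuous (μ := volume)
    (f := fun (p : ℝ × ℝ) y => f y (max p.2 (t / 2))) (a₀ := 0) (s := fun p => p.1)
    (hc.comp (by fun_prop : Continuous fun q : (ℝ × ℝ) × ℝ => (q.2, q.1.2))) continuous_fst
  have h2 : Tendsto (fun p : ℝ × ℝ => ∫ y in (0 : ℝ)..p.1, f y (max p.2 (t / 2))) (𝓝 (x, t))
      (𝓝 (∫ y in (0 : ℝ)..x, f y (max t (t / 2)))) := h.tendsto (x, t)
  rw [max_eq_left (by linarith)] at h2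
  refine h2.congr' ?_
  have : ∀ᶠ p : ℝ × ℝ in 𝓝 (x, t), t / 2 < p.2 :=
    continuous_snd.continuousAt.eventually_const_lt (half_lt_self ht)
  filter_upwards [this] with p hp
  rw [max_eq_left hp.le, primX]

lemma locBdd_primX (hd : LocallyDominated f) : LocBdd (primX f) := by
  intro t ht
  obtain ⟨G, hG, δ, hδ, h⟩ := hd t ht
  refine ⟨∫ y, G y, ?_⟩
  filter_upwards [Ioi_mem_nhds ht, Metric.ball_mem_nhds t hδ] with s h1 h2 x
  have h3 : ∀ y, |f y s| ≤ G y := fun y => h s y h1 h2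
  calc ‖primX f x s‖ ≤ ∫ y in uIoc 0 x, G y := by
        refine (intervalIntegral.norm_integral_le_integral_norm_uIoc).trans ?_
        by_cases hi : IntegrableOn (fun y => ‖f y s‖) (uIoc 0 x)
        · exact setIntegral_mono hi hG.integrableOn h3
        · rw [integral_undef hi]
          exact integral_nonneg fun y => (abs_nonneg _).trans (h3 y)
    _ ≤ _ := setIntegral_le_integral hG (.of_forall fun y => (abs_nonneg _).trans (h3 y))

lemma hasDerivAt_primX_t (hf : ContDiffOn ℝ 1 (fun p : ℝ × ℝ => f p.1 p.2) (univ ×ˢ Ioi 0))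
    (hj : JointCont f) (hjt : JointCont (dT f)) (hb : LocBdd (dT f)) {t : ℝ} (ht : 0 < t) (x : ℝ) :
    HasDerivAt (fun s => primX f x s) (primX (dT f) x t) t := by
  obtain ⟨B, hB⟩ := hb t ht
  refine (intervalIntegral.hasDerivAt_integral_of_dominated_loc_of_deriv_le (μ := volume)
    (F := fun s y => f y s) (F' := fun s y => dT f y s) (bound := fun _ => B)
    (hB.and (Ioi_mem_nhds ht)) ?_ ((hj.continuous ht).intervalIntegrable _ _)
    (hjt.continuous ht).aestronglyMeasurable
    (.of_forall fun y _ s hs => hs.1 y) (by simp)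
    (.of_forall fun y _ s hs => hasDerivAt_dT hf hs.2 y)).2
  filter_upwards [Ioi_mem_nhds ht] with s hs
  exact (hj.continuous hs).aestronglyMeasurable

end PrimX

/-! ### Densities of a layer -/

/-- The tangent vector `γ' = 1 + i ∂_x η`. -/
def tanC (η : ℝ → ℝ → ℝ) (x t : ℝ) : ℂ := 1 + I * dX η x t

/-- The density `g = ∂_x ξ - i ∂_U η`; it is `(∂_x φ - i ∂_y φ) γ'` on the graph of `η`. -/
def densG (U : ℝ) (η ξ : ℝ → ℝ → ℝ) (x t : ℝ) : ℂ := dX ξ x t - I * dU U η x t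

/-- `F = g / γ'`, the value of `∂_x φ - i ∂_y φ` on the graph. -/
def densF (U : ℝ) (η ξ : ℝ → ℝ → ℝ) (x t : ℝ) : ℂ := densG U η ξ x t * (tanC η x t)⁻¹

/-- The primitive of `g`: the value on the graph of the complex potential. -/
def densP (U : ℝ) (η ξ : ℝ → ℝ → ℝ) (x t : ℝ) : ℂ :=
  ξ x t - I * (primX (dT η) x t + U * η x t : ℝ)

/-- The time derivative of `densP`. -/
def densPt (U : ℝ) (η ξ : ℝ → ℝ → ℝ) (x t : ℝ) : ℂ :=
  dT ξ x t - I * (primX (dT (dT η)) x t + U * dT η x t : ℝ)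

/-- The value on the graph of the time derivative of the complex potential. -/
def densM (U : ℝ) (η ξ : ℝ → ℝ → ℝ) (x t : ℝ) : ℂ :=
  densPt U η ξ x t - I * dT η x t * densF U η ξ x t

/-- The `x`-derivative of `densG`. -/
def densGx (U : ℝ) (η ξ : ℝ → ℝ → ℝ) (x t : ℝ) : ℂ :=
  dX (dX ξ) x t - I * (dT (dX η) x t + U * dX (dX η) x t : ℝ)

/-- The `t`-derivative of `densG`. -/
def densGt (U : ℝ) (η ξ : ℝ → ℝ → ℝ) (x t : ℝ) : ℂ :=
  dT (dX ξ) x t - I * (dT (dT η) x t + U * dT (dX η) x t : ℝ)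

/-- The `x`-derivative of `densF`. -/
def densFx (U : ℝ) (η ξ : ℝ → ℝ → ℝ) (x t : ℝ) : ℂ :=
  densGx U η ξ x t * (tanC η x t)⁻¹
    - densG U η ξ x t * (I * dX (dX η) x t * (tanC η x t)⁻¹ * (tanC η x t)⁻¹)

/-- The `x`-derivative of `densM`. -/
def densMx (U : ℝ) (η ξ : ℝ → ℝ → ℝ) (x t : ℝ) : ℂ :=
  densGt U η ξ x t - I * (dT (dX η) x t * densF U η ξ x t + dT η x t * densFx U η ξ x t)

lemma tanC_ne_zero (η : ℝ → ℝ → ℝ) (x t : ℝ) : tanC η x t ≠ 0 := tangent_ne_zero _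

lemma densF_mul_tanC (U : ℝ) (η ξ : ℝ → ℝ → ℝ) (x t : ℝ) :
    densF U η ξ x t * tanC η x t = densG U η ξ x t := by
  rw [densF, inv_mul_cancel_right₀ (tanC_ne_zero _ _ _)]

section PlateLemmas
variable {l : ℝ} {η : ℝ → ℝ → ℝ} (h : PlateClass l η)
include h

namespace PlateClass

lemma contDiffOn_one : ContDiffOn ℝ 1 (fun p : ℝ × ℝ => η p.1 p.2) (univ ×ˢ Ioi 0) :=
  h.contDiffOn.of_le (by norm_num)

lemma contDiffOn_dX : ContDiffOn ℝ 1 (fun p : ℝ × ℝ => dX η p.1 p.2) (univ ×ˢ Ioi 0) :=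
  FluidPlates.contDiffOn_dX (n := 1) h.contDiffOn

lemma contDiffOn_dT : ContDiffOn ℝ 1 (fun p : ℝ × ℝ => dT η p.1 p.2) (univ ×ˢ Ioi 0) :=
  FluidPlates.contDiffOn_dT (n := 1) h.contDiffOn

lemma jc : JointCont η := h.contDiffOn.continuousOn
lemma jc_dX : JointCont (dX η) := h.contDiffOn_dX.continuousOn
lemma jc_dT : JointCont (dT η) := h.contDiffOn_dT.continuousOn
lemma jc_dXX : JointCont (dX (dX η)) :=
  (FluidPlates.contDiffOn_dX (n := 0) h.contDiffOn_dX).continuousOn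
lemma jc_dTX : JointCont (dT (dX η)) :=
  (FluidPlates.contDiffOn_dT (n := 0) h.contDiffOn_dX).continuousOn
lemma jc_dTT : JointCont (dT (dT η)) :=
  (FluidPlates.contDiffOn_dT (n := 0) h.contDiffOn_dT).continuousOn

lemma dec_dX : Decays (dX η) := vanishes_iff_decays.1 h.dX_class.1
lemma dec_dT : Decays (dT η) := vanishes_iff_decays.1 h.dT_class.1
lemma dec_dXX : Decays (dX (dX η)) := vanishes_iff_decays.1 h.dXX_class.1
lemma dec_dTX : Decays (dT (dX η)) := vanishes_iff_decays.1 h.dTX_class.1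
lemma dec_dTT : Decays (dT (dT η)) := vanishes_iff_decays.1 h.dTT_class.1

lemma lb : LocBdd η := by
  have h1 : JointCont fun x t => η x t - l :=
    ContinuousOn.sub (f := fun p : ℝ × ℝ => η p.1 p.2) (g := fun _ => l) h.jc continuousOn_const
  simpa using (h1.locBdd (vanishes_iff_decays.1 h.vanishes)).add (locBdd_const l)

lemma movingGraph : MovingGraph η where
  jointCont := h.jc
  jointCont_dX := h.jc_dX
  locBdd := h.lb
  locBdd_dX := h.jc_dX.locBdd h.dec_dX
  contDiff t ht := (h.contDiff_x t ht).of_le (by norm_num)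

lemma jc_tanC : JointCont (tanC η) :=
  (jointCont_const (1 : ℂ)).add ((jointCont_const I).mul h.jc_dX.ofReal)

omit h in
lemma lb_inv_tanC (η : ℝ → ℝ → ℝ) : LocBdd fun x t => (tanC η x t)⁻¹ := by
  intro t ht
  refine ⟨1, .of_forall fun s x => ?_⟩
  rw [norm_inv]
  refine inv_le_one_of_one_le₀ ?_
  simpa [tanC] using Complex.abs_re_le_norm (tanC η x s)

lemma dec_dU (U : ℝ) : Decays (dU U η) := decays_affine h.dec_dT h.dec_dX U

lemma jc_dU (U : ℝ) : JointCont (dU U η) :=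
  ContinuousOn.add h.jc_dT (continuousOn_const.mul h.jc_dX)

end PlateClass
end PlateLemmas

namespace TraceClass
variable {ξ : ℝ → ℝ → ℝ} (h : TraceClass ξ)
include h

lemma contDiffOn_one : ContDiffOn ℝ 1 (fun p : ℝ × ℝ => ξ p.1 p.2) (univ ×ˢ Ioi 0) :=
  h.contDiffOn.of_le (by norm_num)
lemma contDiffOn_dX : ContDiffOn ℝ 1 (fun p : ℝ × ℝ => dX ξ p.1 p.2) (univ ×ˢ Ioi 0) :=
  FluidPlates.contDiffOn_dX (n := 1) h.contDiffOn
lemma contDiffOn_dT : ContDiffOn ℝ 1 (fun p : ℝ × ℝ => dT ξ p.1 p.2) (univ ×ˢ Ioi 0) :=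
  FluidPlates.contDiffOn_dT (n := 1) h.contDiffOn
lemma jc : JointCont ξ := h.contDiffOn.continuousOn
lemma jc_dX : JointCont (dX ξ) := h.contDiffOn_dX.continuousOn
lemma jc_dT : JointCont (dT ξ) := h.contDiffOn_dT.continuousOn
lemma jc_dXX : JointCont (dX (dX ξ)) :=
  (FluidPlates.contDiffOn_dX (n := 0) h.contDiffOn_dX).continuousOn
lemma jc_dTX : JointCont (dT (dX ξ)) :=
  (FluidPlates.contDiffOn_dT (n := 0) h.contDiffOn_dX).continuousOn
lemma dec : Decays ξ := vanishes_iff_decays.1 h.vanishes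
lemma dec_dX : Decays (dX ξ) := vanishes_iff_decays.1 h.dX_class.1
lemma dec_dT : Decays (dT ξ) := vanishes_iff_decays.1 h.dT_vanishes
lemma dec_dXX : Decays (dX (dX ξ)) := vanishes_iff_decays.1 h.dXX_class.1
lemma dec_dTX : Decays (dT (dX ξ)) := vanishes_iff_decays.1 h.dTX_class.1

end TraceClass

section Densities
variable {l U : ℝ} {η ξ : ℝ → ℝ → ℝ} (h : PlateClass l η) (hξ : TraceClass ξ)
include h hξ

lemma decays_densG : Decays (densG U η ξ) :=
  hξ.dec_dX.ofReal.sub ((h.dec_dU U).ofReal.const_mul I)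

lemma jointCont_densG : JointCont (densG U η ξ) :=
  hξ.jc_dX.ofReal.sub ((jointCont_const I).mul (h.jc_dU U).ofReal)

lemma locBdd_densG : LocBdd (densG U η ξ) := (jointCont_densG h hξ).locBdd (decays_densG h hξ)

lemma integrable_densG {t : ℝ} (ht : 0 < t) : Integrable fun x => densG U η ξ x t :=
  (hξ.dX_class.2.integrable hξ.jc_dX ht).ofReal.sub
    ((((h.dT_class.2.integrable h.jc_dT ht).add
      ((h.dX_class.2.integrable h.jc_dX ht).const_mul U)).ofReal).const_mul I)

lemma decays_densF : Decays (densF U η ξ) := (decays_densG h hξ).mul_locBdd (PlateClass.lb_inv_tanC η)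

lemma jointCont_densF : JointCont (densF U η ξ) :=
  (jointCont_densG h hξ).mul (h.jc_tanC.inv (tanC_ne_zero η))

lemma locBdd_densF : LocBdd (densF U η ξ) := (jointCont_densF h hξ).locBdd (decays_densF h hξ)

lemma decays_densGx : Decays (densGx U η ξ) :=
  hξ.dec_dXX.ofReal.sub ((decays_affine h.dec_dTX h.dec_dXX U).ofReal.const_mul I)

lemma decays_densGt : Decays (densGt U η ξ) :=
  hξ.dec_dTX.ofReal.sub ((decays_affine h.dec_dTT h.dec_dTX U).ofReal.const_mul I)

lemma jointCont_densGx : JointCont (densGx U η ξ) :=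
  hξ.jc_dXX.ofReal.sub ((jointCont_const I).mul (jointCont_affine h.jc_dTX h.jc_dXX U).ofReal)

lemma jointCont_densGt : JointCont (densGt U η ξ) :=
  hξ.jc_dTX.ofReal.sub ((jointCont_const I).mul (jointCont_affine h.jc_dTT h.jc_dTX U).ofReal)

lemma decays_densFx : Decays (densFx U η ξ) :=
  ((decays_densGx h hξ).mul_locBdd (PlateClass.lb_inv_tanC η)).sub
    ((decays_densG h hξ).mul_locBdd ((((locBdd_const I).mul
      (h.jc_dXX.locBdd h.dec_dXX).ofReal).mul (PlateClass.lb_inv_tanC η)).mul (PlateClass.lb_inv_tanC η)))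

lemma jointCont_densFx : JointCont (densFx U η ξ) := by
  have hi := h.jc_tanC.inv (tanC_ne_zero η)
  exact ((jointCont_densGx h hξ).mul hi).sub
    ((jointCont_densG h hξ).mul ((((jointCont_const I).mul h.jc_dXX.ofReal).mul hi).mul hi))

lemma hasDerivAt_densG {t : ℝ} (ht : 0 < t) (x : ℝ) :
    HasDerivAt (fun x => densG U η ξ x t) (densGx U η ξ x t) x := by
  have h1 := (hasDerivAt_dX hξ.contDiffOn_dX ht x).ofReal_comp
  have h2 := hasDerivAt_dX h.contDiffOn_dT ht x
  have h3 := (hasDerivAt_dX h.contDiffOn_dX ht x).const_mul U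
  rw [dX_dT_comm h.contDiffOn ht] at h2
  exact h1.sub ((h2.add h3).ofReal_comp.const_mul I)

lemma hasDerivAt_densF {t : ℝ} (ht : 0 < t) (x : ℝ) :
    HasDerivAt (fun x => densF U η ξ x t) (densFx U η ξ x t) x := by
  have h1 : HasDerivAt (fun x => tanC η x t) (I * dX (dX η) x t) x :=
    ((hasDerivAt_dX h.contDiffOn_dX ht x).ofReal_comp.const_mul I).const_add 1
  refine ((hasDerivAt_densG h hξ ht x).mul (h1.fun_inv (tanC_ne_zero η x t))).congr_deriv ?_
  rw [densFx, div_eq_mul_inv, sq, mul_inv]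
  ring

lemma density_densF : Density (densF U η ξ) (densFx U η ξ) where
  jointCont := jointCont_densF h hξ
  hasDerivAt _ ht x := hasDerivAt_densF h hξ ht x
  locBdd := locBdd_densF h hξ
  locBdd_deriv := (jointCont_densFx h hξ).locBdd (decays_densFx h hξ)
  decays_deriv := decays_densFx h hξ

lemma density_densP : Density (densP U η ξ) (densG U η ξ) where
  jointCont := hξ.jc.ofReal.sub ((jointCont_const I).mul
    (jointCont_affine (jointCont_primX h.jc_dT) h.jc U).ofReal)
  hasDerivAt _ ht x := (hasDerivAt_dX hξ.contDiffOn_one ht x).ofReal_comp.sub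
    (((hasDerivAt_primX_x h.jc_dT ht x).add
      ((hasDerivAt_dX h.contDiffOn_one ht x).const_mul U)).ofReal_comp.const_mul I)
  locBdd := (hξ.jc.locBdd hξ.dec).ofReal.sub ((locBdd_const I).mul (LocBdd.ofReal
    (locBdd_affine (locBdd_primX h.dT_class.2) h.lb U)))
  locBdd_deriv := locBdd_densG h hξ
  decays_deriv := decays_densG h hξ

lemma jointCont_densPt : JointCont (densPt U η ξ) :=
  hξ.jc_dT.ofReal.sub ((jointCont_const I).mul
    (jointCont_affine (jointCont_primX h.jc_dTT) h.jc_dT U).ofReal)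

lemma locBdd_densPt : LocBdd (densPt U η ξ) :=
  (hξ.jc_dT.locBdd hξ.dec_dT).ofReal.sub ((locBdd_const I).mul (LocBdd.ofReal
    (locBdd_affine (locBdd_primX h.dTT_class.2) (h.jc_dT.locBdd h.dec_dT) U)))

lemma hasDerivAt_densPt {t : ℝ} (ht : 0 < t) (x : ℝ) :
    HasDerivAt (fun x => densPt U η ξ x t) (densGt U η ξ x t) x := by
  have h1 := hasDerivAt_dX hξ.contDiffOn_dT ht x
  have h3 := hasDerivAt_dX h.contDiffOn_dT ht x
  rw [dX_dT_comm hξ.contDiffOn ht] at h1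
  rw [dX_dT_comm h.contDiffOn ht] at h3
  exact h1.ofReal_comp.sub
    (((hasDerivAt_primX_x h.jc_dTT ht x).add (h3.const_mul U)).ofReal_comp.const_mul I)

lemma hasDerivAt_densP_t {t : ℝ} (ht : 0 < t) (x : ℝ) :
    HasDerivAt (fun s => densP U η ξ x s) (densPt U η ξ x t) t :=
  (hasDerivAt_dT hξ.contDiffOn_one ht x).ofReal_comp.sub
    (((hasDerivAt_primX_t h.contDiffOn_dT h.jc_dT h.jc_dTT (h.jc_dTT.locBdd h.dec_dTT) ht x).add
      ((hasDerivAt_dT h.contDiffOn_one ht x).const_mul U)).ofReal_comp.const_mul I)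

lemma decays_densMx : Decays (densMx U η ξ) :=
  (decays_densGt h hξ).sub (((h.dec_dTX.ofReal.mul_locBdd (locBdd_densF h hξ)).add
    (h.dec_dT.ofReal.mul_locBdd
      ((jointCont_densFx h hξ).locBdd (decays_densFx h hξ)))).const_mul I)

lemma jointCont_densMx : JointCont (densMx U η ξ) :=
  (jointCont_densGt h hξ).sub ((jointCont_const I).mul
    ((h.jc_dTX.ofReal.mul (jointCont_densF h hξ)).add (h.jc_dT.ofReal.mul (jointCont_densFx h hξ))))

lemma density_densM : Density (densM U η ξ) (densMx U η ξ) where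
  jointCont := (jointCont_densPt h hξ).sub
    (((jointCont_const I).mul h.jc_dT.ofReal).mul (jointCont_densF h hξ))
  hasDerivAt t ht x := by
    have h3 := hasDerivAt_dX h.contDiffOn_dT ht x
    rw [dX_dT_comm h.contDiffOn ht] at h3
    refine ((hasDerivAt_densPt h hξ ht x).sub ((h3.ofReal_comp.const_mul I).mul
      (hasDerivAt_densF h hξ ht x))).congr_deriv ?_
    rw [densMx]; ring
  locBdd := (locBdd_densPt h hξ).sub
    (((locBdd_const I).mul (h.jc_dT.locBdd h.dec_dT).ofReal).mul (locBdd_densF h hξ))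
  locBdd_deriv := (jointCont_densMx h hξ).locBdd (decays_densMx h hξ)
  decays_deriv := decays_densMx h hξ

lemma bddPrimitive_densP {t : ℝ} (ht : 0 < t) :
    BddPrimitive (fun x => densP U η ξ x t) (fun x => densG U η ξ x t) where
  hasDerivAt := (density_densP h hξ).hasDerivAt t ht
  continuous_density := (jointCont_densG h hξ).continuous ht
  bdd := (density_densP h hξ).locBdd.at ht
  bdd_density := (locBdd_densG h hξ).at ht
  integrable := integrable_densG h hξ ht

/-- The real part of the boundary value of the time derivative decays. -/
lemma decays_re_densM : Decays fun x t => (densM U η ξ x t).re := by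
  have h1 : LocBdd fun x t => (densF U η ξ x t).im := fun t ht => by
    obtain ⟨B, hB⟩ := locBdd_densF h hξ t ht
    exact ⟨B, hB.mono fun s hs x => (Complex.abs_im_le_norm _).trans (hs x)⟩
  have h2 := hξ.dec_dT.add (h.dec_dT.mul_locBdd h1)
  convert h2 using 3 with x t
  simp [densM, densPt]

end Densities

/-! ### The space-time region of a layer -/

/-- The space-time region between the graphs of `a` and `b`, boundary included, for `t > 0`. -/
def region (a b : ℝ → ℝ → ℝ) : Set (ℝ × ℝ × ℝ) :=
  {p | 0 < p.2.2 ∧ a p.1 p.2.2 ≤ p.2.1 ∧ p.2.1 ≤ b p.1 p.2.2}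

/-- The interior of `region`. -/
def openRegion (a b : ℝ → ℝ → ℝ) : Set (ℝ × ℝ × ℝ) :=
  {p | 0 < p.2.2 ∧ a p.1 p.2.2 < p.2.1 ∧ p.2.1 < b p.1 p.2.2}

/-- Two ordered moving graphs of class `C¹`. -/
structure OrderedC1 (a b : ℝ → ℝ → ℝ) : Prop where
  lower : ContDiffOn ℝ 1 (fun p : ℝ × ℝ => a p.1 p.2) (univ ×ˢ Ioi 0)
  upper : ContDiffOn ℝ 1 (fun p : ℝ × ℝ => b p.1 p.2) (univ ×ˢ Ioi 0)
  lt : ∀ x t, 0 < t → a x t < b x t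

/-- The half-space of positive times. -/
def posTime : Set (ℝ × ℝ × ℝ) := {p | 0 < p.2.2}

lemma isOpen_posTime : IsOpen posTime := isOpen_lt continuous_const (by fun_prop)

/-- The map straightening the region: `(x, σ, t) ↦ (x, a + σ (b - a), t)`. -/
def straighten (a b : ℝ → ℝ → ℝ) (q : ℝ × ℝ × ℝ) : ℝ × ℝ × ℝ :=
  (q.1, a q.1 q.2.2 + q.2.1 * (b q.1 q.2.2 - a q.1 q.2.2), q.2.2)

/-- The inverse of `straighten` for positive times. -/
def unstraighten (a b : ℝ → ℝ → ℝ) (p : ℝ × ℝ × ℝ) : ℝ × ℝ × ℝ :=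
  (p.1, (p.2.1 - a p.1 p.2.2) / (b p.1 p.2.2 - a p.1 p.2.2), p.2.2)

namespace OrderedC1
variable {a b : ℝ → ℝ → ℝ} (h : OrderedC1 a b)
include h

lemma straighten_unstraighten {p : ℝ × ℝ × ℝ} (hp : p ∈ posTime) :
    straighten a b (unstraighten a b p) = p := by
  have := sub_pos.2 (h.lt p.1 p.2.2 hp)
  ext
  · rfl
  · simp only [straighten, unstraighten]; field_simp; ring
  · rfl

lemma unstraighten_straighten {q : ℝ × ℝ × ℝ} (hq : q ∈ posTime) :
    unstraighten a b (straighten a b q) = q := by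
  have := sub_pos.2 (h.lt q.1 q.2.2 hq)
  ext
  · rfl
  · simp only [straighten, unstraighten]; field_simp; ring
  · rfl

lemma contDiffOn_lower : ContDiffOn ℝ 1 (fun p : ℝ × ℝ × ℝ => a p.1 p.2.2) posTime :=
  h.lower.comp (g := fun p : ℝ × ℝ => a p.1 p.2) (f := fun p : ℝ × ℝ × ℝ => (p.1, p.2.2))
    (by fun_prop) fun p hp => ⟨trivial, hp⟩

lemma contDiffOn_upper : ContDiffOn ℝ 1 (fun p : ℝ × ℝ × ℝ => b p.1 p.2.2) posTime :=
  h.upper.comp (g := fun p : ℝ × ℝ => b p.1 p.2) (f := fun p : ℝ × ℝ × ℝ => (p.1, p.2.2))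
    (by fun_prop) fun p hp => ⟨trivial, hp⟩

lemma contDiffOn_straighten : ContDiffOn ℝ 1 (straighten a b) posTime := by
  have h1 := h.contDiffOn_lower
  have h2 := h.contDiffOn_upper
  exact contDiffOn_fst.prodMk ((h1.add ((by fun_prop : ContDiffOn ℝ 1
    (fun q : ℝ × ℝ × ℝ => q.2.1) posTime).mul (h2.sub h1))).prodMk (by fun_prop))

lemma contDiffOn_unstraighten : ContDiffOn ℝ 1 (unstraighten a b) posTime := by
  have h1 := h.contDiffOn_lower
  have h2 := h.contDiffOn_upper
  have h3 : ContDiffOn ℝ 1 (fun p : ℝ × ℝ × ℝ =>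
      (p.2.1 - a p.1 p.2.2) / (b p.1 p.2.2 - a p.1 p.2.2)) posTime :=
    ContDiffOn.div ((by fun_prop : ContDiffOn ℝ 1 (fun q : ℝ × ℝ × ℝ => q.2.1) posTime).sub h1)
      (h2.sub h1) fun p hp => (sub_pos.2 (h.lt p.1 p.2.2 hp)).ne'
  exact contDiffOn_fst.prodMk (h3.prodMk (by fun_prop))

lemma hasFDerivAt_straighten {q : ℝ × ℝ × ℝ} (hq : q ∈ posTime) :
    HasFDerivAt (straighten a b) (fderiv ℝ (straighten a b) q) q :=
  ((h.contDiffOn_straighten.contDiffAt (isOpen_posTime.mem_nhds hq)).differentiableAt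
    one_ne_zero).hasFDerivAt

lemma hasFDerivAt_unstraighten {q : ℝ × ℝ × ℝ} (hq : q ∈ posTime) :
    HasFDerivAt (unstraighten a b) (fderiv ℝ (unstraighten a b) q) q :=
  ((h.contDiffOn_unstraighten.contDiffAt (isOpen_posTime.mem_nhds hq)).differentiableAt
    one_ne_zero).hasFDerivAt

omit h in
lemma unstraighten_mem_posTime {p : ℝ × ℝ × ℝ} (hp : p ∈ posTime) :
    unstraighten a b p ∈ posTime := hp

lemma fderiv_straighten_comp {p : ℝ × ℝ × ℝ} (hp : p ∈ posTime) :
    (fderiv ℝ (straighten a b) (unstraighten a b p)).comp (fderiv ℝ (unstraighten a b) p)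
      = ContinuousLinearMap.id ℝ _ := by
  have h1 := (h.hasFDerivAt_straighten (unstraighten_mem_posTime (a := a) (b := b) hp)).comp p
    (h.hasFDerivAt_unstraighten hp)
  refine h1.unique ((hasFDerivAt_id p).congr_of_eventuallyEq ?_)
  filter_upwards [isOpen_posTime.mem_nhds hp] with r hr
  exact h.straighten_unstraighten hr

lemma straighten_mem_region {q : ℝ × ℝ × ℝ} (hq : q ∈ posTime) (hσ : q.2.1 ∈ Icc (0 : ℝ) 1) :
    straighten a b q ∈ region a b := by
  have := h.lt q.1 q.2.2 hq
  refine ⟨hq, ?_, ?_⟩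
  · simp only [straighten]; nlinarith [hσ.1]
  · simp only [straighten]; nlinarith [hσ.2]

lemma straighten_mem_openRegion {q : ℝ × ℝ × ℝ} (hq : q ∈ posTime) (hσ : q.2.1 ∈ Ioo (0 : ℝ) 1) :
    straighten a b q ∈ openRegion a b := by
  have := h.lt q.1 q.2.2 hq
  refine ⟨hq, ?_, ?_⟩
  · simp only [straighten]; nlinarith [hσ.1]
  · simp only [straighten]; nlinarith [hσ.2]

lemma unstraighten_mem_Icc {p : ℝ × ℝ × ℝ} (hp : p ∈ region a b) :
    (unstraighten a b p).2.1 ∈ Icc (0 : ℝ) 1 := by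
  have := sub_pos.2 (h.lt p.1 p.2.2 hp.1)
  refine ⟨div_nonneg (by linarith [hp.2.1]) this.le, (div_le_one this).2 (by linarith [hp.2.2])⟩

lemma region_eq_image :
    region a b = straighten a b '' (univ ×ˢ Icc (0 : ℝ) 1 ×ˢ Ioi (0 : ℝ)) := by
  ext p
  constructor
  · intro hp
    exact ⟨unstraighten a b p, ⟨trivial, h.unstraighten_mem_Icc hp, hp.1⟩,
      h.straighten_unstraighten hp.1⟩
  · rintro ⟨q, ⟨-, h1, h2⟩, rfl⟩
    exact h.straighten_mem_region h2 h1

lemma uniqueDiffOn_region : UniqueDiffOn ℝ (region a b) := by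
  rw [h.region_eq_image]
  refine UniqueDiffOn.image (f' := fun q => fderiv ℝ (straighten a b) q)
    (uniqueDiffOn_univ.prod ((uniqueDiffOn_Icc one_pos).prod (uniqueDiffOn_Ioi 0)))
    (fun q hq => (h.hasFDerivAt_straighten hq.2.2).hasFDerivWithinAt) fun q hq => ?_
  have hp : straighten a b q ∈ posTime := hq.2.2
  have h1 := h.fderiv_straighten_comp hp
  rw [h.unstraighten_straighten hq.2.2] at h1
  refine Function.Surjective.denseRange fun v => ⟨fderiv ℝ (unstraighten a b) (straighten a b q) v, ?_⟩
  exact DFunLike.congr_fun h1 v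

lemma isOpen_openRegion : IsOpen (openRegion a b) := by
  have h1 : IsOpen (posTime ∩ {p | (fun p : ℝ × ℝ × ℝ => p.2.1 - a p.1 p.2.2) p ∈ Ioi 0}) :=
    ContinuousOn.isOpen_inter_preimage ((by fun_prop : Continuous fun p : ℝ × ℝ × ℝ =>
      p.2.1).continuousOn.sub h.contDiffOn_lower.continuousOn) isOpen_posTime isOpen_Ioi
  have h2 : IsOpen (posTime ∩ {p | (fun p : ℝ × ℝ × ℝ => b p.1 p.2.2 - p.2.1) p ∈ Ioi 0}) :=
    ContinuousOn.isOpen_inter_preimage (h.contDiffOn_upper.continuousOn.sub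
      (by fun_prop : Continuous fun p : ℝ × ℝ × ℝ => p.2.1).continuousOn) isOpen_posTime isOpen_Ioi
  convert h1.inter h2 using 1
  ext p
  simp only [openRegion, posTime, mem_inter_iff, mem_ofPred_eq, mem_Ioi, sub_pos]
  tauto

omit h in
lemma openRegion_subset : openRegion a b ⊆ region a b := fun _ hp => ⟨hp.1, hp.2.1.le, hp.2.2.le⟩

lemma region_mem_nhds {p : ℝ × ℝ × ℝ} (hp : p ∈ openRegion a b) : region a b ∈ 𝓝 p :=
  mem_of_superset (h.isOpen_openRegion.mem_nhds hp) openRegion_subset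

/-- A function whose derivative in the open region extends continuously to the closed region is
differentiable there, in the sense of the closed region. -/
lemma hasFDerivWithinAt_region {φ : ℝ × ℝ × ℝ → ℝ} {L : ℝ × ℝ × ℝ → (ℝ × ℝ × ℝ →L[ℝ] ℝ)}
    (hφ : ContinuousOn φ (region a b)) (hL : ContinuousOn L (region a b))
    (hd : ∀ p ∈ openRegion a b, HasFDerivAt φ (L p) p) {p : ℝ × ℝ × ℝ} (hp : p ∈ region a b) :
    HasFDerivWithinAt φ (L p) (region a b) p := by
  -- The straightened region is locally a convex set, to which the extension theorem for derivatives
  -- applies.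
  set Ψ := straighten a b with hΨ
  set Ξ := unstraighten a b with hΞ
  set t := p.2.2 with ht
  have ht0 : 0 < t := hp.1
  set s : Set (ℝ × ℝ × ℝ) := univ ×ˢ Ioo (0 : ℝ) 1 ×ˢ Ioo (t / 2) (2 * t) with hs
  have hcl : closure s = univ ×ˢ Icc (0 : ℝ) 1 ×ˢ Icc (t / 2) (2 * t) := by
    rw [hs, closure_prod_eq, closure_prod_eq, closure_univ, closure_Ioo (by norm_num),
      closure_Ioo (by linarith)]
  have hpos : ∀ q ∈ closure s, q ∈ posTime := by
    intro q hq
    rw [hcl] at hq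
    exact lt_of_lt_of_le (by positivity : 0 < t / 2) hq.2.2.1
  have hmapc : ∀ q ∈ closure s, Ψ q ∈ region a b := fun q hq =>
    h.straighten_mem_region (hpos q hq) (by rw [hcl] at hq; exact hq.2.1)
  have hmap : ∀ q ∈ s, Ψ q ∈ openRegion a b := fun q hq =>
    h.straighten_mem_openRegion (hpos q (subset_closure hq)) hq.2.1
  have hΨc : ∀ q ∈ closure s, ContinuousAt Ψ q := fun q hq =>
    (h.hasFDerivAt_straighten (hpos q hq)).continuousAt
  have htend : ∀ q ∈ closure s, Tendsto Ψ (𝓝[s] q) (𝓝[region a b] (Ψ q)) := fun q hq =>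
    tendsto_nhdsWithin_of_tendsto_nhds_of_eventually_within _
      ((hΨc q hq).tendsto.mono_left nhdsWithin_le_nhds)
      (eventually_mem_nhdsWithin.mono fun r hr => hmapc r (subset_closure hr))
  have hder : ∀ q ∈ s, HasFDerivAt (φ ∘ Ψ) ((L (Ψ q)).comp (fderiv ℝ Ψ q)) q := fun q hq =>
    (hd _ (hmap q hq)).comp q (h.hasFDerivAt_straighten (hpos q (subset_closure hq)))
  have hq : Ξ p ∈ closure s := by
    rw [hcl]
    exact ⟨trivial, h.unstraighten_mem_Icc hp, by show t / 2 ≤ t; linarith, by show t ≤ 2 * t; linarith⟩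
  have hΨΞ : Ψ (Ξ p) = p := h.straighten_unstraighten hp.1
  have key : HasFDerivWithinAt (φ ∘ Ψ) ((L p).comp (fderiv ℝ Ψ (Ξ p))) (closure s) (Ξ p) := by
    refine hasFDerivWithinAt_closure_of_tendsto_fderiv
      (fun q hq => (hder q hq).differentiableAt.differentiableWithinAt)
      (convex_univ.prod ((convex_Ioo _ _).prod (convex_Ioo _ _)))
      (isOpen_univ.prod (isOpen_Ioo.prod isOpen_Ioo))
      (fun q hq => (hφ _ (hmapc q hq)).tendsto.comp (htend q hq)) ?_
    have h1 : Tendsto (fun q => (L (Ψ q)).comp (fderiv ℝ Ψ q)) (𝓝[s] (Ξ p))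
        (𝓝 ((L p).comp (fderiv ℝ Ψ (Ξ p)))) := by
      have h2 : Tendsto (fun q => L (Ψ q)) (𝓝[s] (Ξ p)) (𝓝 (L p)) := by
        have := (hL _ (hmapc _ hq)).tendsto.comp (htend _ hq)
        rwa [hΨΞ] at this
      have h3 : Tendsto (fderiv ℝ Ψ) (𝓝[s] (Ξ p)) (𝓝 (fderiv ℝ Ψ (Ξ p))) :=
        (((h.contDiffOn_straighten.contDiffAt (isOpen_posTime.mem_nhds (hpos _ hq))).fderiv_right
          (m := 0) (by norm_num)).continuousAt.tendsto).mono_left nhdsWithin_le_nhds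
      exact (isBoundedBilinearMap_comp.continuous.tendsto (L p, fderiv ℝ Ψ (Ξ p))).comp
        (h2.prodMk_nhds h3)
    refine h1.congr' ?_
    filter_upwards [self_mem_nhdsWithin] with q hq
    exact (hder q hq).fderiv.symm
  set V : Set (ℝ × ℝ × ℝ) := {r | r.2.2 ∈ Ioo (t / 2) (2 * t)} with hV
  have hVo : V ∈ 𝓝 p := (isOpen_Ioo.preimage (by fun_prop :
    Continuous fun r : ℝ × ℝ × ℝ => r.2.2)).mem_nhds
      ⟨by show t / 2 < t; linarith, by show t < 2 * t; linarith⟩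
  have hcomp := key.comp p (h.hasFDerivAt_unstraighten hp.1).hasFDerivWithinAt
    (s := region a b ∩ V) (fun r hr => by
      rw [hcl]
      exact ⟨trivial, h.unstraighten_mem_Icc hr.1, hr.2.1.le, hr.2.2.le⟩)
  rw [hasFDerivWithinAt_inter hVo, ContinuousLinearMap.comp_assoc, h.fderiv_straighten_comp hp.1,
    ContinuousLinearMap.comp_id] at hcomp
  refine hcomp.congr (fun r hr => ?_) ?_
  · exact congrArg φ (h.straighten_unstraighten hr.1).symm
  · exact congrArg φ (h.straighten_unstraighten hp.1).symm

lemma contDiffOn_one_region {φ : ℝ × ℝ × ℝ → ℝ} {L : ℝ × ℝ × ℝ → (ℝ × ℝ × ℝ →L[ℝ] ℝ)}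
    (hL : ContinuousOn L (region a b))
    (hd : ∀ p ∈ region a b, HasFDerivWithinAt φ (L p) (region a b) p) :
    ContDiffOn ℝ 1 φ (region a b) := by
  have h1 := (contDiffOn_succ_iff_fderivWithin (n := 0) (f := φ) h.uniqueDiffOn_region).2
    ⟨fun p hp => (hd p hp).differentiableWithinAt, by simp, contDiffOn_zero.2 (hL.congr fun p hp =>
      (hd p hp).fderivWithin (h.uniqueDiffOn_region p hp))⟩
  simpa using h1

end OrderedC1

/-! ### The extension to the closed region -/

section StripFn
variable {a b : ℝ → ℝ → ℝ} {Ma ma Mb mb : ℝ → ℝ → ℂ}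

/-- `stripFn` at each time, for moving graphs and time-dependent densities. -/
def movingFn (a b : ℝ → ℝ → ℝ) (Ma Mb : ℝ → ℝ → ℂ) (p : ℝ × ℝ × ℝ) : ℂ :=
  stripFn (fun x => a x p.2.2) (fun x => b x p.2.2) (fun x => Ma x p.2.2) (fun x => Mb x p.2.2)
    p.1 p.2.1

lemma movingFn_lower (a b : ℝ → ℝ → ℝ) (Ma Mb : ℝ → ℝ → ℂ) (x t : ℝ) :
    movingFn a b Ma Mb (x, a x t, t) = Ma x t :=
  stripFn_lower (fun x => a x t) (fun x => b x t) (fun x => Ma x t) (fun x => Mb x t) x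

lemma continuousAt_movingFn (ha : MovingGraph a) (hb : MovingGraph b) (hMa : Density Ma ma)
    (hMb : Density Mb mb) {p : ℝ × ℝ × ℝ} (hp : p ∈ posTime) :
    ContinuousAt (movingFn a b Ma Mb) p := by
  have hp' : 0 < p.2.2 := hp
  have c1 : Tendsto (fun q : ℝ × ℝ × ℝ => q.1) (𝓝 p) (𝓝 p.1) := continuous_fst.continuousAt
  have c2 : Tendsto (fun q : ℝ × ℝ × ℝ => q.2.1) (𝓝 p) (𝓝 p.2.1) :=
    (by fun_prop : Continuous fun q : ℝ × ℝ × ℝ => q.2.1).continuousAt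
  have c3 : Tendsto (fun q : ℝ × ℝ × ℝ => q.2.2) (𝓝 p) (𝓝 p.2.2) :=
    (by fun_prop : Continuous fun q : ℝ × ℝ × ℝ => q.2.2).continuousAt
  have c4 := ((ha.jointCont.tendsto hp' c1 c3).const_mul 2).sub c2
  exact (hMa.jointCont.tendsto hp' c1 c3).add
    (((tendsto_err_nhds ha hMa hp' c1 c2 c4 c3).sub (tendsto_err_nhds hb hMb hp' c1 c2 c4 c3)).const_mul _)

/-- The filter of points of `D` with `|x| → ∞` and time close to `t`. -/
def farFilter (D : Set (ℝ × ℝ × ℝ)) (t : ℝ) : Filter (ℝ × ℝ × ℝ) :=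
  comap (fun p : ℝ × ℝ × ℝ => (p.1, p.2.2)) (cocompact ℝ ×ˢ 𝓝 t) ⊓ 𝓟 D

instance (D : Set (ℝ × ℝ × ℝ)) (t : ℝ) : (farFilter D t).IsCountablyGenerated := by
  have : (cocompact ℝ).IsCountablyGenerated := by
    rw [← Metric.cobounded_eq_cocompact, ← comap_norm_atTop]
    infer_instance
  unfold farFilter
  infer_instance

lemma tendsto_farFilter (D : Set (ℝ × ℝ × ℝ)) (t : ℝ) :
    Tendsto (fun p : ℝ × ℝ × ℝ => (p.1, p.2.2)) (farFilter D t) (cocompact ℝ ×ˢ 𝓝 t) :=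
  tendsto_comap.mono_left inf_le_left

lemma vanishesOn_of_tendsto {D : Set (ℝ × ℝ × ℝ)} (hD : D ⊆ posTime) {F : ℝ × ℝ × ℝ → ℝ}
    (h : ∀ t > 0, Tendsto F (farFilter D t) (𝓝 0)) : VanishesOn D F := by
  intro t ht ε hε
  have h1 := Metric.tendsto_nhds.1 (h t ht) ε hε
  rw [farFilter, eventually_inf_principal, eventually_comap] at h1
  obtain ⟨δ, hδ, R, h2⟩ := (eventually_cocompact_prod_nhds ht (p := fun x s =>
    ∀ p : ℝ × ℝ × ℝ, (p.1, p.2.2) = (x, s) → p ∈ D → dist (F p) 0 < ε)).1 h1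
  refine ⟨δ, hδ, R, fun s x y hp hs hx => ?_⟩
  have := h2 s x (hD hp) hs hx (x, y, s) rfl hp
  rwa [dist_zero_right, Real.norm_eq_abs] at this

lemma region_subset_posTime : region a b ⊆ posTime := fun _ hp => hp.1

lemma tendsto_movingFn_sub (ha : MovingGraph a) (hb : MovingGraph b) (hMa : Density Ma ma)
    (hMb : Density Mb mb) {t : ℝ} (ht : 0 < t) :
    Tendsto (fun p => movingFn a b Ma Mb p - Ma p.1 p.2.2) (farFilter (region a b) t) (𝓝 0) := by
  have hx : Tendsto (fun p : ℝ × ℝ × ℝ => p.1) (farFilter (region a b) t) (cocompact ℝ) :=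
    (tendsto_farFilter (region a b) t).fst
  have hs : Tendsto (fun p : ℝ × ℝ × ℝ => p.2.2) (farFilter (region a b) t) (𝓝 t) :=
    (tendsto_farFilter (region a b) t).snd
  obtain ⟨A, hA⟩ := ha.locBdd t ht
  obtain ⟨B, hB⟩ := hb.locBdd t ht
  have hH : ∀ᶠ p in farFilter (region a b) t,
      |p.2.1 - (2 * a p.1 p.2.2 - p.2.1)| ≤ 2 * (A + B) := by
    filter_upwards [hs.eventually hA, hs.eventually hB,
      mem_inf_of_right (mem_principal_self _)] with p h1 h2 h3
    rw [abs_of_nonneg (by linarith [h3.2.1])]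
    have h4 := (abs_le.1 (h1 p.1)).1
    have h5 := (abs_le.1 (h2 p.1)).2
    linarith [h3.2.2]
  have h1 := tendsto_err_zero ha hMa ht hx hs hH
  have h2 := tendsto_err_zero hb hMb ht hx hs hH
  have h3 := (h1.sub h2).const_mul ((2 * Real.pi * I : ℂ)⁻¹)
  rw [sub_zero, mul_zero] at h3
  refine h3.congr fun p => ?_
  simp only [movingFn, stripFn, add_sub_cancel_left]

lemma tendsto_movingFn (ha : MovingGraph a) (hb : MovingGraph b) (hMa : Density Ma ma)
    (hMb : Density Mb mb) (hd : Decays Ma) {t : ℝ} (ht : 0 < t) :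
    Tendsto (movingFn a b Ma Mb) (farFilter (region a b) t) (𝓝 0) := by
  simpa using (tendsto_movingFn_sub ha hb hMa hMb ht).add ((hd t ht).comp (tendsto_farFilter _ _))

lemma tendsto_re_movingFn (ha : MovingGraph a) (hb : MovingGraph b) (hMa : Density Ma ma)
    (hMb : Density Mb mb) (hd : Decays fun x t => (Ma x t).re) {t : ℝ} (ht : 0 < t) :
    Tendsto (fun p => (movingFn a b Ma Mb p).re) (farFilter (region a b) t) (𝓝 0) := by
  have h1 := (Complex.continuous_re.tendsto 0).comp (tendsto_movingFn_sub ha hb hMa hMb ht)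
  have h2 := h1.add ((hd t ht).comp (tendsto_farFilter (region a b) t))
  simpa [Function.comp_def] using h2

end StripFn

/-! ### Layers -/

/-- The data of one layer: its two surfaces `a < b`, the boundary potentials `α` and `β`, and the
equality of the exponential moments of the corresponding densities. -/
structure LayerData (a b α β : ℝ → ℝ → ℝ) (U : ℝ) : Prop where
  lower : ∃ l, PlateClass l a
  upper : ∃ l, PlateClass l b
  lt : ∀ x t, 0 < t → a x t < b x t
  traceLower : TraceClass α
  traceUpper : TraceClass β
  moment : ∀ t > 0, ∀ k : ℝ, ∫ x, cexp (-I * k * pt (fun x => a x t) x) * densG U a α x t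
    = ∫ x, cexp (-I * k * pt (fun x => b x t) x) * densG U b β x t

section Neg

lemma dX_neg (f : ℝ → ℝ → ℝ) : dX (fun x t => -f x t) = fun x t => -dX f x t := by
  ext x t; simp [dX]

lemma dT_neg (f : ℝ → ℝ → ℝ) : dT (fun x t => -f x t) = fun x t => -dT f x t := by
  ext x t; simp [dT]

lemma Vanishes.neg {f : ℝ → ℝ → ℝ} (h : Vanishes f) : Vanishes fun x t => -f x t := by
  simpa [Vanishes] using h

lemma LocallyDominated.neg {f : ℝ → ℝ → ℝ} (h : LocallyDominated f) :
    LocallyDominated fun x t => -f x t := by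
  simpa [LocallyDominated] using h

lemma PlateClass.neg {l : ℝ} {η : ℝ → ℝ → ℝ} (h : PlateClass l η) :
    PlateClass (-l) fun x t => -η x t where
  contDiffOn := h.contDiffOn.neg
  contDiff_x t ht := (h.contDiff_x t ht).neg
  vanishes := by
    have := h.vanishes.neg
    convert this using 3
    ring
  dX_class := by rw [dX_neg]; exact ⟨h.dX_class.1.neg, h.dX_class.2.neg⟩
  dT_class := by rw [dT_neg]; exact ⟨h.dT_class.1.neg, h.dT_class.2.neg⟩
  dXX_class := by rw [dX_neg, dX_neg]; exact ⟨h.dXX_class.1.neg, h.dXX_class.2.neg⟩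
  dTX_class := by rw [dX_neg, dT_neg]; exact ⟨h.dTX_class.1.neg, h.dTX_class.2.neg⟩
  dTT_class := by rw [dT_neg, dT_neg]; exact ⟨h.dTT_class.1.neg, h.dTT_class.2.neg⟩

lemma densG_neg (U : ℝ) (η ξ : ℝ → ℝ → ℝ) (x t : ℝ) :
    densG U (fun x t => -η x t) ξ x t = (starRingEnd ℂ) (densG U η ξ x t) := by
  simp only [densG, dU, dX_neg, dT_neg, map_sub, map_mul, conj_I, conj_ofReal]
  push_cast; ring

lemma densF_neg (U : ℝ) (η ξ : ℝ → ℝ → ℝ) (x t : ℝ) :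
    densF U (fun x t => -η x t) ξ x t = (starRingEnd ℂ) (densF U η ξ x t) := by
  rw [densF, densF, densG_neg, map_mul, map_inv₀]
  congr 2
  simp only [tanC, dX_neg, map_add, map_mul, map_one, conj_I, conj_ofReal]
  push_cast; ring

end Neg

namespace LayerData
variable {a b α β : ℝ → ℝ → ℝ} {U : ℝ} (h : LayerData a b α β U)
include h

lemma orderedC1 : OrderedC1 a b where
  lower := h.lower.choose_spec.contDiffOn_one
  upper := h.upper.choose_spec.contDiffOn_one
  lt := h.lt

lemma strip {t : ℝ} (ht : 0 < t) : Strip (fun x => a x t) (fun x => b x t)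
    (fun x => densG U a α x t) (fun x => densG U b β x t) where
  lower := h.lower.choose_spec.movingGraph.graph ht
  upper := h.upper.choose_spec.movingGraph.graph ht
  lt x := h.lt x t ht
  continuous_lower := (jointCont_densG h.lower.choose_spec h.traceLower).continuous ht
  continuous_upper := (jointCont_densG h.upper.choose_spec h.traceUpper).continuous ht
  bdd_lower := (locBdd_densG h.lower.choose_spec h.traceLower).at ht
  bdd_upper := (locBdd_densG h.upper.choose_spec h.traceUpper).at ht
  integrable_lower := integrable_densG h.lower.choose_spec h.traceLower ht
  integrable_upper := integrable_densG h.upper.choose_spec h.traceUpper ht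
  moment := h.moment t ht

lemma reflect : LayerData (fun x t => -b x t) (fun x t => -a x t) β α U where
  lower := ⟨_, h.upper.choose_spec.neg⟩
  upper := ⟨_, h.lower.choose_spec.neg⟩
  lt x t ht := neg_lt_neg (h.lt x t ht)
  traceLower := h.traceUpper
  traceUpper := h.traceLower
  moment t ht k := by
    simpa only [densG_neg] using (h.strip ht).reflect.moment k

end LayerData

/-- The complex potential of a layer. -/
def cpot (a b α β : ℝ → ℝ → ℝ) (U : ℝ) : ℝ × ℝ × ℝ → ℂ :=
  movingFn a b (densP U a α) (densP U b β)

/-- The complex velocity `∂_x φ - i ∂_y φ` of a layer. -/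
def cvel (a b α β : ℝ → ℝ → ℝ) (U : ℝ) : ℝ × ℝ × ℝ → ℂ :=
  movingFn a b (densF U a α) (densF U b β)

/-- The time derivative of the complex potential of a layer. -/
def cpotT (a b α β : ℝ → ℝ → ℝ) (U : ℝ) : ℝ × ℝ × ℝ → ℂ :=
  movingFn a b (densM U a α) (densM U b β)

/-- The velocity potential of a layer. -/
def potential (a b α β : ℝ → ℝ → ℝ) (U : ℝ) (p : ℝ × ℝ × ℝ) : ℝ := (cpot a b α β U p).re

/-- The differential `Re f dx - Im f dy + Re P dt` of the velocity potential. -/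
def gradL (a b α β : ℝ → ℝ → ℝ) (U : ℝ) (p : ℝ × ℝ × ℝ) : ℝ × ℝ × ℝ →L[ℝ] ℝ :=
  (cvel a b α β U p).re • ContinuousLinearMap.fst ℝ ℝ (ℝ × ℝ)
    - (cvel a b α β U p).im • (ContinuousLinearMap.fst ℝ ℝ ℝ).comp (ContinuousLinearMap.snd ℝ ℝ (ℝ × ℝ))
    + (cpotT a b α β U p).re •
      (ContinuousLinearMap.snd ℝ ℝ ℝ).comp (ContinuousLinearMap.snd ℝ ℝ (ℝ × ℝ))

lemma hasDerivAt_tau_plate {l U : ℝ} {η ξ : ℝ → ℝ → ℝ} (h : PlateClass l η) (hξ : TraceClass ξ)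
    {t : ℝ} (ht : 0 < t) {z w : ℂ} (hz : ∀ x, pt (fun x => η x t) x ≠ z)
    (hw : ∀ x, pt (fun x => η x t) x ≠ w) :
    HasDerivAt (fun s => tau (fun x => η x s) (fun x => densP U η ξ x s) z w)
      (tau (fun x => η x t) (fun x => densM U η ξ x t) z w) t := by
  obtain ⟨B₁, h1⟩ := (density_densP (U := U) h hξ).locBdd t ht
  obtain ⟨B₂, h2⟩ := (locBdd_densPt (U := U) h hξ) t ht
  obtain ⟨B₃, h3⟩ := h.movingGraph.locBdd_dX t ht
  obtain ⟨B₄, h4⟩ := (h.jc_dT.locBdd h.dec_dT) t ht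
  obtain ⟨B₅, h5⟩ := (h.jc_dTX.locBdd h.dec_dTX) t ht
  have hpos : ∀ᶠ s in 𝓝 t, 0 < s := Ioi_mem_nhds ht
  refine hasDerivAt_tau_time (ηt := dT η) (ηxt := dT (dX η)) (G := densP U η ξ) (Gt := densPt U η ξ)
    (g := fun x => densG U η ξ x t) (B := max B₁ (max B₂ (max B₃ (max B₄ B₅))))
    (hpos.mono fun s hs => h.movingGraph.graph hs)
    (fun x => h.jc.tendsto (x₀ := x) ht continuous_snd.continuousAt continuous_fst.continuousAt)
    (hpos.mono fun s hs x => hasDerivAt_dT h.contDiffOn_one hs x)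
    (hpos.mono fun s hs x => hasDerivAt_dT h.contDiffOn_dX hs x)
    (hpos.mono fun s hs x => hasDerivAt_densP_t h hξ hs x) ?_
    (hpos.mono fun s hs => (density_densP h hξ).jointCont.continuous hs)
    ((jointCont_densPt h hξ).continuous ht) (h.jc_dTX.continuous ht) (bddPrimitive_densP h hξ ht)
    (fun x => ?_) (h.dTX_class.2.integrable h.jc_dTX ht) (fun x => ?_) hz hw
  · filter_upwards [h1, h2, h3, h4, h5] with s c1 c2 c3 c4 c5 x
    have d3 : |deriv (fun x => η x s) x| ≤ B₃ := c3 x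
    have d4 : |dT η x s| ≤ B₄ := c4 x
    have d5 : |dT (dX η) x s| ≤ B₅ := c5 x
    exact ⟨by simp [c1 x], by simp [c2 x], by simp [d3], by simp [d4], by simp [d5]⟩
  · have := hasDerivAt_dX h.contDiffOn_dT ht x
    rwa [dX_dT_comm h.contDiffOn ht] at this
  · have := densF_mul_tanC U η ξ x t
    have e : 1 + I * ((deriv (fun x => η x t) x : ℝ) : ℂ) = tanC η x t := rfl
    rw [e, densM, ← this]
    ring

namespace LayerData
variable {a b α β : ℝ → ℝ → ℝ} {U : ℝ} (h : LayerData a b α β U)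
include h

lemma continuousAt_cpot {p : ℝ × ℝ × ℝ} (hp : p ∈ posTime) : ContinuousAt (cpot a b α β U) p :=
  continuousAt_movingFn h.lower.choose_spec.movingGraph h.upper.choose_spec.movingGraph
    (density_densP h.lower.choose_spec h.traceLower)
    (density_densP h.upper.choose_spec h.traceUpper) hp

lemma continuousAt_cvel {p : ℝ × ℝ × ℝ} (hp : p ∈ posTime) : ContinuousAt (cvel a b α β U) p :=
  continuousAt_movingFn h.lower.choose_spec.movingGraph h.upper.choose_spec.movingGraph
    (density_densF h.lower.choose_spec h.traceLower)
    (density_densF h.upper.choose_spec h.traceUpper) hp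

lemma continuousAt_cpotT {p : ℝ × ℝ × ℝ} (hp : p ∈ posTime) : ContinuousAt (cpotT a b α β U) p :=
  continuousAt_movingFn h.lower.choose_spec.movingGraph h.upper.choose_spec.movingGraph
    (density_densM h.lower.choose_spec h.traceLower)
    (density_densM h.upper.choose_spec h.traceUpper) hp

lemma cvel_eq_cau {x y t : ℝ} (hp : (x, y, t) ∈ openRegion a b) :
    cvel a b α β U (x, y, t) = (2 * Real.pi * I)⁻¹ *
      (cau (fun x => a x t) (fun x => densG U a α x t) (x + I * y)
        - cau (fun x => b x t) (fun x => densG U b β x t) (x + I * y)) := by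
  have ht : 0 < t := hp.1
  have d1 := density_densF (U := U) h.lower.choose_spec h.traceLower
  have d2 := density_densF (U := U) h.upper.choose_spec h.traceUpper
  have := (h.strip ht).stripFn_eq_cau (z := x + I * y) (d1.jointCont.continuous ht)
    (d1.locBdd.at ht) (d2.jointCont.continuous ht) (d2.locBdd.at ht)
    (fun x => densF_mul_tanC U a α x t) (fun x => densF_mul_tanC U b β x t)
    (by simpa using hp.2.1) (by simpa using hp.2.2)
  simpa [cvel, movingFn] using this

/-- Inside the layer the complex velocity is the `z`-derivative of the complex potential. -/
lemma hasDerivAt_cpot {z : ℂ} {t : ℝ} (hp : (z.re, z.im, t) ∈ openRegion a b) :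
    HasDerivAt (fun z : ℂ => cpot a b α β U (z.re, z.im, t)) (cvel a b α β U (z.re, z.im, t)) z := by
  have ht : 0 < t := hp.1
  have e := h.cvel_eq_cau hp
  rw [show (z.re : ℂ) + I * z.im = z by apply Complex.ext <;> simp] at e
  rw [e]
  exact (h.strip ht).hasDerivAt_stripFn (bddPrimitive_densP h.lower.choose_spec h.traceLower ht)
    (bddPrimitive_densP h.upper.choose_spec h.traceUpper ht) hp.2.1 hp.2.2

/-- Inside the layer the complex potential is differentiable in time. -/
lemma hasDerivAt_cpot_t {z : ℂ} {t : ℝ} (hp : (z.re, z.im, t) ∈ openRegion a b) :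
    HasDerivAt (fun s : ℝ => cpot a b α β U (z.re, z.im, s)) (cpotT a b α β U (z.re, z.im, t)) t := by
  have ht : 0 < t := hp.1
  obtain ⟨la, ha⟩ := h.lower
  obtain ⟨lb, hb⟩ := h.upper
  have h1 : a z.re t < z.im := hp.2.1
  have h2 : z.im < b z.re t := hp.2.2
  -- The normalization point is frozen at its position at time `t`.
  set w := mirror (fun x => a x t) z with hw
  have hwb : w.im < a w.re t := mirror_below (a := fun x => a x t) h1
  have dMa := density_densM (U := U) ha h.traceLower
  have dMb := density_densM (U := U) hb h.traceUpper
  have e : cpotT a b α β U (z.re, z.im, t) = cauchyT (fun x => a x t) (fun x => b x t)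
      (fun x => densM U a α x t) (fun x => densM U b β x t) z w :=
    (cauchyT_mirror_eq_stripFn (ha.movingGraph.graph ht) (hb.movingGraph.graph ht)
      (dMa.jointCont.continuous ht) (dMa.locBdd.at ht) (dMb.jointCont.continuous ht)
      (dMb.locBdd.at ht) h1 h2).symm
  rw [e]
  have hd := ((hasDerivAt_tau_plate (U := U) ha h.traceLower ht (z := z) (w := w)
      (pt_ne_of_ne h1.ne) (pt_ne_of_ne hwb.ne')).sub
    (hasDerivAt_tau_plate (U := U) hb h.traceUpper ht (z := z) (w := w) (pt_ne_of_ne h2.ne')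
      (below_pt_ne_upper (fun x => h.lt x t ht) hwb))).const_mul (2 * Real.pi * I : ℂ)⁻¹
  refine hd.congr_of_eventuallyEq ?_
  have c1 : ∀ᶠ s in 𝓝 t, a z.re s < z.im :=
    (ha.jc.tendsto ht tendsto_const_nhds tendsto_id).eventually_lt_const h1
  have c2 : ∀ᶠ s in 𝓝 t, z.im < b z.re s :=
    (hb.jc.tendsto ht tendsto_const_nhds tendsto_id).eventually_const_lt h2
  have c3 : ∀ᶠ s in 𝓝 t, w.im < a w.re s :=
    (ha.jc.tendsto ht tendsto_const_nhds tendsto_id).eventually_const_lt hwb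
  filter_upwards [c1, c2, c3, Ioi_mem_nhds ht] with s h3 h4 h5 hs
  exact (h.strip hs).stripFn_eq_cauchyT (bddPrimitive_densP ha h.traceLower hs)
    (bddPrimitive_densP hb h.traceUpper hs) h3 h4 h5

/-- The potential is differentiable inside the layer: its partial derivatives in `z` and in `t` exist
and are continuous. -/
lemma hasFDerivAt_potential {p : ℝ × ℝ × ℝ} (hp : p ∈ openRegion a b) :
    HasFDerivAt (potential a b α β U) (gradL a b α β U p) p := by
  set m : ℝ × ℝ × ℝ →L[ℝ] ℂ × ℝ :=
    (Complex.equivRealProdCLM.symm.toContinuousLinearMap.comp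
      ((ContinuousLinearMap.fst ℝ ℝ (ℝ × ℝ)).prod
        ((ContinuousLinearMap.fst ℝ ℝ ℝ).comp (ContinuousLinearMap.snd ℝ ℝ (ℝ × ℝ))))).prod
      ((ContinuousLinearMap.snd ℝ ℝ ℝ).comp (ContinuousLinearMap.snd ℝ ℝ (ℝ × ℝ))) with hm
  set j : ℂ × ℝ → ℝ × ℝ × ℝ := fun q => (q.1.re, q.1.im, q.2) with hj
  have hjm : ∀ q, j (m q) = q := fun q => by simp [hj, hm]
  have hjc : Continuous j := by fun_prop
  have hju : j (m p) ∈ openRegion a b := by rwa [hjm]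
  have hev : ∀ᶠ v in 𝓝 (m p), j v ∈ openRegion a b :=
    hjc.continuousAt.eventually (h.orderedC1.isOpen_openRegion.mem_nhds hju)
  have hpos : j (m p) ∈ posTime := hju.1
  set f₁ : ℂ → ℝ → ℂ →L[ℝ] ℝ := fun z t => Complex.reCLM.comp
    ((ContinuousLinearMap.toSpanSingleton ℂ (cvel a b α β U (z.re, z.im, t))).restrictScalars ℝ)
    with hf₁
  set f₂ : ℂ → ℝ → ℝ →L[ℝ] ℝ := fun z t =>
    ContinuousLinearMap.toSpanSingleton ℝ (cpotT a b α β U (z.re, z.im, t)).re with hf₂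
  have key := hasStrictFDerivAt_uncurry_coprod (𝕜 := ℝ) (u := m p)
    (f := fun z t => potential a b α β U (z.re, z.im, t)) (f₁ := f₁) (f₂ := f₂) ?_ ?_ ?_ ?_
  · have h1 := key.hasFDerivAt.comp p m.hasFDerivAt
    have h2 : (↿(fun (z : ℂ) (t : ℝ) => potential a b α β U (z.re, z.im, t))) ∘ m
        = potential a b α β U := by
      ext q
      exact congrArg (potential a b α β U) (hjm q)
    rw [h2] at h1
    refine h1.congr_fderiv ?_
    have e : ∀ F : ℝ × ℝ × ℝ → ℂ, F ((m p).1.re, (m p).1.im, (m p).2) = F p :=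
      fun F => congrArg F (hjm p)
    ext <;> simp [hf₁, hf₂, Function.HasUncurry.uncurry, gradL, hm]
  · filter_upwards [hev] with v hv
    have h1 := (h.hasDerivAt_cpot hv).hasFDerivAt.restrictScalars ℝ
    exact Complex.reCLM.hasFDerivAt.comp v.1 h1
  · filter_upwards [hev] with v hv
    have h1 := h.hasDerivAt_cpot_t hv
    have h2 := Complex.reCLM.hasFDerivAt.comp_hasDerivAt v.2 h1
    exact h2.hasFDerivAt
  · have h1 : ContinuousAt (fun v : ℂ × ℝ => cvel a b α β U (j v)) (m p) :=
      ContinuousAt.comp (h.continuousAt_cvel hpos) hjc.continuousAt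
    have h2 : Continuous fun c : ℂ => Complex.reCLM.comp
        ((ContinuousLinearMap.toSpanSingleton ℂ c).restrictScalars ℝ) := by
      have e : (fun c : ℂ => Complex.reCLM.comp
          ((ContinuousLinearMap.toSpanSingleton ℂ c).restrictScalars ℝ))
          = fun c : ℂ => c.re • Complex.reCLM - c.im • Complex.imCLM := by
        ext c v; simp [mul_comm]
      rw [e]
      fun_prop
    exact h2.continuousAt.comp h1
  · have h1 : ContinuousAt (fun v : ℂ × ℝ => cpotT a b α β U (j v)) (m p) :=
      ContinuousAt.comp (h.continuousAt_cpotT hpos) hjc.continuousAt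
    have h2 : Continuous fun c : ℂ => ContinuousLinearMap.toSpanSingleton ℝ c.re := by
      have e : (fun c : ℂ => ContinuousLinearMap.toSpanSingleton ℝ c.re)
          = fun c : ℂ => c.re • ContinuousLinearMap.id ℝ ℝ := by
        ext c; simp
      rw [e]
      fun_prop
    exact h2.continuousAt.comp h1

end LayerData

/-! ### Solutions in a single layer -/

/-- The flow of mean velocity `U` in one layer: a potential of class `C¹` up to the boundary,
harmonic inside, decaying with its derivatives, whose surfaces move with the fluid. -/
structure LayerFlow (a b : ℝ → ℝ → ℝ) (U : ℝ) (φ : ℝ × ℝ × ℝ → ℝ) : Prop where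
  contDiffOn : ContDiffOn ℝ 1 φ (region a b)
  vanishes : VanishesOn (region a b) φ
  pX_vanishes : VanishesOn (region a b) (pX (region a b) φ)
  pY_vanishes : VanishesOn (region a b) (pY (region a b) φ)
  pT_vanishes : VanishesOn (region a b) (pT (region a b) φ)
  harmonic : ∀ t > 0, InnerProductSpace.HarmonicOnNhd (fun z : ℂ => φ (z.re, z.im, t))
    {z | a z.re t < z.im ∧ z.im < b z.re t}
  normal_lower : ∀ x, ∀ t > 0, (U + pX (region a b) φ (x, a x t, t)) * (-dX a x t)
    + pY (region a b) φ (x, a x t, t) * 1 = dT a x t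
  normal_upper : ∀ x, ∀ t > 0, (U + pX (region a b) φ (x, b x t, t)) * (-dX b x t)
    + pY (region a b) φ (x, b x t, t) * 1 = dT b x t

section Trace
variable {D : Set (ℝ × ℝ × ℝ)} {φ : ℝ × ℝ × ℝ → ℝ} {f : ℝ → ℝ → ℝ} {x t f' : ℝ}

lemma hasDerivAt_trace_x (hφ : DifferentiableWithinAt ℝ φ D (x, f x t, t))
    (hf : HasDerivAt (fun x => f x t) f' x) (hm : ∀ x, (x, f x t, t) ∈ D) :
    HasDerivAt (fun x => φ (x, f x t, t))
      (pX D φ (x, f x t, t) + pY D φ (x, f x t, t) * f') x := by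
  have h1 : HasDerivAt (fun x => (x, f x t, t)) ((1 : ℝ), f', (0 : ℝ)) x :=
    (hasDerivAt_id x).prodMk (hf.prodMk (hasDerivAt_const x t))
  have h2 := hφ.hasFDerivWithinAt.comp_hasDerivAt x h1 (.of_forall hm)
  refine h2.congr_deriv ?_
  rw [show ((1 : ℝ), f', (0 : ℝ)) = (1, 0, 0) + f' • ((0 : ℝ), (1 : ℝ), (0 : ℝ)) by simp, map_add,
    map_smul, pX, pY, smul_eq_mul, mul_comm f']

lemma hasDerivAt_trace_t (hφ : DifferentiableWithinAt ℝ φ D (x, f x t, t))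
    (hf : HasDerivAt (fun s => f x s) f' t) (hm : ∀ᶠ s in 𝓝 t, (x, f x s, s) ∈ D) :
    HasDerivAt (fun s => φ (x, f x s, s))
      (pT D φ (x, f x t, t) + pY D φ (x, f x t, t) * f') t := by
  have h1 : HasDerivAt (fun s => (x, f x s, s)) ((0 : ℝ), f', (1 : ℝ)) t :=
    (hasDerivAt_const t x).prodMk (hf.prodMk (hasDerivAt_id t))
  have h2 := hφ.hasFDerivWithinAt.comp_hasDerivAt t h1 hm
  refine h2.congr_deriv ?_
  rw [show ((0 : ℝ), f', (1 : ℝ)) = (0, 0, 1) + f' • ((0 : ℝ), (1 : ℝ), (0 : ℝ)) by simp, map_add,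
    map_smul, pT, pY, smul_eq_mul, mul_comm f']

end Trace

section Region
variable {a b : ℝ → ℝ → ℝ} (h : OrderedC1 a b)
include h

lemma OrderedC1.lower_mem_region {t : ℝ} (ht : 0 < t) (x : ℝ) : (x, a x t, t) ∈ region a b :=
  ⟨ht, le_rfl, (h.lt x t ht).le⟩

lemma OrderedC1.upper_mem_region {t : ℝ} (ht : 0 < t) (x : ℝ) : (x, b x t, t) ∈ region a b :=
  ⟨ht, (h.lt x t ht).le, le_rfl⟩

end Region

lemma densF_eq (U : ℝ) (η ξ : ℝ → ℝ → ℝ) (x t : ℝ) :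
    densF U η ξ x t = surfX U η ξ x t - I * surfY U η ξ x t := by
  have h1 := tanC_ne_zero η x t
  have h2 : (1 + (dX η x t : ℂ) ^ 2) ≠ 0 := by
    have : (0 : ℝ) < 1 + dX η x t ^ 2 := by positivity
    exact_mod_cast this.ne'
  rw [densF, mul_inv_eq_iff_eq_mul₀ h1, densG, tanC, surfX, surfY]
  push_cast
  field_simp
  linear_combination (dX η x t * dU U η x t + (dX η x t)^2 * dX ξ x t : ℂ) * I_sq

lemma surf_normal (U : ℝ) (η ξ : ℝ → ℝ → ℝ) (x t : ℝ) :
    (U + surfX U η ξ x t) * (-dX η x t) + surfY U η ξ x t * 1 = dT η x t := by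
  have : (0 : ℝ) < 1 + dX η x t ^ 2 := by positivity
  rw [surfX, surfY, dU]
  field_simp
  ring

namespace LayerData
variable {a b α β : ℝ → ℝ → ℝ} {U : ℝ} (h : LayerData a b α β U)
include h

lemma continuousOn_potential : ContinuousOn (potential a b α β U) (region a b) := fun _ hp =>
  (Complex.continuous_re.continuousAt.comp (h.continuousAt_cpot hp.1)).continuousWithinAt

lemma continuousOn_gradL : ContinuousOn (gradL a b α β U) (region a b) := by
  have h1 : ContinuousOn (cvel a b α β U) (region a b) := fun _ hp =>
    (h.continuousAt_cvel hp.1).continuousWithinAt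
  have h2 : ContinuousOn (cpotT a b α β U) (region a b) := fun _ hp =>
    (h.continuousAt_cpotT hp.1).continuousWithinAt
  have h3 := Complex.continuous_re.comp_continuousOn h1
  have h4 := Complex.continuous_im.comp_continuousOn h1
  have h5 := Complex.continuous_re.comp_continuousOn h2
  exact ((h3.smul continuousOn_const).sub (h4.smul continuousOn_const)).add
    (h5.smul continuousOn_const)

lemma hasFDerivWithinAt_potential {p : ℝ × ℝ × ℝ} (hp : p ∈ region a b) :
    HasFDerivWithinAt (potential a b α β U) (gradL a b α β U p) (region a b) p :=
  h.orderedC1.hasFDerivWithinAt_region h.continuousOn_potential h.continuousOn_gradL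
    (fun _ hp => h.hasFDerivAt_potential hp) hp

lemma fderivWithin_potential {p : ℝ × ℝ × ℝ} (hp : p ∈ region a b) :
    fderivWithin ℝ (potential a b α β U) (region a b) p = gradL a b α β U p :=
  (h.hasFDerivWithinAt_potential hp).fderivWithin (h.orderedC1.uniqueDiffOn_region p hp)

lemma pX_potential {p : ℝ × ℝ × ℝ} (hp : p ∈ region a b) :
    pX (region a b) (potential a b α β U) p = (cvel a b α β U p).re := by
  simp [pX, h.fderivWithin_potential hp, gradL]

lemma pY_potential {p : ℝ × ℝ × ℝ} (hp : p ∈ region a b) :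
    pY (region a b) (potential a b α β U) p = -(cvel a b α β U p).im := by
  simp [pY, h.fderivWithin_potential hp, gradL]

lemma pT_potential {p : ℝ × ℝ × ℝ} (hp : p ∈ region a b) :
    pT (region a b) (potential a b α β U) p = (cpotT a b α β U p).re := by
  simp [pT, h.fderivWithin_potential hp, gradL]

omit h in
lemma cvel_lower (x t : ℝ) : cvel a b α β U (x, a x t, t) = densF U a α x t :=
  movingFn_lower a b _ _ x t

/-- Reflection in the real axis conjugates the complex velocity. -/
lemma cvel_reflect {x y t : ℝ} (hp : (x, y, t) ∈ openRegion a b) :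
    cvel (fun x t => -b x t) (fun x t => -a x t) β α U (x, -y, t)
      = (starRingEnd ℂ) (cvel a b α β U (x, y, t)) := by
  have hp' : (x, -y, t) ∈ openRegion (fun x t => -b x t) (fun x t => -a x t) :=
    ⟨hp.1, neg_lt_neg hp.2.2, neg_lt_neg hp.2.1⟩
  rw [h.reflect.cvel_eq_cau hp', h.cvel_eq_cau hp]
  have e : (x : ℂ) + I * ((-y : ℝ) : ℂ) = (starRingEnd ℂ) (x + I * y) := by simp
  rw [e, map_mul, map_sub, ← cau_neg, ← cau_neg]
  simp only [densG_neg, map_inv₀, map_mul, conj_I, conj_ofReal, map_ofNat, mul_neg, inv_neg]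
  ring

/-- The complex velocity on the upper surface; in the formula defining it the two surfaces do not
play symmetric roles, so this comes from the reflected layer. -/
lemma cvel_upper {x t : ℝ} (ht : 0 < t) : cvel a b α β U (x, b x t, t) = densF U b β x t := by
  have h0 : ((x, b x t, t) : ℝ × ℝ × ℝ) ∈ posTime := ht
  have h0' : ((x, -b x t, t) : ℝ × ℝ × ℝ) ∈ posTime := ht
  have c1 : Tendsto (fun y : ℝ => cvel a b α β U (x, y, t)) (𝓝[<] (b x t))
      (𝓝 (cvel a b α β U (x, b x t, t))) :=
    Tendsto.comp (h.continuousAt_cvel h0)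
      ((by fun_prop : Continuous fun y : ℝ => (x, y, t)).continuousAt.tendsto.mono_left
        nhdsWithin_le_nhds)
  have c2 : Tendsto (fun y : ℝ => cvel (fun x t => -b x t) (fun x t => -a x t) β α U (x, -y, t))
      (𝓝[<] (b x t)) (𝓝 (cvel (fun x t => -b x t) (fun x t => -a x t) β α U (x, -b x t, t))) :=
    Tendsto.comp (h.reflect.continuousAt_cvel h0')
      ((by fun_prop : Continuous fun y : ℝ => (x, -y, t)).continuousAt.tendsto.mono_left
        nhdsWithin_le_nhds)
  have c3 := (continuous_conj.tendsto _).comp c2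
  have e1 : (starRingEnd ℂ) (cvel (fun x t => -b x t) (fun x t => -a x t) β α U (x, -b x t, t))
      = densF U b β x t := by
    rw [show (x, -b x t, t) = (x, (fun x t => -b x t) x t, t) from rfl, LayerData.cvel_lower,
      densF_neg, conj_conj]
  rw [e1] at c3
  refine tendsto_nhds_unique c1 (c3.congr' ?_)
  filter_upwards [Ioo_mem_nhdsLT (h.lt x t ht)] with y hy
  rw [Function.comp_apply, h.cvel_reflect ⟨ht, hy.1, hy.2⟩, conj_conj]

omit h in
lemma potential_lower (x t : ℝ) : potential a b α β U (x, a x t, t) = α x t := by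
  rw [potential, cpot, movingFn_lower, densP]
  simp

lemma tendsto_potential {t : ℝ} (ht : 0 < t) :
    Tendsto (potential a b α β U) (farFilter (region a b) t) (𝓝 0) := by
  refine tendsto_re_movingFn h.lower.choose_spec.movingGraph h.upper.choose_spec.movingGraph
    (density_densP h.lower.choose_spec h.traceLower)
    (density_densP h.upper.choose_spec h.traceUpper) ?_ ht
  convert h.traceLower.dec using 3 with x t
  simp [densP]

lemma tendsto_cvel {t : ℝ} (ht : 0 < t) :
    Tendsto (cvel a b α β U) (farFilter (region a b) t) (𝓝 0) :=
  tendsto_movingFn h.lower.choose_spec.movingGraph h.upper.choose_spec.movingGraph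
    (density_densF h.lower.choose_spec h.traceLower)
    (density_densF h.upper.choose_spec h.traceUpper)
    (decays_densF h.lower.choose_spec h.traceLower) ht

lemma tendsto_re_cpotT {t : ℝ} (ht : 0 < t) :
    Tendsto (fun p => (cpotT a b α β U p).re) (farFilter (region a b) t) (𝓝 0) :=
  tendsto_re_movingFn h.lower.choose_spec.movingGraph h.upper.choose_spec.movingGraph
    (density_densM h.lower.choose_spec h.traceLower)
    (density_densM h.upper.choose_spec h.traceUpper)
    (decays_re_densM h.lower.choose_spec h.traceLower) ht

/-- On the upper surface the potential and `β` have the same `x`-derivative, and both decay. -/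
lemma potential_upper {x t : ℝ} (ht : 0 < t) : potential a b α β U (x, b x t, t) = β x t := by
  obtain ⟨lb, hb⟩ := h.upper
  have hmem := h.orderedC1.upper_mem_region ht
  have hd : ∀ x, HasDerivAt (fun x => potential a b α β U (x, b x t, t) - β x t) 0 x := fun x => by
    have h1 := hasDerivAt_trace_x (h.hasFDerivWithinAt_potential (hmem x)).differentiableWithinAt
      (hasDerivAt_dX hb.contDiffOn_one ht x) hmem
    refine (h1.sub (hasDerivAt_dX h.traceUpper.contDiffOn_one ht x)).congr_deriv ?_
    rw [h.pX_potential (hmem x), h.pY_potential (hmem x), h.cvel_upper ht]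
    have := congrArg Complex.re (densF_mul_tanC U b β x t)
    simp [tanC, densG] at this
    linarith
  have hc : ∀ x x' : ℝ, potential a b α β U (x, b x t, t) - β x t
      = potential a b α β U (x', b x' t, t) - β x' t :=
    is_const_of_deriv_eq_zero (fun x => (hd x).differentiableAt) fun x => (hd x).deriv
  have hfar : Tendsto (fun x' : ℝ => (x', b x' t, t)) atTop (farFilter (region a b) t) := by
    refine tendsto_inf.2 ⟨tendsto_comap_iff.2 (Tendsto.prodMk ?_ tendsto_const_nhds),
      tendsto_principal.2 (.of_forall hmem)⟩
    rw [cocompact_eq_atBot_atTop]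
    exact tendsto_id.mono_right le_sup_right
  have hβ : Tendsto (fun x' => β x' t) atTop (𝓝 0) := by
    refine (h.traceUpper.dec t ht).comp (Tendsto.prodMk (f := atTop) (m₁ := id)
      (m₂ := fun _ => t) ?_ tendsto_const_nhds)
    rw [cocompact_eq_atBot_atTop]
    exact tendsto_id.mono_right le_sup_right
  have hlim := ((h.tendsto_potential ht).comp hfar).sub hβ
  rw [sub_zero] at hlim
  have := tendsto_nhds_unique (hlim.congr fun x' => hc x' x) tendsto_const_nhds
  linarith

lemma harmonicOnNhd_potential {t : ℝ} (ht : 0 < t) : InnerProductSpace.HarmonicOnNhd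
    (fun z : ℂ => potential a b α β U (z.re, z.im, t)) {z | a z.re t < z.im ∧ z.im < b z.re t} := by
  have ho : IsOpen {z : ℂ | a z.re t < z.im ∧ z.im < b z.re t} :=
    isOpen_strip (h.strip ht).lower.continuous (h.strip ht).upper.continuous
  have hd : DifferentiableOn ℂ (fun z : ℂ => cpot a b α β U (z.re, z.im, t))
      {z | a z.re t < z.im ∧ z.im < b z.re t} := fun z hz =>
    (h.hasDerivAt_cpot (z := z) ⟨ht, hz.1, hz.2⟩).differentiableAt.differentiableWithinAt
  exact fun z hz => (hd.analyticAt (ho.mem_nhds hz)).harmonicAt_re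

/-- Equality of moments suffices for the existence of a flow with given boundary potentials. -/
theorem layerFlow_potential : LayerFlow a b U (potential a b α β U) := by
  have hpos := region_subset_posTime (a := a) (b := b)
  have hre : ∀ t > 0, Tendsto (pX (region a b) (potential a b α β U)) (farFilter (region a b) t)
      (𝓝 0) := fun t ht => by
    refine ((Complex.continuous_re.tendsto 0).comp (h.tendsto_cvel ht)).congr' ?_
    filter_upwards [mem_inf_of_right (mem_principal_self _)] with p hp
    exact (h.pX_potential hp).symm
  have him : ∀ t > 0, Tendsto (pY (region a b) (potential a b α β U)) (farFilter (region a b) t)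
      (𝓝 0) := fun t ht => by
    have h1 := ((Complex.continuous_im.tendsto 0).comp (h.tendsto_cvel ht)).neg
    rw [zero_im, neg_zero] at h1
    refine h1.congr' ?_
    filter_upwards [mem_inf_of_right (mem_principal_self _)] with p hp
    exact (h.pY_potential hp).symm
  have hti : ∀ t > 0, Tendsto (pT (region a b) (potential a b α β U)) (farFilter (region a b) t)
      (𝓝 0) := fun t ht => by
    refine (h.tendsto_re_cpotT ht).congr' ?_
    filter_upwards [mem_inf_of_right (mem_principal_self _)] with p hp
    exact (h.pT_potential hp).symm
  have normal : ∀ η ξ : ℝ → ℝ → ℝ, ∀ x t : ℝ, (x, η x t, t) ∈ region a b →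
      cvel a b α β U (x, η x t, t) = densF U η ξ x t →
      (U + pX (region a b) (potential a b α β U) (x, η x t, t)) * (-dX η x t)
        + pY (region a b) (potential a b α β U) (x, η x t, t) * 1 = dT η x t := by
    intro η ξ x t hp e
    rw [h.pX_potential hp, h.pY_potential hp, e, densF_eq, ← surf_normal U η ξ x t]
    simp
  exact
  { contDiffOn := h.orderedC1.contDiffOn_one_region h.continuousOn_gradL
      fun p hp => h.hasFDerivWithinAt_potential hp
    vanishes := vanishesOn_of_tendsto hpos fun t ht => h.tendsto_potential ht
    pX_vanishes := vanishesOn_of_tendsto hpos hre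
    pY_vanishes := vanishesOn_of_tendsto hpos him
    pT_vanishes := vanishesOn_of_tendsto hpos hti
    harmonic := fun t ht => h.harmonicOnNhd_potential ht
    normal_lower := fun x t ht => normal a α x t (h.orderedC1.lower_mem_region ht x)
      (cvel_lower x t)
    normal_upper := fun x t ht => normal b β x t (h.orderedC1.upper_mem_region ht x)
      (h.cvel_upper ht) }

end LayerData

/-! ### Cauchy's theorem in a curved strip -/

section CurvedStrip
variable {a b : ℝ → ℝ}

/-- The closed strip between two graphs. -/
def closedStrip (a b : ℝ → ℝ) : Set ℂ := {z | a z.re ≤ z.im ∧ z.im ≤ b z.re}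

/-- The point at height fraction `s` on the vertical segment over `x`. -/
def stripPt (a b : ℝ → ℝ) (p : ℝ × ℝ) : ℂ := p.1 + I * (a p.1 + p.2 * (b p.1 - a p.1) : ℝ)

@[simp] lemma stripPt_re (a b : ℝ → ℝ) (p : ℝ × ℝ) : (stripPt a b p).re = p.1 := by simp [stripPt]
@[simp] lemma stripPt_im (a b : ℝ → ℝ) (p : ℝ × ℝ) :
    (stripPt a b p).im = a p.1 + p.2 * (b p.1 - a p.1) := by simp [stripPt]

lemma stripPt_mem_closedStrip (hlt : ∀ x, a x < b x) {p : ℝ × ℝ} (hp : p.2 ∈ Icc (0 : ℝ) 1) :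
    stripPt a b p ∈ closedStrip a b := by
  have := hlt p.1
  constructor
  · rw [stripPt_re, stripPt_im]; nlinarith [hp.1]
  · rw [stripPt_re, stripPt_im]; nlinarith [hp.2]

variable (ha : ContDiff ℝ 2 a) (hb : ContDiff ℝ 2 b)
include ha hb

lemma continuous_stripPt : Continuous (stripPt a b) := by
  have h1 := ha.continuous
  have h2 := hb.continuous
  unfold stripPt
  fun_prop

omit ha hb in
lemma hasFDerivAt_comp_fst {f : ℝ → ℝ} (hf : ContDiff ℝ 1 f) (p : ℝ × ℝ) :
    HasFDerivAt (fun p : ℝ × ℝ => f p.1) (deriv f p.1 • ContinuousLinearMap.fst ℝ ℝ ℝ) p :=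
  ((hf.differentiable one_ne_zero p.1).hasDerivAt).comp_hasFDerivAt p hasFDerivAt_fst

/-- Cauchy's theorem for the part `|x| ≤ R` of the strip, from the divergence theorem in the
coordinates of `stripPt`. -/
lemma integral_upper_sub_integral_lower (hlt : ∀ x, a x < b x) {h : ℂ → ℂ}
    (hd : ∀ z : ℂ, a z.re < z.im → z.im < b z.re → DifferentiableAt ℂ h z)
    (hc : ContinuousOn h (closedStrip a b)) (R : ℝ) :
    (∫ x in -R..R, h (pt b x) * (1 + I * (deriv b x : ℝ)))
      - ∫ x in -R..R, h (pt a x) * (1 + I * (deriv a x : ℝ))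
      = (∫ s in (0 : ℝ)..1, h (stripPt a b (R, s)) * (I * (b R - a R : ℝ)))
        - ∫ s in (0 : ℝ)..1, h (stripPt a b (-R, s)) * (I * (b (-R) - a (-R) : ℝ)) := by
  have ha1 : ContDiff ℝ 1 a := ha.of_le (by norm_num)
  have hb1 : ContDiff ℝ 1 b := hb.of_le (by norm_num)
  have hda : ContDiff ℝ 1 (deriv a) := ContDiff.deriv' (n := 1) (by
    rw [one_add_one_eq_two]; exact ha)
  have hdb : ContDiff ℝ 1 (deriv b) := ContDiff.deriv' (n := 1) (by
    rw [one_add_one_eq_two]; exact hb)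
  -- With `h = h(γ)` the form `h dγ = h γ_x dx + h γ_s ds` is closed, as `γ_x = B`, `γ_s = A`.
  set γ := stripPt a b with hγ
  set A : ℝ × ℝ → ℂ := fun p => I * (b p.1 - a p.1 : ℝ) with hA
  set B : ℝ × ℝ → ℂ := fun p => 1 + I * (deriv a p.1 + p.2 * (deriv b p.1 - deriv a p.1) : ℝ) with hB
  set dx := ContinuousLinearMap.fst ℝ ℝ ℝ
  set ds := ContinuousLinearMap.snd ℝ ℝ ℝ
  set γ' : ℝ × ℝ → ℝ × ℝ →L[ℝ] ℂ := fun p => dx.smulRight (B p) + ds.smulRight (A p) with hγ'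
  set A' : ℝ × ℝ → ℝ × ℝ →L[ℝ] ℂ := fun p =>
    dx.smulRight (I * (deriv b p.1 - deriv a p.1 : ℝ)) with hA'
  set B' : ℝ × ℝ → ℝ × ℝ →L[ℝ] ℂ := fun p =>
    dx.smulRight (I * (deriv (deriv a) p.1 + p.2 * (deriv (deriv b) p.1 - deriv (deriv a) p.1) : ℝ))
      + ds.smulRight (I * (deriv b p.1 - deriv a p.1 : ℝ)) with hB'
  have cast : ∀ {F : ℝ × ℝ → ℝ} {F' : ℝ × ℝ →L[ℝ] ℝ} {p : ℝ × ℝ}, HasFDerivAt F F' p →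
      HasFDerivAt (fun p => I * (F p : ℂ)) (I • Complex.ofRealCLM.comp F') p := fun {F F' p} hF =>
    (Complex.ofRealCLM.hasFDerivAt.comp p hF).const_mul I
  have dA : ∀ p, HasFDerivAt A (A' p) p := fun p => by
    refine (cast ((hasFDerivAt_comp_fst hb1 p).sub (hasFDerivAt_comp_fst ha1 p))).congr_fderiv ?_
    ext <;> simp [hA', dx]
  have dI : ∀ {f g : ℝ → ℝ}, ContDiff ℝ 1 f → ContDiff ℝ 1 g → ∀ p : ℝ × ℝ,
      HasFDerivAt (fun p : ℝ × ℝ => I * ((f p.1 + p.2 * (g p.1 - f p.1) : ℝ) : ℂ))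
        (dx.smulRight (I * (deriv f p.1 + p.2 * (deriv g p.1 - deriv f p.1) : ℝ))
          + ds.smulRight (I * (g p.1 - f p.1 : ℝ))) p := fun {f g} hf hg p => by
    refine (cast ((hasFDerivAt_comp_fst hf p).add (hasFDerivAt_snd.mul
      ((hasFDerivAt_comp_fst hg p).sub (hasFDerivAt_comp_fst hf p))))).congr_fderiv ?_
    ext <;> simp [dx, ds, mul_add]
  have dB : ∀ p, HasFDerivAt B (B' p) p := fun p => (dI hda hdb p).const_add 1
  have dγ : ∀ p, HasFDerivAt γ (γ' p) p := fun p => by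
    refine ((Complex.ofRealCLM.hasFDerivAt.comp p hasFDerivAt_fst).add
      (dI ha1 hb1 p)).congr_fderiv ?_
    ext <;> simp [dx, ds, hγ', hA, hB]
  have hmaps : ∀ p ∈ (uIcc (-R) R) ×ˢ (uIcc (0 : ℝ) 1), γ p ∈ closedStrip a b := fun p hp =>
    stripPt_mem_closedStrip hlt (by simpa [uIcc_of_le] using hp.2)
  have hhγ : ContinuousOn (fun p => h (γ p)) ((uIcc (-R) R) ×ˢ (uIcc (0 : ℝ) 1)) :=
    hc.comp (continuous_stripPt ha hb).continuousOn hmaps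
  have hcA : Continuous A := continuous_iff_continuousAt.2 fun p => (dA p).continuousAt
  have hcB : Continuous B := continuous_iff_continuousAt.2 fun p => (dB p).continuousAt
  have dh : ∀ p ∈ Ioo (min (-R) R) (max (-R) R) ×ˢ Ioo (min (0 : ℝ) 1) (max 0 1),
      HasFDerivAt (fun p => h (γ p)) (deriv h (γ p) • γ' p) p := fun p hp => by
    have h2 : p.2 ∈ Ioo (0 : ℝ) 1 := by simpa using hp.2
    have h3 := hlt p.1
    refine HasDerivAt.comp_hasFDerivAt p (hd _ ?_ ?_).hasDerivAt (dγ p)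
    · rw [hγ, stripPt_re, stripPt_im]; nlinarith [h2.1]
    · rw [hγ, stripPt_re, stripPt_im]; nlinarith [h2.2]
  have key := integral2_divergence_prod_of_hasFDerivAt (fun p => h (γ p) * A p)
    (fun p => -(h (γ p) * B p)) (fun p => h (γ p) • A' p + A p • (deriv h (γ p) • γ' p))
    (fun p => -(h (γ p) • B' p + B p • (deriv h (γ p) • γ' p))) (-R) 0 R 1
    (hhγ.mul hcA.continuousOn) (hhγ.mul hcB.continuousOn).neg
    (fun p hp => (dh p hp).mul (dA p)) (fun p hp => ((dh p hp).mul (dB p)).neg)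
  have hz : ∀ p, (h (γ p) • A' p + A p • (deriv h (γ p) • γ' p)) (1, 0)
      + (-(h (γ p) • B' p + B p • (deriv h (γ p) • γ' p))) (0, 1) = 0 := fun p => by
    simp [hA', hB', hγ', dx, ds]
    ring
  simp only [hz, integrableOn_zero, forall_const, intervalIntegral.integral_zero,
    intervalIntegral.integral_neg] at key
  have e1 : ∀ x, γ (x, 1) = pt b x := fun x => by simp [hγ, stripPt, pt]
  have e0 : ∀ x, γ (x, 0) = pt a x := fun x => by simp [hγ, stripPt, pt]
  simp only [e1, e0, hA, hB, one_mul, zero_mul, add_zero, add_sub_cancel] at key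
  linear_combination key

/-- Cauchy's theorem for the whole strip: for a function decaying at both ends, the integrals over
the two boundary curves agree. -/
theorem integral_upper_eq_integral_lower (hlt : ∀ x, a x < b x) {H : ℝ}
    (hH : ∀ x, b x - a x ≤ H) {h : ℂ → ℂ}
    (hd : ∀ z : ℂ, a z.re < z.im → z.im < b z.re → DifferentiableAt ℂ h z)
    (hc : ContinuousOn h (closedStrip a b))
    (hv : ∀ ε > 0, ∃ R : ℝ, ∀ z ∈ closedStrip a b, R < |z.re| → ‖h z‖ < ε)
    (hia : Integrable fun x => h (pt a x) * (1 + I * (deriv a x : ℝ)))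
    (hib : Integrable fun x => h (pt b x) * (1 + I * (deriv b x : ℝ))) :
    ∫ x, h (pt b x) * (1 + I * (deriv b x : ℝ)) = ∫ x, h (pt a x) * (1 + I * (deriv a x : ℝ)) := by
  have hE : Tendsto (fun R : ℝ => ∫ s in (0 : ℝ)..1, h (stripPt a b (R, s)) * (I * (b R - a R : ℝ)))
      (cocompact ℝ) (𝓝 0) := by
    rw [Metric.tendsto_nhds]
    intro ε hε
    have hH0 : 0 < H := (sub_pos.2 (hlt 0)).trans_le (hH 0)
    obtain ⟨R, hR⟩ := hv (ε / (2 * H)) (by positivity)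
    filter_upwards [(tendsto_norm_cocompact_atTop (E := ℝ)).eventually_gt_atTop R] with x hx
    rw [dist_zero_right]
    have := intervalIntegral.norm_integral_le_of_norm_le_const (a := 0) (b := 1) (C := ε / 2)
      (f := fun s : ℝ => h (stripPt a b (x, s)) * (I * (b x - a x : ℝ))) fun s hs => by
        rw [uIoc_of_le zero_le_one] at hs
        have h1 := hR _ (stripPt_mem_closedStrip hlt (p := (x, s)) ⟨hs.1.le, hs.2⟩)
          (by simpa using hx)
        rw [norm_mul, norm_mul, norm_I, one_mul, norm_real, Real.norm_eq_abs,
          abs_of_pos (sub_pos.2 (hlt x))]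
        calc _ ≤ ε / (2 * H) * H := mul_le_mul h1.le (hH x) (sub_pos.2 (hlt x)).le (by positivity)
          _ = ε / 2 := by field_simp
    simp only [sub_zero, abs_one, mul_one] at this
    linarith
  have hT : Tendsto (fun R : ℝ => R) atTop (cocompact ℝ) := by
    rw [cocompact_eq_atBot_atTop]
    exact tendsto_id.mono_right le_sup_right
  have hB : Tendsto (fun R : ℝ => -R) atTop (cocompact ℝ) := by
    rw [cocompact_eq_atBot_atTop]
    exact tendsto_neg_atTop_atBot.mono_right le_sup_left
  have h1 := (hE.comp hT).sub (hE.comp hB)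
  have h2 := (intervalIntegral_tendsto_integral hib tendsto_neg_atTop_atBot tendsto_id).sub
    (intervalIntegral_tendsto_integral hia tendsto_neg_atTop_atBot tendsto_id)
  have h3 := tendsto_nhds_unique h2 (h1.congr fun R =>
    (integral_upper_sub_integral_lower ha hb hlt hd hc R).symm)
  simpa [sub_eq_zero] using h3

end CurvedStrip

/-- A function holomorphic in a strip, continuous up to the boundary, zero on the boundary curves
and decaying at both ends is zero. -/
theorem eqOn_zero_of_strip {a b : ℝ → ℝ} (ha : Continuous a) (hb : Continuous b) {A B : ℝ}
    (hA : ∀ x, |a x| ≤ A) (hB : ∀ x, |b x| ≤ B) {h : ℂ → ℂ}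
    (hd : ∀ z : ℂ, a z.re < z.im → z.im < b z.re → DifferentiableAt ℂ h z)
    (hc : ContinuousOn h (closedStrip a b))
    (hv : ∀ ε > 0, ∃ R : ℝ, ∀ z ∈ closedStrip a b, R < |z.re| → ‖h z‖ < ε)
    (hza : ∀ x, h (pt a x) = 0) (hzb : ∀ x, h (pt b x) = 0) :
    EqOn h 0 (closedStrip a b) := by
  have hza' : ∀ z : ℂ, a z.re = z.im → h z = 0 := fun z hz => by
    rw [← hza z.re]; congr 1; apply Complex.ext <;> simp [hz]
  have hzb' : ∀ z : ℂ, z.im = b z.re → h z = 0 := fun z hz => by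
    rw [← hzb z.re]; congr 1; apply Complex.ext <;> simp [hz]
  intro z hz
  rcases hz.1.eq_or_lt with h1 | h1
  · exact hza' z h1
  rcases hz.2.eq_or_lt with h2 | h2
  · exact hzb' z h2
  rw [Pi.zero_apply, ← norm_le_zero_iff]
  refine le_of_forall_pos_le_add fun ε hε => ?_
  rw [zero_add]
  obtain ⟨R, hR⟩ := hv ε hε
  -- The maximum principle on a truncation of the strip, whose vertical sides lie where `|h| < ε`.
  set R' := max R |z.re| + 1 with hR'
  set V : Set ℂ := {w | a w.re < w.im ∧ w.im < b w.re} ∩ {w | |w.re| < R'} with hV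
  have hVo : IsOpen V := (isOpen_strip ha hb).inter (isOpen_lt (by fun_prop) continuous_const)
  have hcl : closure V ⊆ closedStrip a b ∩ {w | |w.re| ≤ R'} := by
    refine closure_minimal (fun w hw => ⟨⟨hw.1.1.le, hw.1.2.le⟩, (show |w.re| < R' from hw.2).le⟩) ?_
    have c1 : Continuous fun w : ℂ => a w.re := ha.comp Complex.continuous_re
    have c2 : Continuous fun w : ℂ => b w.re := hb.comp Complex.continuous_re
    exact ((isClosed_le c1 Complex.continuous_im).inter (isClosed_le Complex.continuous_im c2)).inter
      (isClosed_le Complex.continuous_re.abs continuous_const)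
  have hbd : Bornology.IsBounded V := by
    refine (isBounded_iff_forall_norm_le.2 ⟨R' + (A + B), fun w hw => ?_⟩)
    refine (Complex.norm_le_abs_re_add_abs_im w).trans (add_le_add (le_of_lt hw.2) ?_)
    have h3 := abs_le.1 (hA w.re)
    have h4 := abs_le.1 (hB w.re)
    exact abs_le.2 ⟨by linarith [hw.1.1, (abs_nonneg _).trans (hB 0)],
      by linarith [hw.1.2, (abs_nonneg _).trans (hA 0)]⟩
  have hdc : DiffContOnCl ℂ h V :=
    ⟨fun w hw => (hd w hw.1.1 hw.1.2).differentiableWithinAt, hc.mono fun w hw => (hcl hw).1⟩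
  refine Complex.norm_le_of_forall_mem_frontier_norm_le hbd hdc (fun w hw => ?_)
    (subset_closure (s := V) ⟨⟨h1, h2⟩, ?_⟩)
  · have hw1 := hcl hw.1
    have hw2 : w ∉ V := by rw [← hVo.interior_eq]; exact hw.2
    rcases hw1.1.1.eq_or_lt with h3 | h3
    · rw [hza' w h3, norm_zero]; exact hε.le
    rcases hw1.1.2.eq_or_lt with h4 | h4
    · rw [hzb' w h4, norm_zero]; exact hε.le
    refine (hR w hw1.1 ?_).le
    by_contra! h5
    exact hw2 ⟨⟨h3, h4⟩, lt_of_le_of_lt (h5.trans (le_max_left _ |z.re|)) (lt_add_one _)⟩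
  · exact lt_of_le_of_lt (le_max_right R _) (lt_add_one _)

/-! ### Boundary values and uniqueness of the flow in a layer -/

/-- The impermeability condition and the boundary potential determine all first derivatives of the
potential on a surface: three linear equations with determinant `1 + (∂_x η)²`. -/
lemma surf_formulas {D : Set (ℝ × ℝ × ℝ)} {φ : ℝ × ℝ × ℝ → ℝ} {η ξ : ℝ → ℝ → ℝ} {U x t : ℝ}
    {p : ℝ × ℝ × ℝ} (hn : (U + pX D φ p) * (-dX η x t) + pY D φ p * 1 = dT η x t)
    (hx : dX ξ x t = pX D φ p + pY D φ p * dX η x t)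
    (ht : dT ξ x t = pT D φ p + pY D φ p * dT η x t) :
    pX D φ p = surfX U η ξ x t ∧ pY D φ p = surfY U η ξ x t ∧ pT D φ p = surfT U η ξ x t := by
  have h0 : (0 : ℝ) < 1 + dX η x t ^ 2 := by positivity
  have hY : pY D φ p = dU U η x t + pX D φ p * dX η x t := by rw [dU, ← hn]; ring
  rw [hY] at hx ht ⊢
  refine ⟨?_, ?_, ?_⟩
  · rw [surfX, eq_div_iff h0.ne', hx]; ring
  · rw [surfY, eq_div_iff h0.ne', hx]; ring
  · rw [surfT, eq_div_iff h0.ne', hx, ht]; ring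

lemma VanishesOn.at {D : Set (ℝ × ℝ × ℝ)} {F : ℝ × ℝ × ℝ → ℝ} (h : VanishesOn D F) {t : ℝ}
    (ht : 0 < t) {ε : ℝ} (hε : 0 < ε) :
    ∃ R : ℝ, ∀ x y : ℝ, (x, y, t) ∈ D → R < |x| → |F (x, y, t)| < ε := by
  obtain ⟨δ, hδ, R, hR⟩ := h t ht ε hε
  exact ⟨R, fun x y hp hx => hR t x y hp (by simpa using hδ) hx⟩

/-- The complex velocity `∂_x φ - i ∂_y φ` at time `t`. -/
def velC (a b : ℝ → ℝ → ℝ) (φ : ℝ × ℝ × ℝ → ℝ) (t : ℝ) (z : ℂ) : ℂ :=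
  pX (region a b) φ (z.re, z.im, t) - I * pY (region a b) φ (z.re, z.im, t)

namespace LayerFlow
variable {a b α β : ℝ → ℝ → ℝ} {U : ℝ} {φ : ℝ × ℝ × ℝ → ℝ} (F : LayerFlow a b U φ)
  (hO : OrderedC1 a b)
include F

lemma differentiableWithinAt {p : ℝ × ℝ × ℝ} (hp : p ∈ region a b) :
    DifferentiableWithinAt ℝ φ (region a b) p :=
  F.contDiffOn.differentiableOn one_ne_zero p hp

include hO

lemma surf_lower (hα : ∀ x t, 0 < t → φ (x, a x t, t) = α x t) {t : ℝ} (ht : 0 < t) (x : ℝ) :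
    pX (region a b) φ (x, a x t, t) = surfX U a α x t ∧
    pY (region a b) φ (x, a x t, t) = surfY U a α x t ∧
    pT (region a b) φ (x, a x t, t) = surfT U a α x t := by
  have hd := F.differentiableWithinAt (hO.lower_mem_region ht x)
  refine surf_formulas (F.normal_lower x t ht) (HasDerivAt.deriv ?_) (HasDerivAt.deriv ?_)
  · refine (hasDerivAt_trace_x hd (hasDerivAt_dX hO.lower ht x)
      (hO.lower_mem_region ht)).congr_of_eventuallyEq (.of_forall fun y => (hα y t ht).symm)
  · refine (hasDerivAt_trace_t hd (hasDerivAt_dT hO.lower ht x) ?_).congr_of_eventuallyEq ?_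
    · filter_upwards [Ioi_mem_nhds ht] with s hs using hO.lower_mem_region hs x
    · filter_upwards [Ioi_mem_nhds ht] with s hs using (hα x s hs).symm

lemma surf_upper (hβ : ∀ x t, 0 < t → φ (x, b x t, t) = β x t) {t : ℝ} (ht : 0 < t) (x : ℝ) :
    pX (region a b) φ (x, b x t, t) = surfX U b β x t ∧
    pY (region a b) φ (x, b x t, t) = surfY U b β x t ∧
    pT (region a b) φ (x, b x t, t) = surfT U b β x t := by
  have hd := F.differentiableWithinAt (hO.upper_mem_region ht x)
  refine surf_formulas (F.normal_upper x t ht) (HasDerivAt.deriv ?_) (HasDerivAt.deriv ?_)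
  · refine (hasDerivAt_trace_x hd (hasDerivAt_dX hO.upper ht x)
      (hO.upper_mem_region ht)).congr_of_eventuallyEq (.of_forall fun y => (hβ y t ht).symm)
  · refine (hasDerivAt_trace_t hd (hasDerivAt_dT hO.upper ht x) ?_).congr_of_eventuallyEq ?_
    · filter_upwards [Ioi_mem_nhds ht] with s hs using hO.upper_mem_region hs x
    · filter_upwards [Ioi_mem_nhds ht] with s hs using (hβ x s hs).symm

lemma velC_lower (hα : ∀ x t, 0 < t → φ (x, a x t, t) = α x t) {t : ℝ} (ht : 0 < t) (x : ℝ) :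
    velC a b φ t (pt (fun x => a x t) x) = densF U a α x t := by
  obtain ⟨h1, h2, -⟩ := F.surf_lower hO hα ht x
  rw [velC, densF_eq, pt_re, pt_im, h1, h2]

lemma velC_upper (hβ : ∀ x t, 0 < t → φ (x, b x t, t) = β x t) {t : ℝ} (ht : 0 < t) (x : ℝ) :
    velC a b φ t (pt (fun x => b x t) x) = densF U b β x t := by
  obtain ⟨h1, h2, -⟩ := F.surf_upper hO hβ ht x
  rw [velC, densF_eq, pt_re, pt_im, h1, h2]

lemma continuousOn_velC {t : ℝ} (ht : 0 < t) :
    ContinuousOn (velC a b φ t) (closedStrip (fun x => a x t) fun x => b x t) := by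
  have h1 := F.contDiffOn.continuousOn_fderivWithin hO.uniqueDiffOn_region le_rfl
  have h2 : ContinuousOn (fun z : ℂ => (z.re, z.im, t))
      (closedStrip (fun x => a x t) fun x => b x t) := by fun_prop
  have h3 := h1.comp h2 fun z hz => ⟨ht, hz.1, hz.2⟩
  have h4 : ∀ v, ContinuousOn (fun z : ℂ =>
      ((fderivWithin ℝ φ (region a b) (z.re, z.im, t) v : ℝ) : ℂ))
      (closedStrip (fun x => a x t) fun x => b x t) := fun v =>
    Complex.continuous_ofReal.comp_continuousOn (h3.clm_apply continuousOn_const)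
  exact (h4 _).sub (continuousOn_const.mul (h4 _))

/-- Inside the layer the complex velocity is holomorphic, the potential being harmonic. -/
lemma differentiableAt_velC {t : ℝ} (ht : 0 < t) {z : ℂ} (h1 : a z.re t < z.im)
    (h2 : z.im < b z.re t) : DifferentiableAt ℂ (velC a b φ t) z := by
  have hop : IsOpen {z : ℂ | (z.re, z.im, t) ∈ openRegion a b} :=
    hO.isOpen_openRegion.preimage (by fun_prop)
  refine (HarmonicAt.differentiableAt_complex_partial
    (F.harmonic t ht z ⟨h1, h2⟩)).congr_of_eventuallyEq ?_
  filter_upwards [hop.mem_nhds (show (z.re, z.im, t) ∈ openRegion a b from ⟨ht, h1, h2⟩)] with w hw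
  have hm : HasFDerivAt (fun z : ℂ => (z.re, z.im, t))
      (Complex.reCLM.prod (Complex.imCLM.prod (0 : ℂ →L[ℝ] ℝ))) w :=
    Complex.reCLM.hasFDerivAt.prodMk (Complex.imCLM.hasFDerivAt.prodMk (hasFDerivAt_const t w))
  have hd : HasFDerivAt φ (fderivWithin ℝ φ (region a b) (w.re, w.im, t)) (w.re, w.im, t) :=
    (F.differentiableWithinAt (OrderedC1.openRegion_subset hw)).hasFDerivWithinAt.hasFDerivAt
      (hO.region_mem_nhds hw)
  have hc : HasFDerivAt (fun z : ℂ => φ (z.re, z.im, t)) _ w := hd.comp w hm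
  rw [hc.fderiv]
  simp [velC, pX, pY]

omit hO in
lemma vanishes_velC {t : ℝ} (ht : 0 < t) {ε : ℝ} (hε : 0 < ε) :
    ∃ R : ℝ, ∀ z ∈ closedStrip (fun x => a x t) (fun x => b x t), R < |z.re| →
      ‖velC a b φ t z‖ < ε := by
  obtain ⟨R₁, h1⟩ := F.pX_vanishes.at ht (half_pos hε)
  obtain ⟨R₂, h2⟩ := F.pY_vanishes.at ht (half_pos hε)
  refine ⟨max R₁ R₂, fun z hz hx => ?_⟩
  have h3 := h1 z.re z.im ⟨ht, hz.1, hz.2⟩ ((le_max_left _ _).trans_lt hx)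
  have h4 := h2 z.re z.im ⟨ht, hz.1, hz.2⟩ ((le_max_right _ _).trans_lt hx)
  refine (norm_sub_le _ _).trans_lt ?_
  rw [norm_mul, norm_I, one_mul, norm_real, norm_real, Real.norm_eq_abs, Real.norm_eq_abs]
  linarith

end LayerFlow

lemma integrable_exp_mul_densG {l U k t : ℝ} {η ξ : ℝ → ℝ → ℝ} (h : PlateClass l η)
    (hξ : TraceClass ξ) (ht : 0 < t) :
    Integrable fun x => cexp (-I * k * pt (fun x => η x t) x) * densG U η ξ x t := by
  obtain ⟨A, hA⟩ := h.lb.at ht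
  have hc : Continuous fun x => cexp (-I * k * pt (fun x => η x t) x) := by
    have := continuous_pt (h.jc.continuous ht)
    fun_prop
  refine (integrable_densG h hξ ht).bdd_mul (c := Real.exp (|k| * A)) hc.aestronglyMeasurable
    (.of_forall fun x => ?_)
  rw [Complex.norm_exp, Real.exp_le_exp]
  have : (-I * k * pt (fun x => η x t) x).re = k * η x t := by simp [pt]
  rw [this]
  exact (le_abs_self _).trans (by rw [abs_mul]; exact mul_le_mul_of_nonneg_left (hA x) (abs_nonneg k))

/-- The two densities of a flow have the same exponential moments, by Cauchy's theorem for
`e^{-ikz}` times the complex velocity. -/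
theorem LayerFlow.layerData {a b α β : ℝ → ℝ → ℝ} {U la lb : ℝ} {φ : ℝ × ℝ × ℝ → ℝ}
    (F : LayerFlow a b U φ) (ha : PlateClass la a) (hb : PlateClass lb b)
    (hlt : ∀ x t, 0 < t → a x t < b x t) (hα : TraceClass α) (hβ : TraceClass β)
    (hφα : ∀ x t, 0 < t → φ (x, a x t, t) = α x t)
    (hφβ : ∀ x t, 0 < t → φ (x, b x t, t) = β x t) : LayerData a b α β U where
  lower := ⟨la, ha⟩
  upper := ⟨lb, hb⟩
  lt := hlt
  traceLower := hα
  traceUpper := hβ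
  moment t ht k := by
    have hO : OrderedC1 a b := ⟨ha.contDiffOn_one, hb.contDiffOn_one, hlt⟩
    obtain ⟨A, hA⟩ := ha.lb.at ht
    obtain ⟨B, hB⟩ := hb.lb.at ht
    have ea : ∀ x, cexp (-I * k * pt (fun x => a x t) x) * velC a b φ t (pt (fun x => a x t) x)
        * (1 + I * (deriv (fun x => a x t) x : ℝ))
        = cexp (-I * k * pt (fun x => a x t) x) * densG U a α x t := fun x => by
      rw [F.velC_lower hO hφα ht, mul_assoc, ← densF_mul_tanC U a α x t]; rfl
    have eb : ∀ x, cexp (-I * k * pt (fun x => b x t) x) * velC a b φ t (pt (fun x => b x t) x)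
        * (1 + I * (deriv (fun x => b x t) x : ℝ))
        = cexp (-I * k * pt (fun x => b x t) x) * densG U b β x t := fun x => by
      rw [F.velC_upper hO hφβ ht, mul_assoc, ← densF_mul_tanC U b β x t]; rfl
    have key := integral_upper_eq_integral_lower (a := fun x => a x t) (b := fun x => b x t)
      ((ha.contDiff_x t ht).of_le (by norm_num)) ((hb.contDiff_x t ht).of_le (by norm_num))
      (fun x => hlt x t ht) (H := A + B) (fun x => ?_)
      (h := fun z => cexp (-I * k * z) * velC a b φ t z) (fun z h1 h2 => ?_)
      ((by fun_prop : Continuous fun z : ℂ => cexp (-I * k * z)).continuousOn.mul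
        (F.continuousOn_velC hO ht)) (fun ε hε => ?_) ?_ ?_
    · simpa only [ea, eb] using key.symm
    · have h1 := (abs_le.1 (hA x)).1
      have h2 := (abs_le.1 (hB x)).2
      linarith
    · exact DifferentiableAt.mul (by fun_prop) (F.differentiableAt_velC hO ht h1 h2)
    · obtain ⟨R, hR⟩ := F.vanishes_velC ht (ε := ε * Real.exp (-(|k| * (A + B)))) (by positivity)
      refine ⟨R, fun z hz hx => ?_⟩
      have h1 := hR z hz hx
      have h2 : ‖cexp (-I * k * z)‖ ≤ Real.exp (|k| * (A + B)) := by
        rw [Complex.norm_exp, Real.exp_le_exp]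
        have e : (-I * k * z).re = k * z.im := by simp
        rw [e]
        refine (le_abs_self _).trans ?_
        rw [abs_mul]
        refine mul_le_mul_of_nonneg_left (abs_le.2 ⟨?_, ?_⟩) (abs_nonneg k)
        · linarith [hz.1, (abs_le.1 (hA z.re)).1, (norm_nonneg _).trans (hB 0)]
        · linarith [hz.2, (abs_le.1 (hB z.re)).2, (norm_nonneg _).trans (hA 0)]
      rw [norm_mul]
      calc _ ≤ Real.exp (|k| * (A + B)) * ‖velC a b φ t z‖ := by gcongr
        _ < Real.exp (|k| * (A + B)) * (ε * Real.exp (-(|k| * (A + B)))) := by gcongr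
        _ = ε := by rw [mul_left_comm, ← Real.exp_add, add_neg_cancel, Real.exp_zero, mul_one]
    · simpa only [ea] using integrable_exp_mul_densG ha hα ht
    · simpa only [eb] using integrable_exp_mul_densG hb hβ ht

/-- The flow in a layer is determined by the boundary values of its potential: the difference of
two complex velocities is zero on both surfaces. -/
theorem LayerFlow.eqOn {a b α β : ℝ → ℝ → ℝ} {U : ℝ} {φ φ' : ℝ × ℝ × ℝ → ℝ}
    (F : LayerFlow a b U φ) (F' : LayerFlow a b U φ') (hO : OrderedC1 a b)
    (ha : LocBdd a) (hb : LocBdd b)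
    (hφα : ∀ x t, 0 < t → φ (x, a x t, t) = α x t) (hφβ : ∀ x t, 0 < t → φ (x, b x t, t) = β x t)
    (hφα' : ∀ x t, 0 < t → φ' (x, a x t, t) = α x t)
    (hφβ' : ∀ x t, 0 < t → φ' (x, b x t, t) = β x t) : EqOn φ φ' (region a b) := by
  rintro ⟨x, y, t⟩ hp
  have ht : 0 < t := hp.1
  obtain ⟨A, hA⟩ := ha.at ht
  obtain ⟨B, hB⟩ := hb.at ht
  have hac : Continuous fun x => a x t := JointCont.continuous (f := a) hO.lower.continuousOn ht
  have hbc : Continuous fun x => b x t := JointCont.continuous (f := b) hO.upper.continuousOn ht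
  have hv : EqOn (fun z => velC a b φ t z - velC a b φ' t z) 0
      (closedStrip (fun x => a x t) fun x => b x t) :=
    eqOn_zero_of_strip hac hbc hA hB
    (fun z h1 h2 => (F.differentiableAt_velC hO ht h1 h2).sub (F'.differentiableAt_velC hO ht h1 h2))
    ((F.continuousOn_velC hO ht).sub (F'.continuousOn_velC hO ht))
    (fun ε hε => by
      obtain ⟨R₁, h1⟩ := F.vanishes_velC ht (half_pos hε)
      obtain ⟨R₂, h2⟩ := F'.vanishes_velC ht (half_pos hε)
      refine ⟨max R₁ R₂, fun z hz hx => (norm_sub_le _ _).trans_lt ?_⟩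
      linarith [h1 z hz ((le_max_left _ _).trans_lt hx), h2 z hz ((le_max_right _ _).trans_lt hx)])
    (fun x => by rw [F.velC_lower hO hφα ht, F'.velC_lower hO hφα' ht, sub_self])
    (fun x => by rw [F.velC_upper hO hφβ ht, F'.velC_upper hO hφβ' ht, sub_self])
  -- The vertical derivatives agree and so do the values on the lower surface.
  have hd : ∀ v ∈ Icc (a x t) (b x t), HasDerivWithinAt
      (fun v => φ (x, v, t) - φ' (x, v, t)) 0 (Icc (a x t) (b x t)) v := fun v hv' => by
    have hm : (x, v, t) ∈ region a b := ⟨ht, hv'.1, hv'.2⟩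
    have hl : HasDerivWithinAt (fun v : ℝ => (x, v, t)) ((0 : ℝ), (1 : ℝ), (0 : ℝ))
        (Icc (a x t) (b x t)) v :=
      ((hasDerivAt_const v x).prodMk
        ((hasDerivAt_id v).prodMk (hasDerivAt_const v t))).hasDerivWithinAt
    have hmaps : MapsTo (fun v : ℝ => (x, v, t)) (Icc (a x t) (b x t)) (region a b) :=
      fun w hw => ⟨ht, hw.1, hw.2⟩
    have h1 := (F.differentiableWithinAt hm).hasFDerivWithinAt.comp_hasDerivWithinAt v hl hmaps
    have h2 := (F'.differentiableWithinAt hm).hasFDerivWithinAt.comp_hasDerivWithinAt v hl hmaps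
    refine (h1.sub h2).congr_deriv ?_
    have h3 : velC a b φ t (x + I * v) - velC a b φ' t (x + I * v) = 0 :=
      hv (show (x + I * v : ℂ) ∈ closedStrip _ _ by simpa [closedStrip] using hv')
    have h4 := congrArg Complex.im h3
    simp [velC] at h4
    change pY (region a b) φ (x, v, t) - pY (region a b) φ' (x, v, t) = 0
    linarith
  have hc := (convex_Icc (a x t) (b x t)).norm_image_sub_le_of_norm_hasDerivWithin_le (C := 0) hd
    (fun _ _ => by simp) (left_mem_Icc.2 (hO.lt x t ht).le) 
    (show y ∈ Icc (a x t) (b x t) from ⟨hp.2.1, hp.2.2⟩)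
  rw [zero_mul, norm_le_zero_iff, hφα x t ht, hφα' x t ht, sub_self, sub_zero] at hc
  exact sub_eq_zero.1 hc

/-! ### Moments and the non-local equations -/

section Moments

/-- The integrand of an exponential moment of the density on a surface. -/
def momentIntegrand (U : ℝ) (η ξ : ℝ → ℝ → ℝ) (t k x : ℝ) : ℂ :=
  cexp (-I * k * pt (fun x => η x t) x) * densG U η ξ x t

lemma I_mul_momentIntegrand (U : ℝ) (η ξ : ℝ → ℝ → ℝ) (t k x : ℝ) :
    I * momentIntegrand U η ξ t k x
      = cexp (-I * k * x) * cexp (k * η x t) * (dU U η x t + I * dX ξ x t) := by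
  have e : -I * k * pt (fun x => η x t) x = -I * k * x + k * η x t := by
    rw [pt]; linear_combination (-k * η x t : ℂ) * I_sq
  rw [momentIntegrand, e, Complex.exp_add, densG]
  linear_combination (-cexp (-I * k * x) * cexp (k * η x t) * dU U η x t : ℂ) * I_sq

lemma conj_I_mul_momentIntegrand_neg (U : ℝ) (η ξ : ℝ → ℝ → ℝ) (t k x : ℝ) :
    (starRingEnd ℂ) (I * momentIntegrand U η ξ t (-k) x)
      = cexp (-I * k * x) * cexp (-(k * η x t)) * (dU U η x t - I * dX ξ x t) := by
  rw [I_mul_momentIntegrand, map_mul, map_mul, ← Complex.exp_conj, ← Complex.exp_conj]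
  simp [sub_eq_add_neg]

variable {a b α β : ℝ → ℝ → ℝ} {U la lb t : ℝ} (ha : PlateClass la a) (hb : PlateClass lb b)
  (hα : TraceClass α) (hβ : TraceClass β) (ht : 0 < t)
include ha hb hα hβ ht

lemma integral_sinh_eq (k : ℝ) : ∫ x : ℝ, cexp (-I * k * x) *
      ((dU U a x t * Real.sinh (k * a x t) : ℝ) + I * (dX α x t * Real.cosh (k * a x t) : ℝ)
        - (dU U b x t * Real.sinh (k * b x t) : ℝ) - I * (dX β x t * Real.cosh (k * b x t) : ℝ))
    = (I * (∫ x, momentIntegrand U a α t k x) - I * ∫ x, momentIntegrand U b β t k x) / 2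
      - (starRingEnd ℂ) (I * (∫ x, momentIntegrand U a α t (-k) x)
        - I * ∫ x, momentIntegrand U b β t (-k) x) / 2 := by
  have i1 : ∀ k, Integrable fun x => I * momentIntegrand U a α t k x := fun k =>
    (integrable_exp_mul_densG ha hα ht).const_mul I
  have i2 : ∀ k, Integrable fun x => I * momentIntegrand U b β t k x := fun k =>
    (integrable_exp_mul_densG hb hβ ht).const_mul I
  have i3 : ∀ k, Integrable fun x =>
      I * momentIntegrand U a α t k x - I * momentIntegrand U b β t k x := fun k =>
    (i1 k).sub (i2 k)
  rw [← integral_const_mul, ← integral_const_mul, ← integral_sub (i1 k) (i2 k),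
    ← integral_const_mul, ← integral_const_mul, ← integral_sub (i1 (-k)) (i2 (-k)), ← integral_conj,
    ← integral_div, ← integral_div, ← integral_sub ((i3 k).div_const 2)
      ((integrable_conj (i3 (-k))).div_const 2)]
  congr 1; ext x
  rw [map_sub, conj_I_mul_momentIntegrand_neg, conj_I_mul_momentIntegrand_neg,
    I_mul_momentIntegrand, I_mul_momentIntegrand]
  push_cast
  rw [Complex.sinh, Complex.sinh, Complex.cosh, Complex.cosh]
  ring

lemma integral_cosh_eq (k : ℝ) : ∫ x : ℝ, cexp (-I * k * x) *
      ((dU U a x t * Real.cosh (k * a x t) : ℝ) + I * (dX α x t * Real.sinh (k * a x t) : ℝ)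
        - (dU U b x t * Real.cosh (k * b x t) : ℝ) - I * (dX β x t * Real.sinh (k * b x t) : ℝ))
    = (I * (∫ x, momentIntegrand U a α t k x) - I * ∫ x, momentIntegrand U b β t k x) / 2
      + (starRingEnd ℂ) (I * (∫ x, momentIntegrand U a α t (-k) x)
        - I * ∫ x, momentIntegrand U b β t (-k) x) / 2 := by
  have i1 : ∀ k, Integrable fun x => I * momentIntegrand U a α t k x := fun k =>
    (integrable_exp_mul_densG ha hα ht).const_mul I
  have i2 : ∀ k, Integrable fun x => I * momentIntegrand U b β t k x := fun k =>
    (integrable_exp_mul_densG hb hβ ht).const_mul I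
  have i3 : ∀ k, Integrable fun x =>
      I * momentIntegrand U a α t k x - I * momentIntegrand U b β t k x := fun k =>
    (i1 k).sub (i2 k)
  rw [← integral_const_mul, ← integral_const_mul, ← integral_sub (i1 k) (i2 k),
    ← integral_const_mul, ← integral_const_mul, ← integral_sub (i1 (-k)) (i2 (-k)), ← integral_conj,
    ← integral_div, ← integral_div, ← integral_add ((i3 k).div_const 2)
      ((integrable_conj (i3 (-k))).div_const 2)]
  congr 1; ext x
  rw [map_sub, conj_I_mul_momentIntegrand_neg, conj_I_mul_momentIntegrand_neg,
    I_mul_momentIntegrand, I_mul_momentIntegrand]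
  push_cast
  rw [Complex.sinh, Complex.sinh, Complex.cosh, Complex.cosh]
  ring

/-- The pair of non-local equations of a layer, for all wave numbers, is the equality of moments:
the sum of the two equations is the moment at `k`, their difference the conjugate of the moment
at `-k`. -/
lemma forall_integral_eq_zero_iff : (∀ k : ℝ,
    (∫ x : ℝ, cexp (-I * k * x) *
      ((dU U a x t * Real.sinh (k * a x t) : ℝ) + I * (dX α x t * Real.cosh (k * a x t) : ℝ)
        - (dU U b x t * Real.sinh (k * b x t) : ℝ)
        - I * (dX β x t * Real.cosh (k * b x t) : ℝ)) = 0) ∧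
    ∫ x : ℝ, cexp (-I * k * x) *
      ((dU U a x t * Real.cosh (k * a x t) : ℝ) + I * (dX α x t * Real.sinh (k * a x t) : ℝ)
        - (dU U b x t * Real.cosh (k * b x t) : ℝ)
        - I * (dX β x t * Real.sinh (k * b x t) : ℝ)) = 0) ↔
    ∀ k : ℝ, ∫ x, momentIntegrand U a α t k x = ∫ x, momentIntegrand U b β t k x := by
  simp only [integral_sinh_eq ha hb hα hβ ht, integral_cosh_eq ha hb hα hβ ht]
  constructor
  · intro h k
    obtain ⟨h1, h2⟩ := h k
    have h3 : I * ((∫ x, momentIntegrand U a α t k x) - ∫ x, momentIntegrand U b β t k x) = 0 := by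
      linear_combination h1 + h2
    exact sub_eq_zero.1 ((mul_eq_zero.1 h3).resolve_left I_ne_zero)
  · intro h k
    rw [h k, h (-k)]
    simp

end Moments

/-! ### The walls -/

section Walls

lemma vanishes_of_tendsto {f : ℝ → ℝ} (hf : Tendsto f (cocompact ℝ) (𝓝 0)) :
    Vanishes fun x _ => f x :=
  vanishes_iff_decays.2 fun _ _ => hf.comp tendsto_fst

lemma locallyDominated_of_integrable {f : ℝ → ℝ} (hf : Integrable f) :
    LocallyDominated fun x _ => f x :=
  fun _ _ => ⟨fun x => |f x|, hf.abs, 1, one_pos, fun _ _ _ _ => le_rfl⟩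

lemma schwartz_class (f : 𝓢(ℝ, ℝ)) :
    Vanishes (fun x _ => f x) ∧ LocallyDominated fun x _ => f x :=
  ⟨vanishes_of_tendsto f.tendsto_cocompact, locallyDominated_of_integrable f.integrable⟩

lemma zero_class : Vanishes (fun _ _ => 0) ∧ LocallyDominated fun _ _ => 0 := by
  simpa using schwartz_class 0

/-- A wall is a plate at rest. -/
lemma plateClass_wall (c : ℝ) (f : 𝓢(ℝ, ℝ)) : PlateClass c fun x _ => c + f x := by
  have e1 : dX (fun x _ => c + f x) = fun x _ => SchwartzMap.derivCLM ℝ ℝ f x := by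
    ext x t; simp [dX]
  have e2 : ∀ g : 𝓢(ℝ, ℝ), dX (fun x _ => g x) = fun x _ => SchwartzMap.derivCLM ℝ ℝ g x := by
    intro g; ext x t; simp [dX]
  have e3 : ∀ g : ℝ → ℝ, dT (fun x _ => g x) = fun _ _ => 0 := by
    intro g; ext x t; simp [dT]
  exact
  { contDiffOn := by
      have : ContDiff ℝ 2 f := f.smooth 2
      fun_prop
    contDiff_x := fun t _ => contDiff_const.add (f.smooth 4)
    vanishes := by simpa using (schwartz_class f).1
    dX_class := by rw [e1]; exact schwartz_class _
    dT_class := by rw [e3]; exact zero_class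
    dXX_class := by rw [e1, e2]; exact schwartz_class _
    dTX_class := by rw [e1, e3]; exact zero_class
    dTT_class := by rw [e3, e3]; exact zero_class }

variable {n : ℕ} (C : Channel n)

lemma dT_top (x t : ℝ) : dT C.top x t = 0 := by simp [dT, Channel.top]
lemma dT_bot (x t : ℝ) : dT C.bot x t = 0 := by simp [dT, Channel.bot]
lemma dU_top (U x t : ℝ) : dU U C.top x t = U * deriv C.hTop x := by
  rw [dU, dT_top]; simp [dX, Channel.top]
lemma dU_bot (U x t : ℝ) : dU U C.bot x t = U * deriv C.hBot x := by
  rw [dU, dT_bot]; simp [dX, Channel.bot]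

end Walls

/-! ### The stack of layers -/

section Stack
variable {n : ℕ} {C : Channel n} {η : Fin n → ℝ → ℝ → ℝ}

lemma floor_zero : floor C η 0 = C.bot := rfl
lemma floor_succ (j : Fin n) : floor C η j.succ = η j := rfl
lemma ceil_last : ceil C η (Fin.last n) = C.top := by simp [ceil]
lemma ceil_castSucc (j : Fin n) : ceil C η j.castSucc = η j := by simp [ceil]

lemma ceil_zero : ceil C η 0 = η C.first := by
  rw [← ceil_castSucc (C := C) (η := η) C.first]; rfl

lemma floor_last : floor C η (Fin.last n) = η C.last := by
  rw [← floor_succ (C := C) (η := η) C.last]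
  congr 1
  ext
  have := C.one_le
  simp [Channel.last]
  omega

lemma AdmissiblePlates.floor_class (h : AdmissiblePlates C η) (i : Fin (n + 1)) :
    ∃ l, PlateClass l (floor C η i) := by
  induction i using Fin.cases with
  | zero => exact ⟨_, plateClass_wall (-C.h₀) C.hBot⟩
  | succ j => exact ⟨_, h.plate j⟩

lemma AdmissiblePlates.ceil_class (h : AdmissiblePlates C η) (i : Fin (n + 1)) :
    ∃ l, PlateClass l (ceil C η i) := by
  induction i using Fin.lastCases with
  | last => exact ⟨_, by rw [ceil_last]; exact plateClass_wall C.h₀ C.hTop⟩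
  | cast j => exact ⟨_, by rw [ceil_castSucc]; exact h.plate j⟩

lemma AdmissiblePlates.orderedC1 (h : AdmissiblePlates C η) (i : Fin (n + 1)) :
    OrderedC1 (floor C η i) (ceil C η i) where
  lower := (h.floor_class i).choose_spec.contDiffOn_one
  upper := (h.ceil_class i).choose_spec.contDiffOn_one
  lt := h.ordered i

/-- The non-local equations say, layer by layer, that the two densities have the same moments. -/
lemma nonlocal_iff_moments (h : AdmissiblePlates C η) {ξp ξm : Fin (n + 1) → ℝ → ℝ → ℝ}
    (hp : ∀ i, TraceClass (ξp i)) (hm : ∀ i, TraceClass (ξm i)) {t : ℝ} (ht : 0 < t) :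
    ((∀ (j : ℕ) (hj : j + 1 < n), ∀ k : ℝ, InternalEquations C η ξp ξm j hj t k) ∧
      ∀ k : ℝ, ExternalEquations C η ξp ξm t k) ↔
    ∀ (i : Fin (n + 1)) (k : ℝ), ∫ x, momentIntegrand (C.U i) (floor C η i) (ξm i) t k x
      = ∫ x, momentIntegrand (C.U i) (ceil C η i) (ξp i) t k x := by
  have hbot := plateClass_wall (-C.h₀) C.hBot
  have htop := plateClass_wall C.h₀ C.hTop
  have internal := fun (j : ℕ) (hj : j + 1 < n) => forall_integral_eq_zero_iff
    (U := C.U ⟨j + 1, Nat.lt_succ_of_lt hj⟩) (h.plate ⟨j, Nat.lt_of_succ_lt hj⟩)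
    (h.plate ⟨j + 1, hj⟩) (hm ⟨j + 1, Nat.lt_succ_of_lt hj⟩) (hp ⟨j + 1, Nat.lt_succ_of_lt hj⟩) ht
  have top := forall_integral_eq_zero_iff (U := C.U (Fin.last n)) (h.plate C.last) htop
    (hm (Fin.last n)) (hp (Fin.last n)) ht
  have bot := forall_integral_eq_zero_iff (U := C.U 0) (h.plate C.first) hbot (hp 0) (hm 0) ht
  -- The wall terms of the external equations in terms of `∂_U` of the walls.
  have eT : ∀ x t, dU (C.U (Fin.last n)) (fun x _ => C.h₀ + C.hTop x) x t
      = C.U (Fin.last n) * deriv C.hTop x := dU_top C _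
  have eB : ∀ x t, dU (C.U 0) (fun x _ => -C.h₀ + C.hBot x) x t = C.U 0 * deriv C.hBot x :=
    dU_bot C _
  have eb : ∀ k x : ℝ, k * (-C.h₀ + C.hBot x) = -(k * (C.h₀ - C.hBot x)) := fun k x => by ring
  simp only [eT] at top
  simp only [eB, eb, Real.sinh_neg, Real.cosh_neg, mul_neg, ofReal_neg, sub_neg_eq_add] at bot
  have int_ceil : ∀ (j : ℕ) (hj : j + 1 < n),
      ceil C η ⟨j + 1, Nat.lt_succ_of_lt hj⟩ = η ⟨j + 1, hj⟩ := fun j hj =>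
    ceil_castSucc (C := C) (η := η) ⟨j + 1, hj⟩
  constructor
  · rintro ⟨hi, he⟩ i
    induction i using Fin.cases with
    | zero =>
      rw [ceil_zero]
      exact fun k => (bot.1 (fun k => ⟨(he k).bot₁, (he k).bot₂⟩) k).symm
    | succ j =>
      by_cases hj : j.val + 1 < n
      · have e : j.succ = ⟨j.val + 1, Nat.lt_succ_of_lt hj⟩ := rfl
        rw [e, int_ceil j hj]
        exact (internal j hj).1 fun k => ⟨(hi j hj k).eq₁, (hi j hj k).eq₂⟩
      · have e : j.succ = Fin.last n := by ext; simp; omega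
        rw [e, ceil_last, floor_last]
        exact top.1 fun k => ⟨(he k).top₁, (he k).top₂⟩
  · intro hM
    have h0 := hM 0
    have hl := hM (Fin.last n)
    rw [ceil_zero] at h0
    rw [ceil_last, floor_last] at hl
    have b := bot.2 fun k => (h0 k).symm
    have c := top.2 hl
    refine ⟨fun j hj k => ?_, fun k => ⟨(c k).1, (c k).2, (b k).1, (b k).2⟩⟩
    have hj' := hM ⟨j + 1, Nat.lt_succ_of_lt hj⟩
    rw [int_ceil j hj] at hj'
    have d := (internal j hj).2 hj' k
    exact ⟨d.1, d.2⟩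

end Stack

/-! ### Equivalence of the two problems -/

section Congr
variable {f g : ℝ → ℝ → ℝ} (h : ∀ x t, 0 < t → f x t = g x t)
include h

lemma dX_congr : ∀ x t, 0 < t → dX f x t = dX g x t := fun x t ht => by
  rw [dX, dX, funext fun y => h y t ht]

lemma dT_congr : ∀ x t, 0 < t → dT f x t = dT g x t := fun x t ht => by
  refine Filter.EventuallyEq.deriv_eq ?_
  filter_upwards [Ioi_mem_nhds ht] with s hs using h x s hs

lemma Vanishes.congr (hg : Vanishes g) : Vanishes f := fun t ht ε hε => by
  obtain ⟨δ, hδ, R, hR⟩ := hg t ht ε hε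
  exact ⟨δ, hδ, R, fun s x hs h1 h2 => by rw [h x s hs]; exact hR s x hs h1 h2⟩

lemma LocallyDominated.congr (hg : LocallyDominated g) : LocallyDominated f := fun t ht => by
  obtain ⟨G, hG, δ, hδ, hb⟩ := hg t ht
  exact ⟨G, hG, δ, hδ, fun s x hs h1 => by rw [h x s hs]; exact hb s x hs h1⟩

lemma TraceClass.congr (hg : TraceClass g) : TraceClass f where
  contDiffOn := hg.contDiffOn.congr fun p hp => h p.1 p.2 hp.2
  vanishes := hg.vanishes.congr h
  dT_vanishes := hg.dT_vanishes.congr (dT_congr h)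
  dX_class := ⟨hg.dX_class.1.congr (dX_congr h), hg.dX_class.2.congr (dX_congr h)⟩
  dXX_class := ⟨hg.dXX_class.1.congr (dX_congr (dX_congr h)),
    hg.dXX_class.2.congr (dX_congr (dX_congr h))⟩
  dTX_class := ⟨hg.dTX_class.1.congr (dT_congr (dX_congr h)),
    hg.dTX_class.2.congr (dT_congr (dX_congr h))⟩

end Congr

section Equivalence
variable {n : ℕ} {C : Channel n} {η : Fin n → ℝ → ℝ → ℝ} {φ : Fin (n + 1) → ℝ × ℝ × ℝ → ℝ}
  {ξp ξm : Fin (n + 1) → ℝ → ℝ → ℝ}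

lemma IsSolution.layerFlow (S : IsSolution C η φ) (i : Fin (n + 1)) :
    LayerFlow (floor C η i) (ceil C η i) (C.U i) (φ i) where
  contDiffOn := S.contDiffOn i
  vanishes := S.vanishes i
  pX_vanishes := S.pX_vanishes i
  pY_vanishes := S.pY_vanishes i
  pT_vanishes := S.pT_vanishes i
  harmonic := S.harmonic i
  normal_lower x t ht := by
    change normalVelocity C η φ i (floor C η i) x t = _
    induction i using Fin.cases with
    | zero => rw [floor_zero, dT_bot]; exact S.neumann_bot x t ht
    | succ j => exact S.kinematic_above j x t ht
  normal_upper x t ht := by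
    change normalVelocity C η φ i (ceil C η i) x t = _
    induction i using Fin.lastCases with
    | last => rw [ceil_last, dT_top]; exact S.neumann_top x t ht
    | cast j => rw [ceil_castSucc]; exact S.kinematic_below j x t ht

/-- Flows in all layers with the boundary potentials `ξ` satisfy the surface formulas. -/
lemma surfaceFormulas_of_layerFlow (hη : AdmissiblePlates C η)
    (F : ∀ i, LayerFlow (floor C η i) (ceil C η i) (C.U i) (φ i)) (hT : HasTraces C η φ ξp ξm)
    (j : Fin n) {x t : ℝ} (ht : 0 < t) : SurfaceFormulas C η φ ξp ξm j x t := by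
  have up : ∀ i, pX (closedLayer C η i) (φ i) (x, ceil C η i x t, t)
        = surfX (C.U i) (ceil C η i) (ξp i) x t ∧
      pY (closedLayer C η i) (φ i) (x, ceil C η i x t, t)
        = surfY (C.U i) (ceil C η i) (ξp i) x t ∧
      pT (closedLayer C η i) (φ i) (x, ceil C η i x t, t)
        = surfT (C.U i) (ceil C η i) (ξp i) x t := fun i =>
    (F i).surf_upper (hη.orderedC1 i) (fun x t ht => (hT i x t ht).1) ht x
  have low : ∀ i, pX (closedLayer C η i) (φ i) (x, floor C η i x t, t)
        = surfX (C.U i) (floor C η i) (ξm i) x t ∧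
      pY (closedLayer C η i) (φ i) (x, floor C η i x t, t)
        = surfY (C.U i) (floor C η i) (ξm i) x t ∧
      pT (closedLayer C η i) (φ i) (x, floor C η i x t, t)
        = surfT (C.U i) (floor C η i) (ξm i) x t := fun i =>
    (F i).surf_lower (hη.orderedC1 i) (fun x t ht => (hT i x t ht).2) ht x
  have u := up j.castSucc
  have l := low j.succ
  rw [ceil_castSucc] at u
  rw [floor_succ] at l
  exact ⟨u.1, u.2.1, u.2.2, l.1, l.2.1, l.2.2⟩

lemma SurfaceFormulas.bernoulli_below {j : Fin n} {x t : ℝ}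
    (h : SurfaceFormulas C η φ ξp ξm j x t) : bernoulliTerm C η φ j.castSucc (η j) x t
      = surfBernoulli (C.U j.castSucc) (η j) (ξp j.castSucc) x t := by
  rw [bernoulliTerm, surfBernoulli, h.below_x, h.below_y, h.below_t]

lemma SurfaceFormulas.bernoulli_above {j : Fin n} {x t : ℝ}
    (h : SurfaceFormulas C η φ ξp ξm j x t) : bernoulliTerm C η φ j.succ (η j) x t
      = surfBernoulli (C.U j.succ) (η j) (ξm j.succ) x t := by
  rw [bernoulliTerm, surfBernoulli, h.above_x, h.above_y, h.above_t]

/-- A solution of the free-boundary problem yields one of the non-local problem. -/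
theorem IsSolution.isNonlocalSolution (S : IsSolution C η φ) :
    IsNonlocalSolution C η (traceAbove C η φ) (traceBelow C η φ) := by
  have hT : HasTraces C η φ (traceAbove C η φ) (traceBelow C η φ) := fun _ _ _ _ => ⟨rfl, rfl⟩
  have hM := fun (t : ℝ) (ht : 0 < t) => (nonlocal_iff_moments S.plates S.traceAbove_class
    S.traceBelow_class ht).2 fun i k => by
      obtain ⟨la, ha⟩ := S.plates.floor_class i
      obtain ⟨lb, hb⟩ := S.plates.ceil_class i
      exact ((S.layerFlow i).layerData ha hb (S.plates.ordered i) (S.traceBelow_class i)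
        (S.traceAbove_class i) (fun _ _ _ => rfl) fun _ _ _ => rfl).moment t ht k
  exact
  { plates := S.plates
    ξp_class := S.traceAbove_class
    ξm_class := S.traceBelow_class
    internal := fun j hj t ht => (hM t ht).1 j hj
    external := fun t ht => (hM t ht).2
    beam := fun j x t ht => by
      have h := surfaceFormulas_of_layerFlow S.plates S.layerFlow hT j (x := x) ht
      rw [← h.bernoulli_below, ← h.bernoulli_above]
      exact S.beam j x t ht }

lemma IsNonlocalSolution.layerData (S : IsNonlocalSolution C η ξp ξm) (i : Fin (n + 1)) :
    LayerData (floor C η i) (ceil C η i) (ξm i) (ξp i) (C.U i) where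
  lower := S.plates.floor_class i
  upper := S.plates.ceil_class i
  lt := S.plates.ordered i
  traceLower := S.ξm_class i
  traceUpper := S.ξp_class i
  moment t ht := (nonlocal_iff_moments S.plates S.ξp_class S.ξm_class ht).1
    ⟨fun j hj => S.internal j hj t ht, S.external t ht⟩ i

/-- Flows in all layers with the boundary potentials of a solution of the non-local problem form a
solution of the free-boundary problem. -/
lemma IsNonlocalSolution.isSolution (S : IsNonlocalSolution C η ξp ξm)
    (F : ∀ i, LayerFlow (floor C η i) (ceil C η i) (C.U i) (φ i)) (hT : HasTraces C η φ ξp ξm) :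
    IsSolution C η φ where
  plates := S.plates
  contDiffOn i := (F i).contDiffOn
  vanishes i := (F i).vanishes
  pX_vanishes i := (F i).pX_vanishes
  pY_vanishes i := (F i).pY_vanishes
  pT_vanishes i := (F i).pT_vanishes
  traceBelow_class i := (S.ξm_class i).congr fun x t ht => (hT i x t ht).2
  traceAbove_class i := (S.ξp_class i).congr fun x t ht => (hT i x t ht).1
  harmonic i := (F i).harmonic
  kinematic_below j x t ht := by
    have h : normalVelocity C η φ j.castSucc (ceil C η j.castSucc) x t
      = dT (ceil C η j.castSucc) x t := (F j.castSucc).normal_upper x t ht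
    rwa [ceil_castSucc] at h
  kinematic_above j x t ht := (F j.succ).normal_lower x t ht
  beam j x t ht := by
    have h := surfaceFormulas_of_layerFlow S.plates F hT j (x := x) ht
    rw [h.bernoulli_below, h.bernoulli_above]
    exact S.beam j x t ht
  neumann_top x t ht := by
    have h : normalVelocity C η φ (Fin.last n) (ceil C η (Fin.last n)) x t
      = dT (ceil C η (Fin.last n)) x t := (F (Fin.last n)).normal_upper x t ht
    rwa [ceil_last, dT_top] at h
  neumann_bot x t ht := by
    have h : normalVelocity C η φ 0 (floor C η 0) x t = dT (floor C η 0) x t :=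
      (F 0).normal_lower x t ht
    rwa [floor_zero, dT_bot] at h

/-- Two solutions of the free-boundary problem with the same boundary potentials agree. -/
theorem IsSolution.eqOn {φ' : Fin (n + 1) → ℝ × ℝ × ℝ → ℝ} (S : IsSolution C η φ)
    (S' : IsSolution C η φ') (hT : HasTraces C η φ ξp ξm) (hT' : HasTraces C η φ' ξp ξm)
    (i : Fin (n + 1)) : EqOn (φ i) (φ' i) (closedLayer C η i) := by
  obtain ⟨la, ha⟩ := S.plates.floor_class i
  obtain ⟨lb, hb⟩ := S.plates.ceil_class i
  exact (S.layerFlow i).eqOn (S'.layerFlow i) (S.plates.orderedC1 i) ha.lb hb.lb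
    (fun x t ht => (hT i x t ht).2) (fun x t ht => (hT i x t ht).1)
    (fun x t ht => (hT' i x t ht).2) (fun x t ht => (hT' i x t ht).1)

/-- A solution of the non-local problem comes from a solution of the free-boundary problem. -/
theorem IsNonlocalSolution.exists_isSolution (S : IsNonlocalSolution C η ξp ξm) :
    ∃ φ : Fin (n + 1) → ℝ × ℝ × ℝ → ℝ, IsSolution C η φ ∧ HasTraces C η φ ξp ξm := by
  have hT : HasTraces C η (fun i => potential (floor C η i) (ceil C η i) (ξm i) (ξp i) (C.U i))
      ξp ξm := fun i x t ht =>
    ⟨(S.layerData i).potential_upper ht, LayerData.potential_lower x t⟩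
  exact ⟨_, S.isSolution (fun i => (S.layerData i).layerFlow_potential) hT, hT⟩

end Equivalence

end FluidPlates

end

theorem mainTheorem4 {n : ℕ} (C : FluidPlates.Channel n) (η : Fin n → ℝ → ℝ → ℝ) :
    (∀ φ : Fin (n + 1) → ℝ × ℝ × ℝ → ℝ, FluidPlates.IsSolution C η φ →
      FluidPlates.IsNonlocalSolution C η
        (FluidPlates.traceAbove C η φ) (FluidPlates.traceBelow C η φ) ∧
      ∀ (j : Fin n) (x t : ℝ), 0 < t →
        FluidPlates.SurfaceFormulas C η φ
          (FluidPlates.traceAbove C η φ) (FluidPlates.traceBelow C η φ) j x t) ∧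
    (∀ ξp ξm : Fin (n + 1) → ℝ → ℝ → ℝ, FluidPlates.IsNonlocalSolution C η ξp ξm →
      ∃ φ : Fin (n + 1) → ℝ × ℝ × ℝ → ℝ,
        FluidPlates.IsSolution C η φ ∧ FluidPlates.HasTraces C η φ ξp ξm ∧
        ∀ φ' : Fin (n + 1) → ℝ × ℝ × ℝ → ℝ,
          FluidPlates.IsSolution C η φ' → FluidPlates.HasTraces C η φ' ξp ξm →
          ∀ i, Set.EqOn (φ' i) (φ i) (FluidPlates.closedLayer C η i)) := by
  refine ⟨fun φ S => ⟨S.isNonlocalSolution, fun j x t ht =>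
    FluidPlates.surfaceFormulas_of_layerFlow S.plates S.layerFlow (fun _ _ _ _ => ⟨rfl, rfl⟩) j ht⟩,
    fun ξp ξm S => ?_⟩
  obtain ⟨φ, hS, hT⟩ := S.exists_isSolution
  exact ⟨φ, hS, hT, fun φ' hS' hT' => hS'.eqOn hS hT' hT⟩
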